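/- Throughout, graphs are finite and simple. A plane graph is a connected planar graph drawn in the plane; the length of a face is the length of its boundary walk, the outer face included. A graph is 3-connected if it has more than three vertices and stays connected after the removal of any at most two vertices. A pentagulation of an $n$-gon with $p$ pentagons is a plane graph that has one face of length $n$ bounded by a simple cycle, and whose other faces, $p$ in number, all have length $5$. A plane triangulation is a plane graph all of whose faces have length $3$. **Theorem.** Let $n\ge 3$, $n\ne 5$. There exists a $3$-connected pentagulation of an $n$-gon with exactly $n+10$ pentagons if and only if there exists a plane triangulation $H$ containing one of the following five subgraphs (not necessarily induced), where all vertices of the subgraph are distinct, the numbers are the degrees of its vertices in $H$, a dash is an edge, and $\oplus$ is a vertex-disjoint union, such that all vertices of $H$ outside the subgraph have degree $5$: (i) $\;(6-6)\oplus(6-6)\oplus(n)$, two disjoint edges and a further single vertex; (ii) $\;(6-7-6)\oplus(n)$, a path with two edges and a further single vertex; (iii) $\;(6-6)\oplus(6-(n+1))$, two disjoint edges; (iv) $\;6-7-(n+1)$, a path with two edges; (v) $\;6-(n+2)-6$, a path with two edges. -/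

import Mathlib

/-- A rotation system (combinatorial map): a simple graph together with a cyclic order of the
darts (oriented edges) leaving each vertex. `rot` sends a dart to the next dart around its
starting vertex. -/
structure RotationSystem (V : Type*) where
  graph : SimpleGraph V
  rot : Equiv.Perm graph.Dart
  rot_fst : ∀ d, (rot d).fst = d.fst
  rot_sameCycle : ∀ d e, d.fst = e.fst → rot.SameCycle d e

namespace RotationSystem

variable {V : Type*} (M : RotationSystem V)

/-- Walking along a face: traverse the dart `d = (u, v)`, then turn at `v` into the dart that
follows `(v, u)` in the rotation at `v`. -/
def facePerm : Equiv.Perm M.graph.Dart :=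
  (SimpleGraph.Dart.symm_involutive (G := M.graph)).toPerm.trans M.rot

/-- The faces are the orbits of the face permutation. -/
def Face : Type _ :=
  Quotient (Equiv.Perm.SameCycle.setoid M.facePerm)

/-- The face whose boundary walk passes through the dart `d`. -/
def faceOf (d : M.graph.Dart) : M.Face :=
  Quotient.mk (Equiv.Perm.SameCycle.setoid M.facePerm) d

/-- The darts of the boundary walk of a face. -/
def boundary (f : M.Face) : Set M.graph.Dart :=
  {d | M.faceOf d = f}

/-- The length of a face: the number of steps of its boundary walk. -/
noncomputable def faceLength (f : M.Face) : ℕ :=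
  (M.boundary f).ncard

/-- The boundary walk of the face does not visit a vertex twice, so (having at least three
steps) it is a simple cycle of the graph. -/
def IsBoundedByCycle (f : M.Face) : Prop :=
  Set.InjOn (fun d : M.graph.Dart => d.fst) (M.boundary f)

end RotationSystem

/-- A connected plane graph, up to homeomorphism of the sphere: a connected finite simple graph
(with at least one edge) with a rotation system that satisfies Euler's formula, that is, whose
associated closed surface is the sphere. -/
structure PlaneGraph (V : Type*) [Finite V] extends RotationSystem V where
  connected : graph.Connected
  euler : (Nat.card V : ℤ) - (Nat.card graph.edgeSet : ℤ) + (Nat.card toRotationSystem.Face : ℤ) = 2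

namespace PlaneGraph

variable {V : Type*} [Finite V]

/-- A plane triangulation: every face, including the outer one, is a triangle. -/
def IsTriangulation (M : PlaneGraph V) : Prop :=
  ∀ f : M.Face, M.faceLength f = 3

/-- `M` is a pentagulation of an `n`-gon with `p` pentagons: one face has length `n` and is
bounded by a simple cycle, and the other faces, `p` in number, all have length five. -/
def IsPentagulation (M : PlaneGraph V) (n p : ℕ) : Prop :=
  ∃ f₀ : M.Face, M.faceLength f₀ = n ∧ M.IsBoundedByCycle f₀ ∧
    (∀ f : M.Face, f ≠ f₀ → M.faceLength f = 5) ∧ Nat.card {f : M.Face // f ≠ f₀} = p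

end PlaneGraph

namespace SimpleGraph

/-- `G` is `k`-connected: it has more than `k` vertices, and removing at most `k - 1` vertices
leaves a connected graph. -/
def IsVertexConnected {V : Type*} (G : SimpleGraph V) (k : ℕ) : Prop :=
  k < Nat.card V ∧ ∀ S : Finset V, S.card < k → (G.induce {v | v ∉ S}).Connected

/-- `H` contains a (not necessarily induced) subgraph isomorphic to `P` in which the vertex
corresponding to `w` has degree `label w` in `H`, and all vertices of `H` that are not in this
subgraph have degree `5`. -/
def HasLabelledSubgraph {V W : Type*} (H : SimpleGraph V) (P : SimpleGraph W)
    (label : W → ℕ) : Prop :=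
  ∃ φ : SimpleGraph.Copy P H,
    (∀ w, (H.neighborSet (φ w)).ncard = label w) ∧
    ∀ v, v ∉ Set.range φ → (H.neighborSet v).ncard = 5

end SimpleGraph

open Function

/-! ### Cycles of a permutation of a finite type -/

namespace Equiv.Perm

variable {D : Type*} (π : Equiv.Perm D)

/-! Pass to the dual. A pentagulation with `n + 10` pentagons becomes a plane map with `n + 11`
vertices, one vertex `N` of degree `n` and the others of degree five. It has `6 * n + 50` darts, so
Euler's formula gives `2 * n + 16` faces, and the face lengths exceed three by two in total: all
faces are triangles except for two quadrangles or one pentagon (`DartMap.IsNear`,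
`DartMap.faces_of_card`). Two diagonals complete such a map to a triangulation, and deleting two
edges leads back. The five labelled subgraphs list the possible positions of two edges relative to
each other and to `N` (`SimpleGraph.TwoEdges`, `SimpleGraph.HasPattern`). What remains is to control
3-connectedness in both directions.

From the pentagulation to the triangulation, 3-connectedness has to make the dual simple and free of
chords of its faces, so that the new diagonals create no parallel edges. Instead of the Jordan curve
theorem, the argument uses homology modulo two: on the sphere, an edge set that meets every face
evenly is a cut (`PlaneGraph.exists_potential`, a dimension count based on Euler's formula). If two
faces around a vertex `v` coincide, or share an edge that they should not share, then a closed curve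
through `v` crosses such an edge set, all of whose edges contain `v` or one further vertex `w`. The
cut then separates neighbours of `v` after the removal of `v` and `w`.

From the triangulation to the pentagulation, one has to show that two faces `f` and `g` of the
near-triangulation never separate the other faces (`DartMap.false_of_cut`). Suppose that they
separate `P` from `Q`. The map is simple, so each of `P`, `Q`, `P ∪ f`, `P ∪ g` has at least three
boundary edges, whereas `f` and `g` have total length at most eight. Counting (`DartMap.cut_arith`)
leaves two possibilities. Either some face set has exactly three boundary edges, two of them on a
face of length at least four, an ear; or `f` and `g` are both quadrangles with two edges on each
side, a lens. In both situations the rest of the sphere consists of two regions with short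
boundaries, and `N` is strictly inside at most one of them. In a suitable region the condition of
degree five determines the neighbourhoods one vertex after another, until some vertex is forced to
have degree three or four (`Ear.false_of_quad`, `Ear.false_of_pentagon`, `DartMap.false_of_lens`).
-/

theorem sameCycle_iterate (d : D) (i : ℕ) : π.SameCycle d (π^[i] d) :=
  ⟨i, by rw [iterate_eq_pow]; rfl⟩

theorem sameCycle_apply_self (d : D) : π.SameCycle d (π d) := ⟨1, by simp⟩

variable [Finite D]

theorem minimalPeriod_pos (d : D) : 0 < minimalPeriod π d :=
  minimalPeriod_pos_of_mem_periodicPts (π.injective.mem_periodicPts d)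

theorem sameCycle_iff_exists_iterate {d e : D} :
    π.SameCycle d e ↔ ∃ i < minimalPeriod π d, π^[i] d = e := by
  constructor
  · intro h
    obtain ⟨i, rfl⟩ := h.exists_nat_pow_eq
    refine ⟨i % minimalPeriod π d, Nat.mod_lt _ (π.minimalPeriod_pos d), ?_⟩
    rw [iterate_mod_minimalPeriod_eq, iterate_eq_pow]
  · rintro ⟨i, -, rfl⟩
    exact ⟨i, by rw [iterate_eq_pow]; rfl⟩

theorem ncard_sameCycle (d : D) : {e | π.SameCycle d e}.ncard = minimalPeriod π d := by
  have : {e | π.SameCycle d e} = (fun i => π^[i] d) '' Set.Iio (minimalPeriod π d) := by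
    ext e
    simp [sameCycle_iff_exists_iterate]
  rw [this, iterate_injOn_Iio_minimalPeriod.ncard_image]
  simp [Set.ncard_eq_toFinset_card']

theorem SameCycle.minimalPeriod_eq {d e : D} (h : π.SameCycle d e) :
    minimalPeriod π e = minimalPeriod π d := by
  rw [← ncard_sameCycle, ← ncard_sameCycle]
  congr 1
  ext x
  exact ⟨fun h' => h.trans h', fun h' => h.symm.trans h'⟩

/-- A predicate preserved by the permutation is constant on cycles. -/
theorem SameCycle.induction {K : D → Prop} (hK : ∀ d, K d → K (π d)) {d e : D}
    (h : π.SameCycle d e) (hd : K d) : K e := by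
  obtain ⟨i, -, rfl⟩ := π.sameCycle_iff_exists_iterate.1 h
  induction i with
  | zero => exact hd
  | succ i ih => rw [iterate_succ_apply']; exact hK _ (ih (π.sameCycle_iterate d i))

theorem minimalPeriod_eq_of_iterate {d : D} {k : ℕ} (hk : 0 < k) (h : π^[k] d = d)
    (h' : ∀ i, 0 < i → i < k → π^[i] d ≠ d) : minimalPeriod π d = k := by
  have h1 : minimalPeriod π d ≤ k := IsPeriodicPt.minimalPeriod_le hk h
  by_contra hne
  exact h' _ (π.minimalPeriod_pos d) (lt_of_le_of_ne h1 hne) (isPeriodicPt_minimalPeriod π d)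

/-- The number of points is the sum of the cycle lengths over the cycles. -/
theorem card_eq_sum_cycles [Fintype (Quotient (SameCycle.setoid π))] :
    Nat.card D = ∑ q : Quotient (SameCycle.setoid π), minimalPeriod π q.out := by
  classical
  have := Fintype.ofFinite D
  rw [Nat.card_congr (Equiv.sigmaFiberEquiv
    (fun d : D => (Quotient.mk (SameCycle.setoid π) d))).symm, Nat.card_sigma]
  refine Finset.sum_congr rfl fun q _ => ?_
  rw [← ncard_sameCycle, ← Nat.card_coe_set_eq]
  refine Nat.card_congr (Equiv.subtypeEquivRight fun d => ?_)
  conv_lhs => rw [← Quotient.out_eq q]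
  rw [Quotient.eq]
  exact ⟨fun h => h.symm, fun h => h.symm⟩

end Equiv.Perm

/-! ### Dart maps -/

theorem RotationSystem.faceOf_eq_iff {V : Type*} (R : RotationSystem V) {d e : R.graph.Dart} :
    R.faceOf d = R.faceOf e ↔ R.facePerm.SameCycle d e :=
  Quotient.eq

/-- A connected rotation system of a simple graph on an abstract set `D` of darts: `tail d` is the
starting vertex of `d`, `inv d` the reversed dart, `rot d` the next dart around `tail d`. -/
structure DartMap (V D : Type*) where
  rot : Equiv.Perm D
  inv : Equiv.Perm D
  tail : D → V
  inv_inv : ∀ d, inv (inv d) = d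
  tail_rot : ∀ d, tail (rot d) = tail d
  sameCycle : ∀ d e, tail d = tail e → rot.SameCycle d e
  tail_inv_ne : ∀ d, tail (inv d) ≠ tail d
  dart_ext : ∀ d e, tail d = tail e → tail (inv d) = tail (inv e) → d = e
  surj : Surjective tail
  conn : ∀ K : D → Prop, (∀ d, K d → K (rot d)) → (∀ d, K d → K (inv d)) → ∀ d e, K d → K e

namespace DartMap

variable {V D : Type*} (M : DartMap V D)

/-- The next dart along the boundary walk of a face. -/
def face : Equiv.Perm D := M.inv.trans M.rot

theorem face_apply (d : D) : M.face d = M.rot (M.inv d) := rfl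

theorem face_inv (d : D) : M.face (M.inv d) = M.rot d := by rw [face_apply, M.inv_inv]

theorem tail_face (d : D) : M.tail (M.face d) = M.tail (M.inv d) := by
  rw [face_apply, M.tail_rot]

/-- The number of darts that leave a vertex. -/
noncomputable def deg (v : V) : ℕ := {d | M.tail d = v}.ncard

/-- The number of darts of the face through a dart. -/
noncomputable def faceLen (d : D) : ℕ := minimalPeriod M.face d

/-- The faces of a dart map. -/
abbrev FaceSet : Type _ := Quotient (Equiv.Perm.SameCycle.setoid M.face)

theorem inv_ne (d : D) : M.inv d ≠ d := fun h => M.tail_inv_ne d (by rw [h])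

theorem inv_eq_iff {d e : D} : M.inv d = e ↔ d = M.inv e :=
  ⟨fun h => by rw [← h, M.inv_inv], fun h => by rw [h, M.inv_inv]⟩

theorem tail_eq_iff {d e : D} : M.tail d = M.tail e ↔ M.rot.SameCycle d e := by
  refine ⟨M.sameCycle d e, ?_⟩
  rintro ⟨i, rfl⟩
  induction i using Int.induction_on with
  | zero => rfl
  | succ i ih => rw [add_comm, zpow_add, Equiv.Perm.mul_apply, zpow_one, M.tail_rot, ih]
  | pred i ih =>
    have h := M.tail_rot ((M.rot ^ (-(i : ℤ) - 1)) d)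
    rw [← Equiv.Perm.mul_apply, ← zpow_one_add] at h
    rw [← h, ih]
    congr 2
    ring_nf

theorem minimalPeriod_rot [Finite D] (d : D) : minimalPeriod M.rot d = M.deg (M.tail d) := by
  rw [deg, ← Equiv.Perm.ncard_sameCycle]
  congr 1
  ext e
  exact ⟨fun h => (M.tail_eq_iff.2 h).symm, fun h => M.tail_eq_iff.1 (Eq.symm h)⟩

/-- The graph on the vertices of a dart map. -/
def graph : SimpleGraph V where
  Adj u v := ∃ d, M.tail d = u ∧ M.tail (M.inv d) = v
  symm := ⟨fun _ _ ⟨d, h, h'⟩ => ⟨M.inv d, h', by rw [M.inv_inv, h]⟩⟩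
  loopless := ⟨fun _ ⟨d, h, h'⟩ => M.tail_inv_ne d (h'.trans h.symm)⟩

theorem adj_tail (d : D) : M.graph.Adj (M.tail d) (M.tail (M.inv d)) := ⟨d, rfl, rfl⟩

/-- The abstract darts are the darts of the graph. -/
noncomputable def dartEquiv : D ≃ M.graph.Dart :=
  Equiv.ofBijective (fun d => ⟨(M.tail d, M.tail (M.inv d)), M.adj_tail d⟩) <| by
    constructor
    · intro d e h
      rw [SimpleGraph.Dart.ext_iff, Prod.ext_iff] at h
      exact M.dart_ext d e h.1 h.2
    · rintro ⟨⟨u, v⟩, h⟩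
      obtain ⟨d, rfl, rfl⟩ := id h
      exact ⟨d, rfl⟩

@[simp] theorem dartEquiv_fst (d : D) : (M.dartEquiv d).fst = M.tail d := rfl

@[simp] theorem dartEquiv_snd (d : D) : (M.dartEquiv d).snd = M.tail (M.inv d) := rfl

theorem dartEquiv_inv (d : D) : M.dartEquiv (M.inv d) = (M.dartEquiv d).symm := by
  apply SimpleGraph.Dart.ext
  change (_, _) = (_, _)
  simp [M.inv_inv]

/-- The rotation system of a dart map. -/
noncomputable abbrev toRotationSystem : RotationSystem V where
  graph := M.graph
  rot := M.dartEquiv.permCongr M.rot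
  rot_fst d := by
    obtain ⟨d, rfl⟩ := M.dartEquiv.surjective d
    simp [M.tail_rot]
  rot_sameCycle d e h := by
    obtain ⟨d, rfl⟩ := M.dartEquiv.surjective d
    obtain ⟨e, rfl⟩ := M.dartEquiv.surjective e
    obtain ⟨i, rfl⟩ := M.sameCycle d e h
    refine ⟨i, ?_⟩
    have : M.dartEquiv.permCongr M.rot ^ i = M.dartEquiv.permCongr (M.rot ^ i) :=
      (map_zpow M.dartEquiv.permCongrHom M.rot i).symm
    rw [this]
    simp

theorem toRotationSystem_facePerm :
    M.toRotationSystem.facePerm = M.dartEquiv.permCongr M.face := by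
  ext1 d
  obtain ⟨d, rfl⟩ := M.dartEquiv.surjective d
  change M.dartEquiv.permCongr M.rot (M.dartEquiv d).symm = _
  rw [← dartEquiv_inv, Equiv.permCongr_apply, Equiv.permCongr_apply, Equiv.symm_apply_apply,
    Equiv.symm_apply_apply]
  rfl

theorem toRotationSystem_faceOf_eq_iff {d e : D} :
    M.toRotationSystem.faceOf (M.dartEquiv d) = M.toRotationSystem.faceOf (M.dartEquiv e) ↔
      M.face.SameCycle d e := by
  rw [RotationSystem.faceOf_eq_iff, toRotationSystem_facePerm]
  refine exists_congr fun i => ?_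
  have : M.dartEquiv.permCongr M.face ^ i = M.dartEquiv.permCongr (M.face ^ i) :=
    (map_zpow M.dartEquiv.permCongrHom M.face i).symm
  rw [this]
  simp

theorem toRotationSystem_boundary (d : D) :
    M.toRotationSystem.boundary (M.toRotationSystem.faceOf (M.dartEquiv d)) =
      M.dartEquiv '' {e | M.face.SameCycle d e} := by
  ext e
  obtain ⟨e, rfl⟩ := M.dartEquiv.surjective e
  rw [M.dartEquiv.injective.mem_set_image]
  change _ = _ ↔ _
  rw [toRotationSystem_faceOf_eq_iff]
  exact Equiv.Perm.sameCycle_comm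

theorem toRotationSystem_faceLength [Finite D] (d : D) :
    M.toRotationSystem.faceLength (M.toRotationSystem.faceOf (M.dartEquiv d)) = M.faceLen d := by
  rw [RotationSystem.faceLength, toRotationSystem_boundary,
    Set.ncard_image_of_injective _ M.dartEquiv.injective, Equiv.Perm.ncard_sameCycle, faceLen]

/-- The faces of the rotation system of a dart map. -/
noncomputable def faceEquiv : M.FaceSet ≃ M.toRotationSystem.Face :=
  Quotient.congr M.dartEquiv fun d e => by
    change _ ↔ (M.toRotationSystem.facePerm).SameCycle _ _
    exact M.toRotationSystem_faceOf_eq_iff.symm.trans (RotationSystem.faceOf_eq_iff _)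

theorem exists_faceOf (f : M.toRotationSystem.Face) :
    ∃ d, f = M.toRotationSystem.faceOf (M.dartEquiv d) := by
  obtain ⟨d, rfl⟩ := Quotient.exists_rep f
  obtain ⟨d, rfl⟩ := M.dartEquiv.surjective d
  exact ⟨d, rfl⟩

theorem ncard_neighborSet (v : V) : (M.graph.neighborSet v).ncard = M.deg v := by
  have : M.graph.neighborSet v = (fun d => M.tail (M.inv d)) '' {d | M.tail d = v} := by
    ext w
    rfl
  rw [this, Set.InjOn.ncard_image, deg]
  rintro d rfl e he h
  exact M.dart_ext _ _ (Eq.symm he) h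

theorem graph_connected [Nonempty V] : M.graph.Connected := by
  obtain ⟨v⟩ := ‹Nonempty V›
  obtain ⟨d, rfl⟩ := M.surj v
  refine SimpleGraph.connected_iff_exists_forall_reachable _ |>.2 ⟨M.tail d, fun w => ?_⟩
  obtain ⟨e, rfl⟩ := M.surj w
  refine M.conn (fun e => M.graph.Reachable (M.tail d) (M.tail e)) ?_ ?_ d e .rfl
  · intro e h
    rwa [M.tail_rot]
  · intro e h
    exact h.trans (M.adj_tail e).reachable

theorem two_mul_card_edgeSet {V : Type*} [Finite V] (G : SimpleGraph V) :
    2 * Nat.card G.edgeSet = Nat.card G.Dart := by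
  classical
  have := Fintype.ofFinite V
  rw [Nat.card_eq_fintype_card, Nat.card_eq_fintype_card, G.dart_card_eq_twice_card_edges,
    SimpleGraph.edgeFinset_card]

/-- A dart map that satisfies Euler's formula is a plane graph. -/
noncomputable def toPlaneGraph [Finite V] [Nonempty V]
    (h : 2 * Nat.card V + 2 * Nat.card M.FaceSet = Nat.card D + 4) : PlaneGraph V where
  toRotationSystem := M.toRotationSystem
  connected := M.graph_connected
  euler := by
    have h1 := two_mul_card_edgeSet M.graph
    rw [← Nat.card_congr M.dartEquiv] at h1
    have h2 := Nat.card_congr M.faceEquiv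
    change (Nat.card V : ℤ) - (Nat.card M.graph.edgeSet : ℤ) + _ = 2
    omega

theorem finite_dart {V : Type*} [Finite V] (G : SimpleGraph V) : Finite G.Dart :=
  Finite.of_injective _ SimpleGraph.Dart.toProd_injective

/-- Darts of a connected graph are connected through rotations and reversals. -/
theorem _root_.RotationSystem.dart_conn {V : Type*} [Finite V] (R : RotationSystem V)
    (hc : R.graph.Connected) (K : R.graph.Dart → Prop) (h1 : ∀ d, K d → K (R.rot d))
    (h2 : ∀ d, K d → K d.symm) : ∀ d e, K d → K e := by
  have := finite_dart R.graph
  intro d e hd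
  have key : ∀ v w, R.graph.Reachable v w → (∀ d, d.fst = v → K d) → ∀ d, d.fst = w → K d := by
    rintro v w ⟨p⟩
    induction p with
    | nil => exact id
    | cons hadj p ih =>
      intro hv
      refine ih fun d hd => ?_
      have := h2 ⟨(_, _), hadj⟩ (hv _ rfl)
      exact (R.rot_sameCycle _ _ (by exact hd.symm)).induction R.rot h1 this
  exact key d.fst e.fst (hc.preconnected _ _)
    (fun d' hd' => (R.rot_sameCycle _ _ hd'.symm).induction R.rot h1 hd) e rfl

/-- The dart map of a connected rotation system without isolated vertices. -/
def ofRotationSystem {V : Type*} [Finite V] (R : RotationSystem V) (hc : R.graph.Connected)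
    (hs : ∀ v, ∃ w, R.graph.Adj v w) : DartMap V R.graph.Dart where
  rot := R.rot
  inv := (SimpleGraph.Dart.symm_involutive (G := R.graph)).toPerm
  tail d := d.fst
  inv_inv d := d.symm_symm
  tail_rot := R.rot_fst
  sameCycle := R.rot_sameCycle
  tail_inv_ne d := d.snd_ne_fst
  dart_ext _ _ h h' := SimpleGraph.Dart.ext _ _ (Prod.ext h h')
  surj v := (hs v).elim fun w h => ⟨⟨(v, w), h⟩, rfl⟩
  conn := R.dart_conn hc

/-! ### Local structure -/

theorem face_sameCycle_face [Finite D] {d e : D} (h : M.face.SameCycle d e) :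
    M.faceLen e = M.faceLen d := h.minimalPeriod_eq

theorem faceLen_face [Finite D] (d : D) : M.faceLen (M.face d) = M.faceLen d :=
  M.face_sameCycle_face (M.face.sameCycle_apply_self d)

theorem iterate_faceLen (d : D) : M.face^[M.faceLen d] d = d := isPeriodicPt_minimalPeriod _ _

theorem face3 {d : D} (h : M.faceLen d = 3) : M.face (M.face (M.face d)) = d := by
  have := M.iterate_faceLen d
  rwa [h] at this

theorem face_ne (d : D) : M.face d ≠ d := fun h => by
  have := M.tail_face d
  rw [h] at this
  exact M.tail_inv_ne d this.symm

theorem face_face_ne (d : D) (hd : M.rot d ≠ d) : M.face (M.face d) ≠ d := fun h => by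
  have h1 := M.tail_face d
  have h2 := M.tail_face (M.face d)
  rw [h] at h2
  have : M.face d = M.inv d := M.dart_ext _ _ h1 (by rw [M.inv_inv, h2])
  rw [this, M.face_inv] at h
  exact hd h

theorem faceLen_eq_three [Finite D] {d : D} (h : M.face (M.face (M.face d)) = d) :
    M.faceLen d = 3 := by
  refine M.face.minimalPeriod_eq_of_iterate (by norm_num) h fun i h1 h2 h3 => ?_
  interval_cases i
  · exact M.face_ne d h3
  · have h3' : M.face (M.face d) = d := h3
    rw [h3'] at h
    exact M.face_ne d h

end DartMap

/-! ### Exploring triangulated discs with interior vertices of degree five -/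

/-- `R u a b` says that `b` follows `a` in the rotation at `u` (and possibly that the corner
between them lies in some region). -/
structure Corners {V : Type*} (R : V → V → V → Prop) : Prop where
  right : ∀ {u a b c}, R u a b → R u a c → b = c
  left : ∀ {u a b c}, R u a c → R u b c → a = b
  ne : ∀ {u a b}, R u a b → u ≠ a
  ne' : ∀ {u a b}, R u a b → u ≠ b
  asymm : ∀ {u a b}, R u a b → ¬ R u b a

/-- Corners of a region all of whose faces are triangles. -/
structure TriangleCorners {V : Type*} (R : V → V → V → Prop) : Prop extends Corners R where
  cyc : ∀ {u a b}, R u a b → R a b u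

/-- All corners at `u` lie in the region, and `u` has degree five. -/
def FiveAround {V : Type*} (R : V → V → V → Prop) (u : V) : Prop :=
  ∀ a b, R u a b → ∃ c d e, R u b c ∧ R u c d ∧ R u d e ∧ R u e a ∧
    a ≠ b ∧ a ≠ c ∧ a ≠ d ∧ a ≠ e ∧ b ≠ c ∧ b ≠ d ∧ b ≠ e ∧ c ≠ d ∧ c ≠ e ∧ d ≠ e

namespace Corners

variable {V : Type*} {R : V → V → V → Prop}

theorem reverse (h : Corners R) : Corners fun u a b => R u b a where
  right := h.left
  left := h.right
  ne := h.ne'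
  ne' := h.ne
  asymm h1 h2 := h.asymm h1 h2

theorem five4 (h : Corners R) {u a b c d e : V} (h5 : FiveAround R u) (h1 : R u a b)
    (h2 : R u b c) (h3 : R u c d) (h4 : R u d e) : R u e a ∧ a ≠ b ∧ a ≠ c ∧ a ≠ d ∧ a ≠ e ∧
      b ≠ c ∧ b ≠ d ∧ b ≠ e ∧ c ≠ d ∧ c ≠ e ∧ d ≠ e := by
  obtain ⟨c', d', e', g2, g3, g4, g5, hn⟩ := h5 a b h1
  obtain rfl := h.right g2 h2
  obtain rfl := h.right g3 h3
  obtain rfl := h.right g4 h4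
  exact ⟨g5, hn⟩

/-- The basic step of the exploration: once four consecutive neighbours of a vertex of degree five
are known, exactly one new neighbour closes up the rotation. The inequalities keep the vertices
found so far apart. -/
theorem five3 (h : Corners R) {u a b c d : V} (h5 : FiveAround R u) (h1 : R u a b)
    (h2 : R u b c) (h3 : R u c d) : ∃ e, R u d e ∧ R u e a ∧ a ≠ b ∧ a ≠ c ∧ a ≠ d ∧ a ≠ e ∧
      b ≠ c ∧ b ≠ d ∧ b ≠ e ∧ c ≠ d ∧ c ≠ e ∧ d ≠ e := by
  obtain ⟨c', d', e, g2, g3, g4, g5, hn⟩ := h5 a b h1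
  obtain rfl := h.right g2 h2
  obtain rfl := h.right g3 h3
  exact ⟨e, g4, g5, hn⟩

/-- A vertex with three or four corners around it does not have degree five. -/
theorem not_three (h : Corners R) {u a b c : V} (h5 : FiveAround R u) (h1 : R u a b)
    (h2 : R u b c) (h3 : R u c a) : False := by
  obtain ⟨e, -, -, hn⟩ := h.five3 h5 h1 h2 h3
  exact hn.2.2.1 rfl

theorem not_four (h : Corners R) {u a b c d : V} (h5 : FiveAround R u) (h1 : R u a b)
    (h2 : R u b c) (h3 : R u c d) (h4 : R u d a) : False :=
  (h.five4 h5 h1 h2 h3 h4).2.2.2.2.1 rfl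

end Corners

namespace TriangleCorners

variable {V : Type*} {R : V → V → V → Prop}

theorem cyc' (h : TriangleCorners R) {u a b : V} (h1 : R u a b) : R b u a := h.cyc (h.cyc h1)

theorem reverse (h : TriangleCorners R) : TriangleCorners fun u a b => R u b a where
  toCorners := h.toCorners.reverse
  cyc h1 := h.cyc' h1

/-- A triangulated triangle `v, p, q` with two edges inside at `p` and two at `q`, and nothing
assumed at `v`. The neighbourhoods of `w`, `z`, `y`, `r`, `s`, `t` are forced in turn, and the
vertex found last has only three corners. -/
theorem false_of_two_two (h : TriangleCorners R) {v p q z w y : V}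
    (h5 : ∀ u, u ≠ v → u ≠ p → u ≠ q → FiveAround R u)
    (hp : ∀ a b, R p a b ↔ (a = v ∧ b = z) ∨ (a = z ∧ b = w) ∨ (a = w ∧ b = q))
    (hq : ∀ a b, R q a b ↔ (a = p ∧ b = w) ∨ (a = w ∧ b = y) ∨ (a = y ∧ b = v))
    (hpn : [v, z, w, q].Nodup) (hqn : [p, w, y, v].Nodup) : False := by
  have ne := @h.ne
  have cyc := @h.cyc
  simp only [List.nodup_cons, List.mem_cons, List.not_mem_nil, or_false, not_or] at hpn hqn
  have p1 : R p v z := by grind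
  have p2 : R p z w := by grind
  have p3 : R p w q := by grind
  have q2 : R q w y := by grind
  have q3 : R q y v := by grind
  obtain ⟨r, w4, w5, wn⟩ := h.five3 (h5 w (by grind) (by grind) (by grind))
    (h.cyc q2) (h.cyc p3) (h.cyc' p2)
  obtain ⟨s, z4, z5, zn⟩ := h.five3 (h5 z (by grind) (by grind) (by grind))
    (h.cyc w4) (h.cyc p2) (h.cyc' p1)
  obtain ⟨t, y4, y5, yn⟩ := h.five3 (h5 y (by grind) (by grind) (by grind))
    (h.cyc q3) (h.cyc' q2) (h.cyc' w5)
  obtain ⟨r5, rn⟩ := h.five4 (h5 r (by grind) (by grind) (by grind))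
    (h.cyc y4) (h.cyc w5) (h.cyc' w4) (h.cyc' z5)
  obtain ⟨u, s4, s5, sn⟩ := h.five3 (h5 s (by grind) (by grind) (by grind))
    (h.cyc r5) (h.cyc z5) (h.cyc' z4)
  obtain ⟨u', t4, t5, tn⟩ := h.five3 (h5 t (by grind) (by grind) (by grind))
    (h.cyc y5) (h.cyc' y4) (h.cyc' r5)
  -- The triangle on the edge between `s` and `t` identifies their last neighbours, which closes up
  -- the exploration.
  obtain rfl := h.right t4 (h.cyc' s5)
  exact h.not_three (h5 u' (by grind) (by grind) (by grind)) (h.cyc' t4) (h.cyc' s4) (h.cyc t5)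

/-- The same exploration for one edge inside at `p` and three at `q`; again the last vertex has only
three corners. -/
theorem false_of_one_three (h : TriangleCorners R) {v p q z w y : V}
    (h5 : ∀ u, u ≠ v → u ≠ p → u ≠ q → FiveAround R u)
    (hp : ∀ a b, R p a b ↔ (a = v ∧ b = z) ∨ (a = z ∧ b = q))
    (hq : ∀ a b, R q a b ↔
      (a = p ∧ b = z) ∨ (a = z ∧ b = w) ∨ (a = w ∧ b = y) ∨ (a = y ∧ b = v))
    (hpn : [v, z, q].Nodup) (hqn : [p, z, w, y, v].Nodup) : False := by
  have ne := @h.ne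
  have cyc := @h.cyc
  simp only [List.nodup_cons, List.mem_cons, List.not_mem_nil, or_false, not_or] at hpn hqn
  have p1 : R p v z := by grind
  have p2 : R p z q := by grind
  have q2 : R q z w := by grind
  have q3 : R q w y := by grind
  have q4 : R q y v := by grind
  obtain ⟨s, z4, z5, zn⟩ := h.five3 (h5 z (by grind) (by grind) (by grind))
    (h.cyc q2) (h.cyc p2) (h.cyc' p1)
  obtain ⟨r, w4, w5, wn⟩ := h.five3 (h5 w (by grind) (by grind) (by grind))
    (h.cyc q3) (h.cyc' q2) (h.cyc' z5)
  obtain ⟨t, y4, y5, yn⟩ := h.five3 (h5 y (by grind) (by grind) (by grind))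
    (h.cyc q4) (h.cyc' q3) (h.cyc' w5)
  obtain ⟨u, s4, s5, sn⟩ := h.five3 (h5 s (by grind) (by grind) (by grind))
    (h.cyc w4) (h.cyc z5) (h.cyc' z4)
  obtain ⟨r5, rn⟩ := h.five4 (h5 r (by grind) (by grind) (by grind))
    (h.cyc y4) (h.cyc w5) (h.cyc' w4) (h.cyc' s5)
  obtain ⟨m, t4, t5, tn⟩ := h.five3 (h5 t (by grind) (by grind) (by grind))
    (h.cyc y5) (h.cyc' y4) (h.cyc' r5)
  obtain ⟨m', u4, u5, un⟩ := h.five3 (h5 u (by grind) (by grind) (by grind))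
    (h.cyc r5) (h.cyc s5) (h.cyc' s4)
  obtain rfl := h.right t4 (h.cyc' u5)
  exact h.not_three (h5 m (by grind) (by grind) (by grind)) (h.cyc u5) (h.cyc' u4) (h.cyc t5)

/-- The same exploration for two edges inside at `p` and three at `q`; here the last vertex has four
corners. -/
theorem false_of_two_three (h : TriangleCorners R) {v p q z w y x : V}
    (h5 : ∀ u, u ≠ v → u ≠ p → u ≠ q → FiveAround R u)
    (hp : ∀ a b, R p a b ↔ (a = v ∧ b = z) ∨ (a = z ∧ b = w) ∨ (a = w ∧ b = q))
    (hq : ∀ a b, R q a b ↔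
      (a = p ∧ b = w) ∨ (a = w ∧ b = y) ∨ (a = y ∧ b = x) ∨ (a = x ∧ b = v))
    (hpn : [v, z, w, q].Nodup) (hqn : [p, w, y, x, v].Nodup) : False := by
  have ne := @h.ne
  have cyc := @h.cyc
  simp only [List.nodup_cons, List.mem_cons, List.not_mem_nil, or_false, not_or] at hpn hqn
  have p1 : R p v z := by grind
  have p2 : R p z w := by grind
  have p3 : R p w q := by grind
  have q2 : R q w y := by grind
  have q3 : R q y x := by grind
  have q4 : R q x v := by grind
  obtain ⟨r, w4, w5, wn⟩ := h.five3 (h5 w (by grind) (by grind) (by grind))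
    (h.cyc q2) (h.cyc p3) (h.cyc' p2)
  obtain ⟨a, y4, y5, yn⟩ := h.five3 (h5 y (by grind) (by grind) (by grind))
    (h.cyc q3) (h.cyc' q2) (h.cyc' w5)
  obtain ⟨s, z4, z5, zn⟩ := h.five3 (h5 z (by grind) (by grind) (by grind))
    (h.cyc w4) (h.cyc p2) (h.cyc' p1)
  obtain ⟨b, x4, x5, xn⟩ := h.five3 (h5 x (by grind) (by grind) (by grind))
    (h.cyc q4) (h.cyc' q3) (h.cyc' y5)
  obtain ⟨r5, rn⟩ := h.five4 (h5 r (by grind) (by grind) (by grind))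
    (h.cyc y4) (h.cyc w5) (h.cyc' w4) (h.cyc' z5)
  obtain ⟨a5, an⟩ := h.five4 (h5 a (by grind) (by grind) (by grind))
    (h.cyc x4) (h.cyc y5) (h.cyc' y4) (h.cyc' r5)
  obtain ⟨s5, sn⟩ := h.five4 (h5 s (by grind) (by grind) (by grind))
    (h.cyc a5) (h.cyc r5) (h.cyc z5) (h.cyc' z4)
  exact h.not_four (h5 b (by grind) (by grind) (by grind))
    (h.cyc x5) (h.cyc' x4) (h.cyc' a5) (h.cyc' s5)

end TriangleCorners

/-- Corners of a region whose faces are triangles and one quadrangle. `Q a u b t` says that the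
boundary walk of the quadrangle is `a, u, b, t`. -/
structure QuadCorners {V : Type*} (R : V → V → V → Prop) (Q : V → V → V → V → Prop) : Prop
    extends Corners R where
  cyc : ∀ {u a b}, R u a b → R a b u ∨ ∃ t, Q a u b t
  quad : ∀ {a u b t}, Q a u b t → R u a b
  rotate : ∀ {a u b t}, Q a u b t → Q u b t a
  unique : ∀ {a u b t a' u' b' t'}, Q a u b t → Q a' u' b' t' →
    (a' = a ∧ u' = u ∧ b' = b ∧ t' = t) ∨ (a' = u ∧ u' = b ∧ b' = t ∧ t' = a) ∨
    (a' = b ∧ u' = t ∧ b' = a ∧ t' = u) ∨ (a' = t ∧ u' = a ∧ b' = u ∧ t' = b)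
  ne₁₃ : ∀ {a u b t}, Q a u b t → a ≠ b

namespace QuadCorners

variable {V : Type*} {R : V → V → V → Prop} {Q : V → V → V → V → Prop}

theorem reverse (h : QuadCorners R Q) :
    QuadCorners (fun u a b => R u b a) (fun a u b t => Q b u a t) where
  toCorners := h.toCorners.reverse
  cyc {u a b} h1 := by
    rcases h.cyc h1 with h2 | ⟨t, h2⟩
    · rcases h.cyc h2 with h3 | ⟨t, h3⟩
      · exact .inl h3
      · obtain rfl := h.right h1 (h.quad (h.rotate h3))
        exact absurd rfl (h.ne (h.quad (h.rotate (h.rotate (h.rotate h3)))))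
    · exact .inr ⟨t, h2⟩
  quad h1 := h.quad h1
  rotate h1 := h.rotate (h.rotate (h.rotate h1))
  unique h1 h2 := by
    have := h.unique h1 h2
    tauto
  ne₁₃ h1 := (h.ne₁₃ h1).symm

/-- A corner next to a quadrangle corner on another face is a triangle corner. -/
theorem tri (h : QuadCorners R Q) {u a b : V} (h1 : R u a b) (h2 : ∀ t, ¬ Q a u b t) :
    R a b u ∧ R b u a := by
  have h3 := (h.cyc h1).resolve_right fun ⟨t, ht⟩ => h2 t ht
  refine ⟨h3, (h.cyc h3).resolve_right ?_⟩
  rintro ⟨t, h4⟩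
  obtain rfl := h.right h1 (h.quad (h.rotate h4))
  exact h.ne (h.quad (h.rotate (h.rotate (h.rotate h4)))) rfl

/-- The case of `false_of_triangle` in which the quadrangle lies on the side `x b`. Its fourth
vertex is then `c₁`, the inner neighbour `z` is `c₃`, and `c₂` has only three corners. -/
theorem false_of_quad_at_left (h : QuadCorners R Q) {x y b c₁ c₂ c₃ z t : V}
    (h5 : ∀ u, u ≠ x → u ≠ y → u ≠ b → FiveAround R u)
    (h1 : R b x c₁) (h2 : R b c₁ c₂) (h3 : R b c₂ c₃) (h4 : R b c₃ y)
    (hn : x ≠ c₁ ∧ x ≠ c₂ ∧ x ≠ c₃ ∧ x ≠ y ∧ c₁ ≠ c₂ ∧ c₁ ≠ c₃ ∧ c₁ ≠ y ∧ c₂ ≠ c₃ ∧ c₂ ≠ y ∧ c₃ ≠ y)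
    (hx : R z x y) (hy : R y b z)
    (hQ : Q z x b t) : False := by
  have ne := @h.ne
  have ne' := @h.ne'
  have right := @h.right
  have left := @h.left
  have hu := fun a u b t => h.unique (a' := a) (u' := u) (b' := b) (t' := t) hQ
  have g1 := h.quad hQ
  have g2 := h.quad (h.rotate hQ)
  have g3 := h.quad (h.rotate (h.rotate hQ))
  have g4 := h.quad (h.rotate (h.rotate (h.rotate hQ)))
  have k1 := h.ne₁₃ hQ
  have k2 := h.ne₁₃ (h.rotate hQ)
  obtain rfl : c₁ = t := h.right h1 g2
  obtain ⟨y1, y2⟩ := h.tri hy (by grind)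
  obtain rfl : z = c₃ := h.left y1 h4
  obtain ⟨e, z4, z5, zn⟩ := h.five3 (h5 z (by grind) (by grind) (by grind)) g4 hx y2
  obtain ⟨m1, m2⟩ := h.tri h3 (by grind)
  obtain rfl := h.right z4 m2
  obtain ⟨l1, l2⟩ := h.tri h2 (by grind)
  obtain ⟨n1, n2⟩ := h.tri z5 (by grind)
  exact h.not_three (h5 _ (by grind) (by grind) (by grind)) m1 l2 n1

/-- The case of `false_of_triangle` in which the quadrangle lies on the side `x y`. The inner
neighbours of `x` and `y` are then `c₁` and `c₃`, whose last neighbours agree, and `c₂` has only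
four corners. -/
theorem false_of_quad_at_edge (h : QuadCorners R Q) {x y b c₁ c₂ c₃ z z' t : V}
    (h5 : ∀ u, u ≠ x → u ≠ y → u ≠ b → FiveAround R u)
    (h1 : R b x c₁) (h2 : R b c₁ c₂) (h3 : R b c₂ c₃) (h4 : R b c₃ y)
    (hn : x ≠ c₁ ∧ x ≠ c₂ ∧ x ≠ c₃ ∧ x ≠ y ∧ c₁ ≠ c₂ ∧ c₁ ≠ c₃ ∧ c₁ ≠ y ∧ c₂ ≠ c₃ ∧ c₂ ≠ y ∧ c₃ ≠ y)
    (hx1 : R x y z) (hx2 : R x z b) (hy1 : R y b z') (hy2 : R y z' x)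
    (hQ : Q y x z t) : False := by
  have ne := @h.ne
  have ne' := @h.ne'
  have right := @h.right
  have left := @h.left
  have hu := fun a u b t => h.unique (a' := a) (u' := u) (b' := b) (t' := t) hQ
  have g1 := h.quad hQ
  have g2 := h.quad (h.rotate hQ)
  have g3 := h.quad (h.rotate (h.rotate hQ))
  have g4 := h.quad (h.rotate (h.rotate (h.rotate hQ)))
  have k1 := h.ne₁₃ hQ
  have k2 := h.ne₁₃ (h.rotate hQ)
  obtain rfl : z' = t := h.left hy2 g4
  obtain ⟨a1, a2⟩ := h.tri hx2 (by grind)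
  obtain rfl := h.right h1 a2
  obtain ⟨b1, b2⟩ := h.tri hy1 (by grind)
  obtain rfl := h.left h4 b1
  obtain ⟨m1, m2⟩ := h.tri h2 (by grind)
  obtain ⟨l1, l2⟩ := h.tri h3 (by grind)
  obtain ⟨u, z4, z5, zn⟩ := h.five3 (h5 _ (by grind) (by grind) (by grind)) m1 a1 g2
  obtain ⟨u', w4, w5, wn⟩ := h.five3 (h5 _ (by grind) (by grind) (by grind)) g3 b2 l2
  obtain ⟨e1, e2⟩ := h.tri z4 (by grind)
  obtain rfl := h.left e1 w5
  obtain ⟨p1, p2⟩ := h.tri z5 (by grind)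
  obtain ⟨q1, q2⟩ := h.tri w4 (by grind)
  exact h.not_four (h5 _ (by grind) (by grind) (by grind)) m2 p2 q1 l1

/-- A triangle `x, y, b` with one quadrangle inside, three edges inside at `b` and at most one edge
inside at `x` and at `y` does not exist. -/
theorem false_of_triangle (h : QuadCorners R Q) {x y b c₁ c₂ c₃ : V}
    (h5 : ∀ u, u ≠ x → u ≠ y → u ≠ b → FiveAround R u)
    (h1 : R b x c₁) (h2 : R b c₁ c₂) (h3 : R b c₂ c₃) (h4 : R b c₃ y)
    (hn : x ≠ c₁ ∧ x ≠ c₂ ∧ x ≠ c₃ ∧ x ≠ y ∧ c₁ ≠ c₂ ∧ c₁ ≠ c₃ ∧ c₁ ≠ y ∧ c₂ ≠ c₃ ∧ c₂ ≠ y ∧ c₃ ≠ y)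
    (hx : R x y b ∨ ∃ m, R x y m ∧ R x m b) (hy : R y b x ∨ ∃ m, R y b m ∧ R y m x) : False := by
  have ne := @h.ne
  have ne' := @h.ne'
  have right := @h.right
  have left := @h.left
  rcases hx with hx | ⟨m, hx1, hx2⟩
  · by_cases hQ : ∃ t, Q y x b t
    · obtain ⟨t, hQ⟩ := hQ
      have hu := fun a u b t => h.unique (a' := a) (u' := u) (b' := b) (t' := t) hQ
      have g2 := h.quad (h.rotate hQ)
      have g3 := h.quad (h.rotate (h.rotate hQ))
      have g4 := h.quad (h.rotate (h.rotate (h.rotate hQ)))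
      rcases hy with hy | ⟨m, hy1, hy2⟩
      · grind
      · obtain ⟨m1, m2⟩ := h.tri hy1 (by grind)
        grind
    · obtain ⟨m1, m2⟩ := h.tri hx (by grind)
      grind
  · rcases hy with hy | ⟨m', hy1, hy2⟩
    · by_cases hQ : ∃ t, Q b y x t
      · obtain ⟨t, hQ⟩ := hQ
        have hu := fun a u b t => h.unique (a' := a) (u' := u) (b' := b) (t' := t) hQ
        have g2 := h.quad (h.rotate hQ)
        have g3 := h.quad (h.rotate (h.rotate hQ))
        have g4 := h.quad (h.rotate (h.rotate (h.rotate hQ)))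
        obtain ⟨m1, m2⟩ := h.tri hx2 (by grind)
        grind
      · obtain ⟨m1, m2⟩ := h.tri hy (by grind)
        grind
    · by_cases hQ : ∃ t, Q y x m t
      · obtain ⟨t, hQ⟩ := hQ
        exact h.false_of_quad_at_edge h5 h1 h2 h3 h4 hn hx1 hx2 hy1 hy2 hQ
      · obtain ⟨m1, m2⟩ := h.tri hx1 (by grind)
        obtain rfl := h.left m1 hy2
        by_cases hQ : ∃ t, Q m x b t
        · obtain ⟨t, hQ⟩ := hQ
          exact h.false_of_quad_at_left h5 h1 h2 h3 h4 hn m2 hy1 hQ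
        · obtain ⟨l1, l2⟩ := h.tri hx2 (by grind)
          by_cases hQ' : ∃ t, Q b y m t
          · obtain ⟨t, hQ'⟩ := hQ'
            -- A quadrangle on the side `y b` is the mirror image of one on the side `x b`.
            exact h.reverse.false_of_quad_at_left (x := y) (y := x) (b := b) (z := m) (t := t)
              (fun u h1 h2 h3 a b hab => by
                obtain ⟨c, d, e, k1, k2, k3, k4, kn⟩ := h5 u h2 h1 h3 b a hab
                exact ⟨e, d, c, k4, k3, k2, k1, by grind⟩)
              h4 h3 h2 h1 (by grind) m2 hx2 hQ'
          · obtain ⟨n1, n2⟩ := h.tri hy1 (by grind)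
            -- With triangles on all three sides, the common inner neighbour of `x` and `y` would be
            -- both `c₁` and `c₃`.
            grind

end QuadCorners

namespace TriangleCorners

variable {V : Type*} {R : V → V → V → Prop}

/-- A quadrangle `x, y, b, c` with three edges inside at `b` and at `c` and at most one edge inside
at `x` and at `y` does not exist. -/
theorem false_of_quadrangle (h : TriangleCorners R) {x y b c e₁ e₂ e₃ c₁ c₂ c₃ : V}
    (h5 : ∀ u, u ≠ x → u ≠ y → u ≠ b → u ≠ c → FiveAround R u)
    (h1 : R b c c₁) (h2 : R b c₁ c₂) (h3 : R b c₂ c₃) (h4 : R b c₃ y)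
    (h1' : R c x e₁) (h2' : R c e₁ e₂) (h3' : R c e₂ e₃) (h4' : R c e₃ b)
    (hn : c ≠ c₁ ∧ c ≠ c₂ ∧ c ≠ c₃ ∧ c ≠ y ∧ c₁ ≠ c₂ ∧ c₁ ≠ c₃ ∧ c₁ ≠ y ∧ c₂ ≠ c₃ ∧ c₂ ≠ y ∧ c₃ ≠ y)
    (hn' : x ≠ e₁ ∧ x ≠ e₂ ∧ x ≠ e₃ ∧ x ≠ b ∧ e₁ ≠ e₂ ∧ e₁ ≠ e₃ ∧ e₁ ≠ b ∧ e₂ ≠ e₃ ∧ e₂ ≠ b ∧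
      e₃ ≠ b)
    (hx : R x y c ∨ ∃ m, R x y m ∧ R x m c) (hy : R y b x ∨ ∃ m, R y b m ∧ R y m x) : False := by
  have ne := @h.ne
  have right := @h.right
  have left := @h.left
  have cyc := @h.cyc
  rcases hx with hx | ⟨m, hx1, hx2⟩ <;> rcases hy with hy | ⟨m', hy1, hy2⟩
  · grind
  · grind
  · grind
  -- The triangle on `x y` identifies the two inner neighbours, which then equal `e₁` and `c₃`. Its
  -- last neighbour is both `c₂` and `e₂`, and that vertex has only four corners.
  · have z1 := h.cyc hx1
    obtain rfl := h.left z1 hy2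
    have m1 := h.cyc' hx2
    obtain rfl := h.right h1' m1
    have m2 := h.cyc hy1
    obtain rfl := h.left m2 h4
    obtain ⟨u, z4, z5, zn⟩ := h.five3 (h5 _ (by grind) (by grind) (by grind) (by grind))
      (h.cyc hx2) (h.cyc' hx1) (h.cyc' hy1)
    have k1 := h.cyc z4
    have k2 := h.cyc' z5
    obtain rfl := h.left h3 k1
    obtain rfl := h.right h2' k2
    have l1 := h.cyc h1
    have l2 := h.cyc' h4'
    obtain rfl := h.right h1 l2
    exact h.not_four (h5 _ (by grind) (by grind) (by grind) (by grind))
      (h.cyc' z4) (h.cyc' h2) (h.cyc h3') (h.cyc z5)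

end TriangleCorners

/-- A vertex of degree five, with its neighbours in cyclic order. -/
def FullFive {V : Type*} (C : V → V → V → Prop) (u : V) : Prop :=
  ∀ a b, C u a b → ∃ c d e, C u b c ∧ C u c d ∧ C u d e ∧ C u e a ∧
    (a ≠ b ∧ a ≠ c ∧ a ≠ d ∧ a ≠ e ∧ b ≠ c ∧ b ≠ d ∧ b ≠ e ∧ c ≠ d ∧ c ≠ e ∧ d ≠ e) ∧
    ∀ s t, C u s t → s = a ∨ s = b ∨ s = c ∨ s = d ∨ s = e

theorem FullFive.reverse {V : Type*} {C : V → V → V → Prop} {u : V} (h : FullFive C u)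
    (hC : Corners C) : FullFive (fun u a b => C u b a) u := by
  intro a b hab
  obtain ⟨c, d, e, h1, h2, h3, h4, hn, hs⟩ := h b a hab
  have right := @hC.right
  exact ⟨e, d, c, h4, h3, h2, h1, by grind, by grind⟩

/-- The corners `R` of a region of faces, among all corners `C`. The boundary darts of the region
go from `u` to `w` for `B u w`. -/
structure Region {V : Type*} (C R : V → V → V → Prop) (B : V → V → Prop) : Prop where
  sub : ∀ {u a b}, R u a b → C u a b
  next : ∀ {u a b c}, R u a b → C u b c → ¬ B u b → R u b c
  prev : ∀ {u a b c}, R u b c → C u a b → ¬ B b u → R u a b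
  start : ∀ {u b c}, B b u → C u b c → R u b c
  ending : ∀ {u b c}, B u b → ¬ R u b c
  first : ∀ {u a b}, B b u → ¬ R u a b
  last : ∀ {u a b}, B u b → C u a b → R u a b
  adj : ∀ {u w}, B u w → (∃ t, C u w t) ∧ (∃ t, C w u t) ∧ (∃ t, C u t w) ∧ ∃ t, C w t u

/-! ### Regions bounded by short cycles next to a quadrangle or a pentagon -/

namespace Region

variable {V : Type*} {C R : V → V → V → Prop} {B : V → V → Prop}

theorem reverse (h : Region C R B) :
    Region (fun u a b => C u b a) (fun u a b => R u b a) (fun u w => B w u) where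
  sub h1 := h.sub h1
  next h1 h2 h3 := h.prev h1 h2 h3
  prev h1 h2 h3 := h.next h1 h2 h3
  start h1 h2 := h.last h1 h2
  ending h1 := h.first h1
  first h1 := h.ending h1
  last h1 h2 := h.start h1 h2
  adj h1 := ⟨(h.adj h1).2.2.2, (h.adj h1).2.2.1, (h.adj h1).2.1, (h.adj h1).1⟩

/-- Where no boundary dart starts, `next` carries membership in the region all the way around the
vertex. -/
theorem fiveAround (h : Region C R B) {u : V} (h5 : FullFive C u) (hB : ∀ w, ¬ B u w) :
    FiveAround R u := by
  intro a b hab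
  obtain ⟨c, d, e, h1, h2, h3, h4, hn, -⟩ := h5 a b (h.sub hab)
  have r1 := h.next hab h1 (hB _)
  have r2 := h.next r1 h2 (hB _)
  have r3 := h.next r2 h3 (hB _)
  exact ⟨c, d, e, r1, r2, r3, h.next r3 h4 (hB _), hn⟩

/-- Only the corner from `x` to `y` at `a` is outside the region, so three edges at `a` lie inside.
The extra outer neighbour `b` leaves at most two inside at `y`. The position of `x` in the rotation
at `y` decides between two, one and no inner edges: the first two cases are excluded by the
explorations above, the third by the corners at `a`. Only `x` may have a degree other than five. -/
theorem clean_triangle_aux (h : Region C R B) (hC : Corners C) (hR : TriangleCorners R)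
    {N x y a b : V} (h5 : ∀ u, u ≠ N → FullFive C u)
    (hB : ∀ u w, B u w ↔ (u = a ∧ w = x) ∨ (u = y ∧ w = a) ∨ (u = x ∧ w = y))
    (ha : C a x y) (hy : C y a b) (hbx : b ≠ x) (hNa : N ≠ a) (hNy : N ≠ y)
    (hN : ∀ s t, R N s t → N = x) : False := by
  have ne := @hC.ne
  have ne' := @hC.ne'
  have right := @hC.right
  have left := @hC.left
  have sub := @h.sub
  have hxy : B x y := (hB _ _).2 (by simp)
  have hya : B y a := (hB _ _).2 (by simp)
  have hax : B a x := (hB _ _).2 (by simp)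
  obtain ⟨a₁, a₂, a₃, k1, k2, k3, k4, kn, ks⟩ := h5 a hNa.symm x y ha
  have r1 := h.start hya k1
  have r2 := h.next r1 k2 (by grind)
  have r3 := h.next r2 k3 (by grind)
  have r4 := h.next r3 k4 (by grind)
  have hq : ∀ s t, R a s t ↔
      (s = y ∧ t = a₁) ∨ (s = a₁ ∧ t = a₂) ∨ (s = a₂ ∧ t = a₃) ∨ (s = a₃ ∧ t = x) := by
    intro s t
    constructor
    · intro hst
      have hs := ks s t (h.sub hst)
      have := @h.ending a x t hax
      grind
    · rintro (⟨rfl, rfl⟩ | ⟨rfl, rfl⟩ | ⟨rfl, rfl⟩ | ⟨rfl, rfl⟩) <;> assumption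
  have h5' : ∀ u, u ≠ x → u ≠ y → u ≠ a → FiveAround R u := by
    intro u h1 h2 h3
    by_cases hu : u = N
    · subst hu
      intro s t hst
      exact absurd (hN s t hst) h1
    · exact h.fiveAround (h5 u hu) (by grind)
  obtain ⟨y₁, y₂, y₃, l1, l2, l3, l4, ln, ls⟩ := h5 y hNy.symm a b hy
  obtain ⟨t, ht⟩ := (h.adj hxy).2.1
  have ht' := h.start hxy ht
  have := h.ending hya (c := b)
  rcases ls x t ht with rfl | rfl | rfl | rfl | rfl
  · grind
  · grind
  · obtain rfl := hC.right ht l2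
    have m2 := h.next ht' l3 (by grind)
    have m3 := h.next m2 l4 (by grind)
    obtain rfl := hR.right r1 (hR.cyc' m3)
    refine hR.false_of_two_three h5' (z := t) ?_ hq ?_ ?_
    · intro u w
      constructor
      · intro huw
        have hs := ls u w (h.sub huw)
        have := @h.ending y a w hya
        have := @h.first y u x hxy
        grind
      · rintro (⟨rfl, rfl⟩ | ⟨rfl, rfl⟩ | ⟨rfl, rfl⟩) <;> assumption
    · simp; grind
    · simp; grind
  · obtain rfl := hC.right ht l3
    have m2 := h.next ht' l4 (by grind)
    obtain rfl := hR.right r1 (hR.cyc' m2)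
    refine hR.false_of_one_three h5' ?_ hq ?_ ?_
    · intro u w
      constructor
      · intro huw
        have hs := ls u w (h.sub huw)
        have := @h.ending y a w hya
        have := @h.first y u x hxy
        have := @h.prev y
        grind
      · rintro (⟨rfl, rfl⟩ | ⟨rfl, rfl⟩) <;> assumption
    · simp; grind
    · simp; grind
  · obtain rfl := hC.right ht l4
    have := hR.cyc ht'
    have := hR.cyc' ht'
    grind

/-- There is no triangle `x, y, a` with only triangles and vertices of degree five inside, if `a`
has degree five and lies next to a face with boundary walk `x, a, y, b, …`. -/
theorem clean_triangle (h : Region C R B) (hC : Corners C) (hR : TriangleCorners R)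
    {N x y a b c : V} (h5 : ∀ u, u ≠ N → FullFive C u)
    (hB : ∀ u w, B u w ↔ (u = a ∧ w = x) ∨ (u = y ∧ w = a) ∨ (u = x ∧ w = y))
    (ha : C a x y) (hy : C y a b) (hx : C x c a) (hbx : b ≠ x) (hcy : c ≠ y) (hNa : N ≠ a)
    (hN : ∀ s t, R N s t → N = x ∨ N = y) : False := by
  by_cases hNy : N = y
  · refine h.reverse.clean_triangle_aux (N := N) (x := y) (y := x) (a := a) (b := c)
      hC.reverse hR.reverse (fun u hu => (h5 u hu).reverse hC) ?_ ha hx hcy hNa ?_ ?_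
    · intro u w
      rw [hB]
      tauto
    · rintro rfl
      have := h.adj ((hB _ _).2 (.inr (.inr ⟨rfl, rfl⟩)))
      obtain ⟨t, ht⟩ := this.1
      exact hC.ne ht hNy
    · intro _ _ _
      exact hNy
  · exact h.clean_triangle_aux hC hR h5 hB ha hy hbx hNa hNy
      fun s t hst => (hN s t hst).resolve_right hNy

variable {R' : V → V → V → Prop} {B' : V → V → Prop}

/-- The inner edges at the two ends of the edge that separates two regions. -/
theorem few_edges (h : Region C R B) (h' : Region C R' B') (hC : Corners C) (hR : TriangleCorners R)
    {x y a b c : V} (h5x : FullFive C x) (h5y : FullFive C y)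
    (hax : B a x) (hya : B y a) (hxy : B x y) (hxc : B' x c) (hyx : B' y x) (hby : B' b y)
    (hB' : ∀ w, w ≠ c → ¬ B' x w) (hB'' : ∀ w, w ≠ x → ¬ B' y w)
    (ha : C a x y) (hx : C x c a) (hy : C y a b) (hac : a ≠ c) (hbx : b ≠ x) (hcy : c ≠ y) :
    (R' x y c ∨ ∃ m, R' x y m ∧ R' x m c) ∧ (R' y b x ∨ ∃ m, R' y b m ∧ R' y m x) := by
  have ne := @hC.ne
  have ne' := @hC.ne'
  have asymm := @hC.asymm
  constructor
  · obtain ⟨e₁, e₂, e₃, k1, k2, k3, k4, kn, ks⟩ := h5x c a hx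
    obtain ⟨t, ht⟩ := (h.adj hxy).1
    have r1 := h.start hax k1
    have s1 := h'.start hyx ht
    rcases ks y t ht with rfl | rfl | rfl | rfl | rfl
    · grind
    · grind
    -- If `y` followed `a` directly at `x`, then `x, a, y` would be a triangle inside the region,
    -- and `a` would have only two corners.
    · have := hC.asymm (h.sub (hR.cyc r1))
      grind
    · obtain rfl := hC.right ht k3
      exact .inr ⟨_, s1, h'.next s1 k4 (hB' _ (by grind))⟩
    · obtain rfl := hC.right ht k4
      exact .inl s1
  · obtain ⟨e₁, e₂, e₃, k1, k2, k3, k4, kn, ks⟩ := h5y a b hy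
    obtain ⟨t, ht⟩ := (h.adj hxy).2.1
    have r1 := h.start hxy ht
    rcases ks x t ht with rfl | rfl | rfl | rfl | rfl
    · grind
    · grind
    · exact .inl (h'.start hby k1)
    · have s1 := h'.start hby k1
      exact .inr ⟨_, s1, h'.next s1 k2 (hB'' _ (by grind))⟩
    · obtain rfl := hC.right ht k4
      have := hC.asymm (h.sub (hR.cyc' r1))
      grind

variable {Q : V → V → V → V → Prop}

/-- The edge `x y` and the quadrangle `x, a, y, b` leave two triangular regions. If `N` is neither
`a` nor strictly inside the first, then `clean_triangle` excludes the first region. Otherwise the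
second region is free of `N`: it is excluded by `clean_triangle` if it is triangulated, and by
`false_of_triangle` if it contains the other quadrangle. -/
theorem quad_aux (h : Region C R B) (h' : Region C R' B') (hC : Corners C)
    (hR : TriangleCorners R) (hR' : TriangleCorners R' ∨ QuadCorners R' Q)
    {N x y a b : V} (h5 : ∀ u, u ≠ N → FullFive C u)
    (hB : ∀ u w, B u w ↔ (u = a ∧ w = x) ∨ (u = y ∧ w = a) ∨ (u = x ∧ w = y))
    (hB' : ∀ u w, B' u w ↔ (u = b ∧ w = y) ∨ (u = x ∧ w = b) ∨ (u = y ∧ w = x))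
    (hN : ∀ s t s' t', N ≠ x → N ≠ y → R N s t → ¬ R' N s' t')
    (hNa : ∀ s t, R' a s t → False) (hNb : ∀ s t, R b s t → False)
    (ha : C a x y) (hy : C y a b) (hb : C b y x) (hx : C x b a) (hab : a ≠ b) : False := by
  have ne := @hC.ne
  have ne' := @hC.ne'
  have hxy : x ≠ y := by
    rintro rfl
    exact hC.asymm ha ha
  -- The alternative forces `N` to be `a` or strictly inside the first region, hence away from the
  -- second one.
  by_cases hA : N ≠ a ∧ ∀ s t, R N s t → N = x ∨ N = y
  · exact h.clean_triangle hC hR h5 hB ha hy hx (ne' hb) (ne hb) hA.1 hA.2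
  have hNx : N ≠ x := by
    rintro rfl
    exact hA ⟨(ne ha).symm, fun _ _ _ => .inl rfl⟩
  have hNy : N ≠ y := by
    rintro rfl
    exact hA ⟨(ne' ha).symm, fun _ _ _ => .inr rfl⟩
  have hNb' : N ≠ b := by
    rintro rfl
    exact hA ⟨hab.symm, fun s t hst => (hNb s t hst).elim⟩
  have hNR' : ∀ s t, ¬ R' N s t := by
    intro s t hst
    apply hA
    refine ⟨?_, fun s' t' hst' => absurd hst (hN s' t' s t hNx hNy hst')⟩
    rintro rfl
    exact hNa s t hst
  rcases hR' with hR' | hR'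
  · exact h'.clean_triangle hC hR' h5 (x := y) (y := x) (a := b) (b := a) (c := a)
      (by intro u w; rw [hB']) hb hx hy (ne' ha) (ne ha) hNb' fun s t hst => (hNR' s t hst).elim
  · obtain ⟨f1, f2⟩ := h.few_edges h' hC hR (h5 x hNx.symm) (h5 y hNy.symm) (c := b) (a := a)
      (b := b)
      (by simp [hB]) (by simp [hB]) (by simp [hB]) (by simp [hB']) (by simp [hB']) (by simp [hB'])
      (by grind) (by grind) ha hx hy hab (ne' hb) (ne hb)
    obtain ⟨c₁, c₂, c₃, k1, k2, k3, k4, kn, ks⟩ := h5 b hNb'.symm y x hb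
    have r1 := h'.start (b := x) (u := b) (by simp [hB']) k1
    have r2 := h'.next r1 k2 (by grind)
    have r3 := h'.next r2 k3 (by grind)
    have r4 := h'.next r3 k4 (by grind)
    refine hR'.false_of_triangle (x := x) (y := y) (b := b) ?_ r1 r2 r3 r4 (by grind) f1 f2
    intro u h1 h2 h3
    by_cases hu : u = N
    · subst hu
      intro s t hst
      exact absurd hst (hNR' s t)
    · exact h'.fiveAround (h5 u hu) (by grind)

/-- The analogue of `quad_aux` for a pentagon `x, a, y, b, c`: the second region is now a
triangulated quadrangle `x, y, b, c`, with three edges inside at both `b` and `c`, and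
`false_of_quadrangle` excludes it. -/
theorem pentagon_aux (h : Region C R B) (h' : Region C R' B') (hC : Corners C)
    (hR : TriangleCorners R) (hR' : TriangleCorners R')
    {N x y a b c : V} (h5 : ∀ u, u ≠ N → FullFive C u)
    (hB : ∀ u w, B u w ↔ (u = a ∧ w = x) ∨ (u = y ∧ w = a) ∨ (u = x ∧ w = y))
    (hB' : ∀ u w, B' u w ↔
      (u = b ∧ w = y) ∨ (u = c ∧ w = b) ∨ (u = x ∧ w = c) ∨ (u = y ∧ w = x))
    (hN : ∀ s t s' t', N ≠ x → N ≠ y → R N s t → ¬ R' N s' t')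
    (hNa : ∀ s t, R' a s t → False) (hNb : ∀ s t, R b s t → False)
    (hNc : ∀ s t, R c s t → False)
    (ha : C a x y) (hy : C y a b) (hb : C b y c) (hc : C c b x) (hx : C x c a)
    (hn : [x, a, y, b, c].Nodup) : False := by
  have ne := @hC.ne
  have ne' := @hC.ne'
  simp only [List.nodup_cons, List.mem_cons, List.not_mem_nil, or_false, not_or] at hn
  by_cases hA : N ≠ a ∧ ∀ s t, R N s t → N = x ∨ N = y
  · exact h.clean_triangle hC hR h5 hB ha hy hx (by grind) (by grind) hA.1 hA.2
  have hNx : N ≠ x := by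
    rintro rfl
    exact hA ⟨by grind, fun _ _ _ => .inl rfl⟩
  have hNy : N ≠ y := by
    rintro rfl
    exact hA ⟨by grind, fun _ _ _ => .inr rfl⟩
  have hNb' : N ≠ b := by
    rintro rfl
    exact hA ⟨by grind, fun s t hst => (hNb s t hst).elim⟩
  have hNc' : N ≠ c := by
    rintro rfl
    exact hA ⟨by grind, fun s t hst => (hNc s t hst).elim⟩
  have hNR' : ∀ s t, ¬ R' N s t := by
    intro s t hst
    apply hA
    refine ⟨?_, fun s' t' hst' => absurd hst (hN s' t' s t hNx hNy hst')⟩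
    rintro rfl
    exact hNa s t hst
  obtain ⟨f1, f2⟩ := h.few_edges h' hC hR (h5 x hNx.symm) (h5 y hNy.symm) (c := c) (a := a) (b := b)
    (by simp [hB]) (by simp [hB]) (by simp [hB]) (by simp [hB']) (by simp [hB']) (by simp [hB'])
    (by grind) (by grind) ha hx hy (by grind) (by grind) (by grind)
  obtain ⟨c₁, c₂, c₃, k1, k2, k3, k4, kn, ks⟩ := h5 b hNb'.symm y c hb
  have r1 := h'.start (b := c) (u := b) (by simp [hB']) k1
  have r2 := h'.next r1 k2 (by grind)
  have r3 := h'.next r2 k3 (by grind)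
  have r4 := h'.next r3 k4 (by grind)
  obtain ⟨e₁, e₂, e₃, l1, l2, l3, l4, ln, ls⟩ := h5 c hNc'.symm b x hc
  have s1 := h'.start (b := x) (u := c) (by simp [hB']) l1
  have s2 := h'.next s1 l2 (by grind)
  have s3 := h'.next s2 l3 (by grind)
  have s4 := h'.next s3 l4 (by grind)
  refine hR'.false_of_quadrangle (x := x) (y := y) (b := b) (c := c) ?_ r1 r2 r3 r4 s1 s2 s3 s4
    (by grind) (by grind) f1 f2
  intro u h1 h2 h3 h4
  by_cases hu : u = N
  · subst hu
    intro s t hst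
    exact absurd hst (hNR' s t)
  · exact h'.fiveAround (h5 u hu) (by grind)

end Region

/-- Two regions between two quadrangles `x, a, y, b` and `x, d, y, c`. -/
structure TwoQuads {V : Type*} (C R R' : V → V → V → Prop) (B B' : V → V → Prop)
    (N x y a b c d : V) : Prop where
  reg : Region C R B
  reg' : Region C R' B'
  corners : Corners C
  tri : TriangleCorners R
  tri' : TriangleCorners R'
  five : ∀ u, u ≠ N → FullFive C u
  bd : ∀ u w, B u w ↔ (u = a ∧ w = x) ∨ (u = y ∧ w = a) ∨ (u = c ∧ w = y) ∨ (u = x ∧ w = c)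
  bd' : ∀ u w, B' u w ↔ (u = b ∧ w = y) ∨ (u = x ∧ w = b) ∨ (u = d ∧ w = x) ∨ (u = y ∧ w = d)
  notBoth : ∀ s t s' t', N ≠ x → N ≠ y → R N s t → ¬ R' N s' t'
  not_a : ∀ s t, ¬ R' a s t
  not_c : ∀ s t, ¬ R' c s t
  not_b : ∀ s t, ¬ R b s t
  not_d : ∀ s t, ¬ R d s t
  fa : C a x y
  fy : C y a b
  fb : C b y x
  fx : C x b a
  gx : C x c d
  gd : C d x y
  gy : C y d c
  gc : C c y x

/-! ### Lenses: two quadrangles with two common vertices -/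

namespace TwoQuads

variable {V : Type*} {C R R' : V → V → V → Prop} {B B' : V → V → Prop} {N x y a b c d : V}

/-- Together with `rotate`, this symmetry reduces the case analysis: `swap` exchanges the two
regions, `rotate` exchanges `x` and `y` within each region. -/
theorem swap (h : TwoQuads C R R' B B' N x y a b c d) : TwoQuads C R' R B' B N y x b a d c where
  reg := h.reg'
  reg' := h.reg
  corners := h.corners
  tri := h.tri'
  tri' := h.tri
  five := h.five
  bd u w := by rw [h.bd']
  bd' u w := by rw [h.bd]
  notBoth s t s' t' h1 h2 h3 h4 := h.notBoth s' t' s t h2 h1 h4 h3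
  not_a := h.not_b
  not_c := h.not_d
  not_b := h.not_a
  not_d := h.not_c
  fa := h.fb
  fy := h.fx
  fb := h.fa
  fx := h.fy
  gx := h.gy
  gd := h.gc
  gy := h.gx
  gc := h.gd

theorem rotate (h : TwoQuads C R R' B B' N x y a b c d) : TwoQuads C R R' B B' N y x c d a b where
  reg := h.reg
  reg' := h.reg'
  corners := h.corners
  tri := h.tri
  tri' := h.tri'
  five := h.five
  bd u w := by rw [h.bd]; tauto
  bd' u w := by rw [h.bd']; tauto
  notBoth s t s' t' h1 h2 h3 h4 := h.notBoth s t s' t' h2 h1 h3 h4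
  not_a := h.not_c
  not_c := h.not_a
  not_b := h.not_d
  not_d := h.not_b
  fa := h.gc
  fy := h.gx
  fb := h.gd
  fx := h.gy
  gx := h.fy
  gd := h.fb
  gy := h.fx
  gc := h.fa

/-- At an end of degree five, there is one more edge, in one of the two regions. -/
theorem split (h : TwoQuads C R R' B B' N x y a b c d) (hy : y ≠ N) :
    (R' y b d ∧ ∃ z, R y c z ∧ R y z a) ∨ (R y c a ∧ ∃ z, R' y b z ∧ R' y z d) := by
  have asymm := @h.corners.asymm
  have fa := h.fa
  have fb := h.fb
  have gd := h.gd
  have gc := h.gc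
  obtain ⟨e₁, e₂, e₃, k1, k2, k3, k4, kn, ks⟩ := h.five y hy a b h.fy
  have s1 := h.reg'.start ((h.bd' b y).2 (by simp)) k1
  have hda : d ≠ a := by
    rintro rfl
    have hd : B' d x := (h.bd' d x).2 (by simp)
    obtain ⟨t, ht⟩ := (h.reg'.adj hd).2.2.2
    obtain ⟨t, ht⟩ := (h.reg'.adj hd).2.2.1
    exact h.not_a _ _ (h.reg'.last hd ht)
  have hxy : x ≠ y := by
    rintro rfl
    exact asymm fa fa
  have hB := h.bd y
  have hB' := h.bd' y
  have ne := @h.corners.ne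
  have ne' := @h.corners.ne'
  rcases ks d c h.gy with rfl | rfl | rfl | rfl | rfl
  · exact absurd rfl hda
  · exact absurd gd (asymm fb)
  · obtain rfl := h.corners.right h.gy k2
    have r3 := h.reg.start (b := c) (u := y) ((h.bd c y).2 (by simp)) k3
    exact .inl ⟨s1, _, r3, h.reg.next r3 k4 (by grind)⟩
  · obtain rfl := h.corners.right h.gy k3
    have r4 := h.reg.start (b := c) (u := y) ((h.bd c y).2 (by simp)) k4
    exact .inr ⟨r4, _, s1, h.reg'.next s1 k2 (by grind)⟩
  · obtain rfl := h.corners.right h.gy k4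
    exact absurd gc (asymm fa)

/-- Without inner edges at `x` and `y`, both `a` and `c` have only three corners. Then both are `N`,
although they are adjacent. -/
theorem false_of_zero_zero (h : TwoQuads C R R' B B' N x y a b c d) (hy : R y c a) (hx : R x a c) :
    False := by
  have sub := @h.reg.sub
  have key : ∀ u s t r, C u s t → C u t r → C u r s → u = N := by
    intro u s t r h1 h2 h3
    by_contra hu
    obtain ⟨e₁, e₂, e₃, k1, k2, k3, k4, kn, ks⟩ := h.five u hu s t h1
    have right := @h.corners.right
    grind
  have h1 := key a x y c h.fa (sub (h.tri.cyc' hy)) (sub (h.tri.cyc hx))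
  have h2 := key c y x a h.gc (sub (h.tri.cyc' hx)) (sub (h.tri.cyc hy))
  subst h1
  exact h.corners.ne (sub (h.tri.cyc hx)) h2.symm

/-- The edge `a c` cuts off the triangle at `x`. The degrees of `a` and `c` then force the inner
neighbour `z` of `y` to have only four corners. -/
theorem false_of_zero_one (h : TwoQuads C R R' B B' N x y a b c d) {z : V} (hx : R x a c)
    (hy : R y c z) (hy' : R y z a) (hNa : N ≠ a) (hNc : N ≠ c) (hN : ∀ s t, ¬ R N s t) : False := by
  have ne := @h.corners.ne
  have ne' := @h.corners.ne'
  have sub := @h.reg.sub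
  have hB := h.bd
  have hR := h.tri
  have hxy : x ≠ y := by
    rintro rfl
    exact h.corners.asymm h.fa h.fa
  have hac : a ≠ c := by
    rintro rfl
    exact h.corners.asymm h.fa h.gc
  obtain ⟨a₁, a₂, a₃, k1, k2, k3, k4, kn, ks⟩ := h.five a hNa.symm x y h.fa
  obtain ⟨c₁, c₂, c₃, l1, l2, l3, l4, ln, ls⟩ := h.five c hNc.symm y x h.gc
  obtain rfl := h.corners.right k1 (sub (hR.cyc' hy'))
  obtain rfl := (h.corners.left k4 (sub (hR.cyc hx))).symm
  obtain rfl := (h.corners.right l1 (sub (hR.cyc' hx))).symm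
  obtain rfl := (h.corners.left l4 (sub (hR.cyc hy))).symm
  have r1 := h.reg.next (hR.cyc' hy') k2 (by grind)
  have r2 := h.reg.next r1 k3 (by grind)
  have s1 := h.reg.next (hR.cyc' hx) l2 (by grind)
  have s2 := h.reg.next s1 l3 (by grind)
  obtain rfl := hR.right s1 (hR.cyc' r2)
  have hz : a₁ ≠ N := by
    rintro rfl
    exact hN _ _ (hR.cyc hy')
  exact hR.not_four (h.reg.fiveAround (h.five a₁ hz) (by grind))
    (hR.cyc hy') (hR.cyc' hy) (hR.cyc' s2) (hR.cyc r1)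

/-- Without an inner edge at `y`, the region is the triangle `y, c, a` together with the triangle
`N, c, a`. In the latter, `c` and `a` have two inner edges each, so `false_of_two_two` applies with
the exceptional vertex as apex. -/
theorem false_of_apex (h : TwoQuads C R R' B B' N x y a b c d) (hN : N = x) (hy : R y c a) :
    False := by
  subst hN
  have ne := @h.corners.ne
  have ne' := @h.corners.ne'
  have sub := @h.reg.sub
  have hB := h.bd
  have hR := h.tri
  have hNy : N ≠ y := by
    rintro rfl
    exact h.corners.asymm h.fa h.fa
  have hac : a ≠ c := by
    rintro rfl
    exact h.corners.asymm h.fa h.gc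
  have hNa := ne h.fa
  have hNc := ne' h.gc
  obtain ⟨a₁, a₂, a₃, k1, k2, k3, k4, kn, ks⟩ := h.five a hNa N y h.fa
  obtain ⟨c₁, c₂, c₃, l1, l2, l3, l4, ln, ls⟩ := h.five c hNc y N h.gc
  obtain rfl := (h.corners.right k1 (sub (hR.cyc' hy))).symm
  obtain rfl := (h.corners.left l4 (sub (hR.cyc hy))).symm
  have r1 := h.reg.next (hR.cyc' hy) k2 (by grind)
  have r2 := h.reg.next r1 k3 (by grind)
  have r3 := h.reg.next r2 k4 (by grind)
  have s1 := h.reg.start ((hB N c).2 (by simp)) l1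
  have s2 := h.reg.next s1 l2 (by grind)
  have s3 := h.reg.next s2 l3 (by grind)
  obtain rfl := hR.right r1 (hR.cyc' s3)
  have ending := @h.reg.ending
  have first := @h.reg.first
  have hyR : ∀ s t, R y s t → s = c ∧ t = a := by
    obtain ⟨e₁, e₂, e₃, m1, m2, m3, m4, mn, ms⟩ := h.five y hNy.symm a b h.fy
    obtain rfl := h.corners.left m4 (sub hy)
    have hbc : b ≠ e₃ := by
      rintro rfl
      exact h.not_b _ _ s1
    have t1 : ¬ R y a b := ending ((hB y a).2 (by simp))
    have t2 : ¬ R y b e₁ := fun h1 => t1 (h.reg.prev h1 h.fy (by grind))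
    have t3 : ¬ R y e₁ e₂ := fun h1 => t2 (h.reg.prev h1 m1 (by grind))
    have t4 : ¬ R y e₂ e₃ := fun h1 => t3 (h.reg.prev h1 m2 (by grind))
    intro s t hst
    have := ms s t (sub hst)
    have right := @h.corners.right
    grind
  -- The region without the triangle at `y`.
  set R₂ : V → V → V → Prop := fun u s t => R u s t ∧ u ≠ y ∧ s ≠ y ∧ t ≠ y with hR₂
  have hT : TriangleCorners R₂ := by
    refine ⟨⟨?_, ?_, ?_, ?_, ?_⟩, ?_⟩
    · exact fun h1 h2 => hR.right h1.1 h2.1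
    · exact fun h1 h2 => hR.left h1.1 h2.1
    · exact fun h1 => hR.ne h1.1
    · exact fun h1 => hR.ne' h1.1
    · exact fun h1 h2 => hR.asymm h1.1 h2.1
    · exact fun ⟨h1, h2, h3, h4⟩ => ⟨hR.cyc h1, h3, h4, h2⟩
  refine hT.false_of_two_two (v := N) (p := c) (q := a) (z := c₁) ?_ ?_ ?_ ?_ ?_ (w := a₂) (y := a₃)
  · intro u h1 h2 h3 s t hst
    have hr : ∀ s t, R u s t → u ≠ y → R₂ u s t := by
      intro s t hst' hu
      refine ⟨hst', hu, ?_, ?_⟩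
      · rintro rfl
        exact h3 (hyR _ _ (hR.cyc hst')).2
      · rintro rfl
        exact h2 (hyR _ _ (hR.cyc' hst')).1
    obtain ⟨c', d', e', g1, g2, g3, g4, gn⟩ :=
      h.reg.fiveAround (h.five u h1) (by grind) s t hst.1
    have hu := hst.2.1
    exact ⟨c', d', e', hr _ _ g1 hu, hr _ _ g2 hu, hr _ _ g3 hu, hr _ _ g4 hu, gn⟩
  · intro s t
    constructor
    · rintro ⟨g1, g2, g3, g4⟩
      have := ls s t (sub g1)
      have right := @h.corners.right
      grind
    · rintro (⟨rfl, rfl⟩ | ⟨rfl, rfl⟩ | ⟨rfl, rfl⟩)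
      · exact ⟨s1, by grind⟩
      · exact ⟨s2, by grind⟩
      · exact ⟨s3, by grind⟩
  · intro s t
    constructor
    · rintro ⟨g1, g2, g3, g4⟩
      have := ks s t (sub g1)
      have := @ending a N t
      have right := @h.corners.right
      grind
    · rintro (⟨rfl, rfl⟩ | ⟨rfl, rfl⟩ | ⟨rfl, rfl⟩)
      · exact ⟨r1, by grind⟩
      · exact ⟨r2, by grind⟩
      · exact ⟨r3, by grind⟩
  · simp; grind
  · simp; grind

/-- The vertices `x` and `y` each have one spare edge, in one of the two regions. If both edges lie
in the same region, the other one is impossible outright. If they lie in different regions, each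
region has the pattern of `false_of_zero_one`, and one of them is free of `N`. The case that `N` is
`x` or `y` is settled beforehand. -/
theorem false (h : TwoQuads C R R' B B' N x y a b c d) : False := by
  -- If `N = x`, then `y` has degree five, and the region without its spare edge is excluded by
  -- `false_of_apex`.
  have key : ∀ {R R' B B' x y a b c d}, TwoQuads C R R' B B' N x y a b c d → N ≠ x := by
    intro R R' B B' x y a b c d h hN
    have hy : y ≠ N := by
      rintro rfl
      subst hN
      exact h.corners.asymm h.fa h.fa
    rcases h.split hy with ⟨h1, -⟩ | ⟨h1, -⟩
    · exact h.swap.rotate.false_of_apex hN h1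
    · exact h.false_of_apex hN h1
  have hx := key h
  have hy := key h.rotate
  -- At least one of the two regions avoids `N` both inside and at its two private boundary
  -- vertices.
  have hN : (N ≠ a ∧ N ≠ c ∧ ∀ s t, ¬ R N s t) ∨ (N ≠ b ∧ N ≠ d ∧ ∀ s t, ¬ R' N s t) := by
    by_cases hA : N ≠ a ∧ N ≠ c ∧ ∀ s t, ¬ R N s t
    · exact .inl hA
    right
    have h1 : ∀ s t, ¬ R' N s t := by
      intro s t hst
      refine hA ⟨?_, ?_, fun s' t' h' => h.notBoth s' t' s t hx hy h' hst⟩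
      · rintro rfl
        exact h.not_a _ _ hst
      · rintro rfl
        exact h.not_c _ _ hst
    refine ⟨?_, ?_, h1⟩
    · rintro rfl
      obtain ⟨t, ht⟩ := (h.reg'.adj ((h.bd' N y).2 (by simp))).2.2.1
      exact h1 _ _ (h.reg'.last ((h.bd' N y).2 (by simp)) ht)
    · rintro rfl
      obtain ⟨t, ht⟩ := (h.reg'.adj ((h.bd' N x).2 (by simp))).2.2.1
      exact h1 _ _ (h.reg'.last ((h.bd' N x).2 (by simp)) ht)
  rcases h.split hy.symm with ⟨h1, z, h2, h3⟩ | ⟨h1, z, h2, h3⟩ <;>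
    rcases h.rotate.split hx.symm with ⟨k1, z', k2, k3⟩ | ⟨k1, z', k2, k3⟩
  · exact h.swap.false_of_zero_zero k1 h1
  · rcases hN with ⟨n1, n2, n3⟩ | ⟨n1, n2, n3⟩
    · exact h.false_of_zero_one k1 h2 h3 n1 n2 n3
    · exact h.swap.false_of_zero_one h1 k2 k3 n1 n2 n3
  · rcases hN with ⟨n1, n2, n3⟩ | ⟨n1, n2, n3⟩
    · exact h.rotate.false_of_zero_one h1 k2 k3 n2 n1 n3
    · exact h.swap.rotate.false_of_zero_one k1 h2 h3 n2 n1 n3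
  · exact h.false_of_zero_zero h1 k1

end TwoQuads

/-! ### Corners, regions and short faces of a dart map -/

namespace DartMap

variable {V D : Type*} (M : DartMap V D)

/-- The corner at `u` from the edge to `a` to the next edge, which leads to `b`, lies in the
set of faces `K`. -/
def Corner (K : D → Prop) (u a b : V) : Prop :=
  ∃ d, M.tail d = u ∧ M.tail (M.inv d) = a ∧ M.tail (M.inv (M.rot d)) = b ∧ K (M.rot d)

/-- The boundary darts of a set of faces `K`. -/
def Bdry (K : D → Prop) (u w : V) : Prop :=
  ∃ d, M.tail d = u ∧ M.tail (M.inv d) = w ∧ K d ∧ ¬ K (M.inv d)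

/-- A set of darts that is a union of faces. -/
def IsFaceSet (K : D → Prop) : Prop := ∀ d, K (M.face d) ↔ K d

variable {M} {K : D → Prop}

theorem IsFaceSet.rot (hK : M.IsFaceSet K) (d : D) : K (M.rot d) ↔ K (M.inv d) := by
  rw [← M.face_inv, hK]

theorem IsFaceSet.sameCycle [Finite D] (hK : M.IsFaceSet K) {d e : D} (h : M.face.SameCycle d e) :
    K d ↔ K e :=
  ⟨h.induction _ fun d hd => (hK d).2 hd, h.symm.induction _ fun d hd => (hK d).2 hd⟩

theorem isFaceSet_sameCycle (f : D) : M.IsFaceSet (M.face.SameCycle f) :=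
  fun _ => Equiv.Perm.sameCycle_apply_right

theorem IsFaceSet.not (hK : M.IsFaceSet K) : M.IsFaceSet fun d => ¬ K d := fun d => not_congr (hK d)

theorem IsFaceSet.and {L : D → Prop} (hK : M.IsFaceSet K) (hL : M.IsFaceSet L) :
    M.IsFaceSet fun d => K d ∧ L d := fun d => and_congr (hK d) (hL d)

theorem rot_ne [Finite D] (h3 : ∀ v, 3 ≤ M.deg v) (d : D) : M.rot d ≠ d := by
  intro h
  have h1 := M.minimalPeriod_rot d
  rw [minimalPeriod_eq_one_iff_isFixedPt.2 h] at h1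
  have := h3 (M.tail d)
  omega

theorem rot_rot_ne [Finite D] (h3 : ∀ v, 3 ≤ M.deg v) (d : D) : M.rot (M.rot d) ≠ d := by
  intro h
  have h1 := M.minimalPeriod_rot d
  have h2 : minimalPeriod M.rot d ≤ 2 := IsPeriodicPt.minimalPeriod_le (by norm_num) h
  have := h3 (M.tail d)
  omega

theorem corner_unique {K L : D → Prop} {u a b c : V} (h1 : M.Corner K u a b)
    (h2 : M.Corner L u a c) : b = c := by
  obtain ⟨d, rfl, rfl, rfl, -⟩ := h1
  obtain ⟨e, k1, k2, rfl, -⟩ := h2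
  rw [M.dart_ext e d k1 k2]

theorem corners [Finite D] (h3 : ∀ v, 3 ≤ M.deg v) (K : D → Prop) : Corners (M.Corner K) where
  right := corner_unique
  left := by
    rintro _ _ _ _ ⟨d, rfl, rfl, rfl, -⟩ ⟨e, k1, rfl, k3, -⟩
    rw [M.rot.injective (M.dart_ext (M.rot e) (M.rot d) (by rw [M.tail_rot, M.tail_rot, k1]) k3)]
  ne := by
    rintro _ _ _ ⟨d, rfl, rfl, rfl, -⟩
    exact (M.tail_inv_ne d).symm
  ne' := by
    rintro _ _ _ ⟨d, rfl, rfl, rfl, -⟩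
    rw [← M.tail_rot]
    exact (M.tail_inv_ne _).symm
  asymm := by
    rintro _ _ _ ⟨d, rfl, rfl, rfl, -⟩ ⟨e, k1, k2, k3, -⟩
    have h1 : e = M.rot d := M.dart_ext _ _ (by rw [k1, M.tail_rot]) k2
    have h2 : M.rot e = d := M.dart_ext _ _ (by rw [M.tail_rot, k1]) k3
    exact rot_rot_ne h3 d (by rw [← h1, h2])

theorem fullFive [Finite D] {u : V} (hu : M.deg u = 5) : FullFive (M.Corner fun _ => True) u := by
  rintro _ _ ⟨d, rfl, rfl, rfl, -⟩
  rw [← M.minimalPeriod_rot] at hu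
  have h5 : M.rot (M.rot (M.rot (M.rot (M.rot d)))) = d := by
    have := isPeriodicPt_minimalPeriod M.rot d
    rwa [hu] at this
  have hne : ∀ i j, i < 5 → j < 5 → i ≠ j →
      M.tail (M.inv (M.rot^[i] d)) ≠ M.tail (M.inv (M.rot^[j] d)) := by
    intro i j hi hj hij h
    apply hij
    have ht : ∀ i, M.tail (M.rot^[i] d) = M.tail d := fun i =>
      (M.tail_eq_iff.2 (M.rot.sameCycle_iterate d i)).symm
    exact (iterate_eq_iterate_iff_of_lt_minimalPeriod (by rwa [hu]) (by rwa [hu])).1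
      (M.dart_ext _ _ (by rw [ht, ht]) h)
  refine ⟨M.tail (M.inv (M.rot^[2] d)), M.tail (M.inv (M.rot^[3] d)), M.tail (M.inv (M.rot^[4] d)),
    ⟨M.rot d, M.tail_rot d, rfl, rfl, trivial⟩, ⟨M.rot (M.rot d), ?_, rfl, rfl, trivial⟩,
    ⟨M.rot (M.rot (M.rot d)), ?_, rfl, rfl, trivial⟩,
    ⟨M.rot (M.rot (M.rot (M.rot d))), ?_, rfl, ?_, trivial⟩,
    ⟨hne 0 1 ?_ ?_ ?_, hne 0 2 ?_ ?_ ?_, hne 0 3 ?_ ?_ ?_, hne 0 4 ?_ ?_ ?_, hne 1 2 ?_ ?_ ?_,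
      hne 1 3 ?_ ?_ ?_, hne 1 4 ?_ ?_ ?_, hne 2 3 ?_ ?_ ?_, hne 2 4 ?_ ?_ ?_, hne 3 4 ?_ ?_ ?_⟩, ?_⟩
  all_goals try norm_num
  all_goals try simp only [M.tail_rot]
  · rw [h5]
  · rintro s t ⟨e, k1, rfl, -, -⟩
    obtain ⟨i, hi, rfl⟩ := M.rot.sameCycle_iff_exists_iterate.1 (M.tail_eq_iff.1 k1.symm)
    rw [hu] at hi
    interval_cases i
    · exact .inl rfl
    · exact .inr (.inl rfl)
    · exact .inr (.inr (.inl rfl))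
    · exact .inr (.inr (.inr (.inl rfl)))
    · exact .inr (.inr (.inr (.inr rfl)))

theorem region (hK : M.IsFaceSet K) :
    Region (M.Corner fun _ => True) (M.Corner K) (M.Bdry K) where
  sub := fun ⟨d, h1, h2, h3, _⟩ => ⟨d, h1, h2, h3, trivial⟩
  next := by
    rintro _ _ _ _ ⟨d, rfl, rfl, rfl, h⟩ ⟨e, k1, k2, rfl, -⟩ hB
    obtain rfl : e = M.rot d := M.dart_ext _ _ (by rw [k1, M.tail_rot]) k2
    refine ⟨_, k1, k2, rfl, ?_⟩
    rw [hK.rot]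
    by_contra hc
    exact hB ⟨_, k1, rfl, h, hc⟩
  prev := by
    rintro _ _ _ _ ⟨d, rfl, rfl, rfl, h⟩ ⟨e, k1, rfl, k3, -⟩ hB
    obtain rfl : M.rot e = d := M.dart_ext _ _ (by rw [M.tail_rot, k1]) k3
    refine ⟨_, k1, rfl, rfl, ?_⟩
    by_contra hc
    exact hB ⟨_, rfl, by rw [M.inv_inv], (hK.rot _).1 h, by rwa [M.inv_inv]⟩
  start := by
    rintro _ _ _ ⟨d, rfl, rfl, h, h'⟩ ⟨e, k1, k2, rfl, -⟩
    obtain rfl : e = M.inv d := M.dart_ext _ _ k1 (by rw [M.inv_inv, k2])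
    exact ⟨_, rfl, k2, rfl, by rwa [hK.rot, M.inv_inv]⟩
  ending := by
    rintro _ _ _ ⟨d, rfl, rfl, h, h'⟩ ⟨e, k1, k2, rfl, k3⟩
    obtain rfl : e = d := M.dart_ext _ _ k1 k2
    exact h' ((hK.rot _).1 k3)
  first := by
    rintro _ _ _ ⟨d, rfl, rfl, h, h'⟩ ⟨e, k1, rfl, k3, k4⟩
    have : M.rot e = M.inv d :=
      M.dart_ext _ _ (by rw [M.tail_rot, k1]) (by rw [M.inv_inv, k3])
    exact h' (this ▸ k4)
  last := by
    rintro _ _ _ ⟨d, rfl, rfl, h, h'⟩ ⟨e, k1, rfl, k3, -⟩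
    have : M.rot e = d := M.dart_ext _ _ (by rw [M.tail_rot, k1]) k3
    exact ⟨e, k1, rfl, k3, this ▸ h⟩
  adj := by
    have key : ∀ d, (∃ t, M.Corner (fun _ => True) (M.tail d) (M.tail (M.inv d)) t) ∧
        ∃ t, M.Corner (fun _ => True) (M.tail d) t (M.tail (M.inv d)) := fun d =>
      ⟨⟨_, d, rfl, rfl, rfl, trivial⟩, _, M.rot.symm d,
        by rw [← M.tail_rot, Equiv.apply_symm_apply], rfl, by rw [Equiv.apply_symm_apply], trivial⟩
    rintro _ _ ⟨d, rfl, rfl, -, -⟩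
    have := key (M.inv d)
    rw [M.inv_inv] at this
    exact ⟨(key d).1, this.1, (key d).2, this.2⟩

theorem triangleCorners [Finite D] (h3 : ∀ v, 3 ≤ M.deg v)
    (hL : ∀ d, K d → M.faceLen d = 3) (hK : M.IsFaceSet K) : TriangleCorners (M.Corner K) where
  toCorners := corners h3 K
  cyc := by
    rintro _ _ _ ⟨d, rfl, rfl, rfl, h⟩
    have h1 := M.face3 (hL _ h)
    have h2 : M.face (M.face (M.rot d)) = M.inv d :=
      M.face.injective (h1.trans (M.face_inv d).symm)
    have h3 : M.rot (M.inv (M.face (M.rot d))) = M.inv d := h2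
    refine ⟨M.inv (M.face (M.rot d)), ?_, ?_, ?_, ?_⟩
    · rw [← M.tail_rot, h3]
    · rw [M.inv_inv, M.tail_face]
    · rw [h3, M.inv_inv]
    · rw [h3, ← hK.rot]
      exact h

/-! ### Short faces -/

theorem tail_face_face_ne [Finite D] (h3 : ∀ v, 3 ≤ M.deg v) (d : D) :
    M.tail (M.face (M.face d)) ≠ M.tail d := by
  intro h
  have : M.face d = M.inv d :=
    M.dart_ext _ _ (M.tail_face d) (by rw [M.inv_inv, ← M.tail_face, h])
  exact rot_ne h3 _ this

theorem tail_face_ne (d : D) : M.tail (M.face d) ≠ M.tail d := by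
  rw [M.tail_face]
  exact M.tail_inv_ne d

/-- A face of length at most five is bounded by a simple cycle. -/
theorem face_simple [Finite D] (h3 : ∀ v, 3 ≤ M.deg v) {d e : D} (h5 : M.faceLen d ≤ 5)
    (h : M.face.SameCycle d e) (ht : M.tail d = M.tail e) : d = e := by
  obtain ⟨i, hi, rfl⟩ := M.face.sameCycle_iff_exists_iterate.1 h
  have hL := M.iterate_faceLen d
  have hi' : i < M.faceLen d := hi
  have key : ∀ j, M.face^[j] (M.face^[i] d) = d → j ≠ 1 ∧ j ≠ 2 := by
    rintro j hj
    refine ⟨?_, ?_⟩ <;> rintro rfl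
    · exact M.tail_face_ne (M.face^[i] d) ((congrArg M.tail hj).trans ht)
    · exact tail_face_face_ne h3 (M.face^[i] d) ((congrArg M.tail hj).trans ht)
  have h2 := key (M.faceLen d - i) (by rw [← iterate_add_apply, Nat.sub_add_cancel hi'.le, hL])
  have h0 : i ≠ 1 := by
    rintro rfl
    exact M.tail_face_ne d ht.symm
  have h1 : i ≠ 2 := by
    rintro rfl
    exact tail_face_face_ne h3 d ht.symm
  obtain rfl : i = 0 := by omega
  rfl

/-- A face of length at most five does not meet itself along an edge. -/
theorem not_sameCycle_inv [Finite D] (h3 : ∀ v, 3 ≤ M.deg v) {d : D} (h5 : M.faceLen d ≤ 5) :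
    ¬ M.face.SameCycle d (M.inv d) := by
  intro h
  have h1 : M.face.SameCycle (M.face d) (M.inv d) := Equiv.Perm.sameCycle_apply_left.2 h
  have := face_simple h3 (by rwa [M.faceLen_face]) h1 (M.tail_face d)
  exact rot_ne h3 _ this

theorem quadCorners [Finite D] (h3 : ∀ v, 3 ≤ M.deg v) (hK : M.IsFaceSet K) {q : D} (hq : K q)
    (hq4 : M.faceLen q = 4) (hL : ∀ d, K d → ¬ M.face.SameCycle q d → M.faceLen d = 3) :
    QuadCorners (M.Corner K) fun a u b t => ∃ d, M.face.SameCycle q d ∧ M.tail d = a ∧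
      M.tail (M.face d) = u ∧ M.tail (M.face (M.face d)) = b ∧
      M.tail (M.face (M.face (M.face d))) = t where
  toCorners := corners h3 K
  cyc := by
    rintro _ _ _ ⟨d, rfl, rfl, rfl, h⟩
    by_cases hd : M.face.SameCycle q (M.rot d)
    · right
      refine ⟨_, M.inv d, ?_, rfl, ?_, ?_, rfl⟩
      · rwa [← M.face_inv, Equiv.Perm.sameCycle_apply_right] at hd
      · rw [M.face_inv, M.tail_rot]
      · rw [M.face_inv, M.tail_face]
    · left
      have hR := triangleCorners h3 (K := fun d => K d ∧ ¬ M.face.SameCycle q d)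
        (fun d hd => hL d hd.1 hd.2) (hK.and (isFaceSet_sameCycle q).not)
      obtain ⟨e, k1, k2, k3, k4⟩ := hR.cyc ⟨d, rfl, rfl, rfl, h, hd⟩
      exact ⟨e, k1, k2, k3, k4.1⟩
  quad := by
    rintro _ _ _ _ ⟨d, h, rfl, rfl, rfl, rfl⟩
    exact ⟨M.inv d, (M.tail_face d).symm, by rw [M.inv_inv], (M.tail_face _).symm,
      (hK.rot _).2 (by rw [M.inv_inv]; exact (hK.sameCycle h).1 hq)⟩
  rotate := by
    rintro _ _ _ _ ⟨d, h, rfl, rfl, rfl, rfl⟩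
    refine ⟨M.face d, Equiv.Perm.sameCycle_apply_right.2 h, rfl, rfl, rfl, ?_⟩
    have := M.iterate_faceLen d
    rw [M.face_sameCycle_face h, hq4] at this
    exact congrArg M.tail this
  unique := by
    rintro _ _ _ _ _ _ _ _ ⟨d, h, rfl, rfl, rfl, rfl⟩ ⟨e, h', rfl, rfl, rfl, rfl⟩
    have hd : minimalPeriod M.face d = 4 := (M.face_sameCycle_face h).trans hq4
    have h4 : M.face (M.face (M.face (M.face d))) = d := by
      have := M.iterate_faceLen d
      rwa [faceLen, hd] at this
    obtain ⟨i, hi, rfl⟩ := M.face.sameCycle_iff_exists_iterate.1 (h.symm.trans h')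
    rw [hd] at hi
    interval_cases i
    · exact .inl ⟨rfl, rfl, rfl, rfl⟩
    · refine .inr (.inl ⟨rfl, rfl, rfl, ?_⟩)
      change M.tail (M.face (M.face (M.face (M.face d)))) = _
      rw [h4]
    · refine .inr (.inr (.inl ⟨rfl, rfl, ?_, ?_⟩))
      · change M.tail (M.face (M.face (M.face (M.face d)))) = _
        rw [h4]
      · change M.tail (M.face (M.face (M.face (M.face (M.face d))))) = _
        rw [h4]
    · refine .inr (.inr (.inr ⟨rfl, ?_, ?_, ?_⟩))
      · change M.tail (M.face (M.face (M.face (M.face d)))) = _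
        rw [h4]
      · change M.tail (M.face (M.face (M.face (M.face (M.face d))))) = _
        rw [h4]
      · change M.tail (M.face (M.face (M.face (M.face (M.face (M.face d)))))) = _
        rw [h4]
  ne₁₃ := by
    rintro _ _ _ _ ⟨d, h, rfl, rfl, rfl, rfl⟩
    exact (tail_face_face_ne h3 d).symm

theorem corner_face (d : D) : M.Corner (fun _ => True) (M.tail (M.face d)) (M.tail d)
    (M.tail (M.face (M.face d))) :=
  ⟨M.inv d, (M.tail_face d).symm, by rw [M.inv_inv], (M.tail_face _).symm, trivial⟩

/-- Around a vertex without boundary darts, a set of faces is constant. -/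
theorem IsFaceSet.const [Finite D] (hK : M.IsFaceSet K) {u : V}
    (hB : ∀ w, ¬ M.Bdry K u w ∧ ¬ M.Bdry K w u) {d e : D} (hd : M.tail d = u) (he : M.tail e = u)
    (h : K d) : K e := by
  have := (M.tail_eq_iff.1 (hd.trans he.symm)).induction M.rot (K := fun d => M.tail d = u ∧ K d) ?_
    ⟨hd, h⟩
  · exact this.2
  · rintro d ⟨rfl, h⟩
    refine ⟨M.tail_rot d, (hK.rot d).2 ?_⟩
    by_contra hc
    exact (hB _).1 ⟨d, rfl, rfl, h, hc⟩

end DartMap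

/-! ### Boundaries of sets of faces -/

namespace DartMap

variable {V D : Type*} {M : DartMap V D} {K : D → Prop}

/-- The boundary darts of a set of faces. -/
def bdrySet (M : DartMap V D) (K : D → Prop) : Set D := {d | K d ∧ ¬ K (M.inv d)}

/-- If no boundary dart left the end of `d`, then rotating from the successor of `inv d` all the way
around to `inv d` would never leave `K`. -/
theorem exists_next [Finite D] (hK : M.IsFaceSet K) {d : D} (hd : d ∈ M.bdrySet K) :
    ∃ e ∈ M.bdrySet K, M.tail e = M.tail (M.inv d) := by
  by_contra hc
  push Not at hc
  have h1 : M.rot.SameCycle (M.rot (M.inv d)) (M.inv d) :=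
    (M.rot.sameCycle_apply_self _).symm
  have := h1.induction M.rot (K := fun e => M.tail e = M.tail (M.inv d) ∧ K e) ?_
    ⟨M.tail_rot _, by rw [hK.rot, M.inv_inv]; exact hd.1⟩
  · exact hd.2 this.2
  · rintro e ⟨he, h⟩
    refine ⟨(M.tail_rot e).trans he, (hK.rot e).2 ?_⟩
    by_contra h'
    exact hc e ⟨h, h'⟩ he

theorem exists_prev [Finite D] (hK : M.IsFaceSet K) {d : D} (hd : d ∈ M.bdrySet K) :
    ∃ e ∈ M.bdrySet K, M.tail (M.inv e) = M.tail d := by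
  obtain ⟨e, he, h⟩ := exists_next hK.not (d := M.inv d)
    ⟨hd.2, by rw [M.inv_inv]; exact not_not.2 hd.1⟩
  exact ⟨M.inv e, ⟨not_not.1 he.2, by rw [M.inv_inv]; exact he.1⟩, by
    rw [M.inv_inv, h, M.inv_inv]⟩

/-- Every boundary dart starts a directed path of three different boundary darts. -/
theorem exists_path [Finite D] (hK : M.IsFaceSet K) {d : D} (hd : d ∈ M.bdrySet K) :
    ∃ e ∈ M.bdrySet K, ∃ f ∈ M.bdrySet K, M.tail e = M.tail (M.inv d) ∧
      M.tail f = M.tail (M.inv e) ∧ e ≠ d ∧ f ≠ e ∧ f ≠ d := by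
  obtain ⟨e, he, h1⟩ := exists_next hK hd
  obtain ⟨f, hf, h2⟩ := exists_next hK he
  refine ⟨e, he, f, hf, h1, h2, ?_, ?_, ?_⟩
  · rintro rfl
    exact M.tail_inv_ne _ h1.symm
  · rintro rfl
    exact M.tail_inv_ne _ h2.symm
  · rintro rfl
    rw [M.dart_ext e (M.inv f) h1 (by rw [M.inv_inv, h2])] at he
    exact hd.2 he.1

theorem exists_mem_bdrySet (hK : M.IsFaceSet K) {d e : D} (hd : K d) (he : ¬ K e) :
    ∃ f, f ∈ M.bdrySet K := by
  by_contra hc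
  have h : ∀ d, K d → K (M.inv d) := fun d hd => by
    by_contra h'
    exact hc ⟨d, hd, h'⟩
  exact he (M.conn K (fun d hd => (hK.rot d).2 (h d hd)) h d e hd)

/-- Connectedness provides a boundary dart, and without loops and parallel edges a boundary walk
cannot close up after one or two steps. -/
theorem three_le_ncard_bdrySet [Finite D] (hK : M.IsFaceSet K) {d e : D} (hd : K d) (he : ¬ K e) :
    3 ≤ (M.bdrySet K).ncard := by
  obtain ⟨f, hf⟩ := exists_mem_bdrySet hK hd he
  obtain ⟨g, hg, h, hh, -, -, h1, h2, h3⟩ := exists_path hK hf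
  have : ({f, g, h} : Set D) ⊆ M.bdrySet K := by
    rintro _ (rfl | rfl | rfl) <;> assumption
  rw [← Set.ncard_eq_three.2 ⟨f, g, h, h1.symm, h3.symm, h2.symm, rfl⟩]
  exact Set.ncard_le_ncard this

/-- Three boundary darts form a directed triangle. -/
theorem exists_triangle [Finite D] (hK : M.IsFaceSet K) (h : (M.bdrySet K).ncard = 3) {d : D}
    (hd : d ∈ M.bdrySet K) :
    ∃ e f, M.bdrySet K = {d, e, f} ∧ M.tail e = M.tail (M.inv d) ∧
      M.tail f = M.tail (M.inv e) ∧ M.tail d = M.tail (M.inv f) := by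
  obtain ⟨e, he, f, hf, h1, h2, h3, h4, h5⟩ := exists_path hK hd
  have hs : ({d, e, f} : Set D) ⊆ M.bdrySet K := by
    rintro _ (rfl | rfl | rfl) <;> assumption
  have heq := Set.eq_of_subset_of_ncard_le hs
    (by rw [h, Set.ncard_eq_three.2 ⟨d, e, f, h3.symm, h5.symm, h4.symm, rfl⟩])
  refine ⟨e, f, heq.symm, h1, h2, ?_⟩
  obtain ⟨g, hg, h6⟩ := exists_next hK hf
  rw [← heq] at hg
  obtain rfl | rfl | rfl := hg
  · exact h6
  · rw [M.dart_ext f (M.inv g) h2 (by rw [M.inv_inv, h6])] at hf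
    exact absurd hf.1 he.2
  · exact absurd h6.symm (M.tail_inv_ne _)

/-- A set `K` of faces bounded by a triangle that consists of the reverses of the darts `d` and
`face d` of the face `f` and of the dart `e`. -/
structure Ear (M : DartMap V D) (K : D → Prop) (f d e : D) : Prop where
  isFaceSet : M.IsFaceSet K
  not_mem : ¬ K f
  sameCycle : M.face.SameCycle f d
  mem : K (M.inv d)
  mem' : K (M.inv (M.face d))
  mem_edge : K e
  not_mem_edge : ¬ K (M.inv e)
  not_sameCycle : ¬ M.face.SameCycle f (M.inv e)
  tail_edge : M.tail e = M.tail d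
  tail_inv_edge : M.tail (M.inv e) = M.tail (M.face (M.face d))
  eq_or : ∀ d', K d' → ¬ K (M.inv d') → d' = M.inv d ∨ d' = M.inv (M.face d) ∨ d' = e

/-- A set of faces with three boundary edges, two of which lie on the short face `f`. -/
theorem exists_ear [Finite D] (h3 : ∀ v, 3 ≤ M.deg v) (hK : M.IsFaceSet K)
    (h : (M.bdrySet K).ncard = 3) {f : D} (hf : ¬ K f) (hf5 : M.faceLen f ≤ 5)
    (h2 : {d | M.face.SameCycle f d ∧ K (M.inv d)}.ncard = 2) :
    ∃ d e, M.Ear K f d e := by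
  obtain ⟨d₁, d₂, hne, h12⟩ := Set.ncard_eq_two.1 h2
  have hF : ∀ d, M.face.SameCycle f d → ¬ K d := fun d hd => mt (hK.sameCycle hd).2 hf
  have hm : ∀ d, M.face.SameCycle f d ∧ K (M.inv d) ↔ d = d₁ ∨ d = d₂ := fun d =>
    Set.ext_iff.1 h12 d
  have key : ∀ d₁ d₂, (∀ d, M.face.SameCycle f d ∧ K (M.inv d) ↔ d = d₁ ∨ d = d₂) → d₁ ≠ d₂ →
      ∀ e, M.bdrySet K = {M.inv d₂, M.inv d₁, e} → M.tail (M.inv d₁) = M.tail (M.inv (M.inv d₂)) →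
      M.tail e = M.tail (M.inv (M.inv d₁)) → M.tail (M.inv d₂) = M.tail (M.inv e) →
      ∃ d e, M.Ear K f d e := by
    intro d₁ d₂ hm hne e hB t1 t2 t3
    rw [M.inv_inv] at t1 t2
    have m1 := (hm d₁).2 (.inl rfl)
    have m2 := (hm d₂).2 (.inr rfl)
    have h21 : d₂ = M.face d₁ := face_simple h3
      (by rwa [M.face_sameCycle_face m2.1])
      (m2.1.symm.trans (Equiv.Perm.sameCycle_apply_right.2 m1.1))
      (by rw [M.tail_face, t1])
    have he : e ∈ M.bdrySet K := by rw [hB]; simp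
    subst h21
    refine ⟨d₁, e, hK, hf, m1.1, m1.2, m2.2, he.1, he.2, fun hc => ?_, t2,
      by rw [← t3, ← M.tail_face], ?_⟩
    · obtain h' | h' := (hm (M.inv e)).1 ⟨hc, by rw [M.inv_inv]; exact he.1⟩
      · rw [h', ← M.tail_face] at t3
        exact tail_face_face_ne h3 d₁ t3
      · rw [h'] at t3
        exact M.tail_inv_ne _ t3
    · intro d' k k'
      have : d' ∈ M.bdrySet K := ⟨k, k'⟩
      rw [hB] at this
      obtain h | h | h := this
      · exact .inr (.inl h)
      · exact .inl h
      · exact .inr (.inr h)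
  have m1 := (hm d₁).2 (.inl rfl)
  have m2 := (hm d₂).2 (.inr rfl)
  have b1 : M.inv d₁ ∈ M.bdrySet K := ⟨m1.2, by rw [M.inv_inv]; exact hF _ m1.1⟩
  have b2 : M.inv d₂ ∈ M.bdrySet K := ⟨m2.2, by rw [M.inv_inv]; exact hF _ m2.1⟩
  obtain ⟨e, g, hB, t1, t2, t3⟩ := exists_triangle hK h b1
  have := b2
  rw [hB] at this
  obtain h' | rfl | rfl := this
  · exact absurd (M.inv.injective h').symm hne
  · exact key d₂ d₁ (fun d => (hm d).trans or_comm) hne.symm g hB t1 t2 t3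
  · refine key d₁ d₂ hm hne e ?_ t3 t1 t2
    rw [hB]
    ext
    simp only [Set.mem_insert_iff, Set.mem_singleton_iff]
    tauto

/-- Here `pF`, `qF` count the edges of `F` to `P`, `Q`, likewise `pG`, `qG` for `G`, and `r` counts
the edges between `F` and `G`. The four lower bounds concern the boundaries of `P`, `Q`, `P ∪ G` and
`P ∪ F`, and the four boundary numbers add up to `2 * (LF + LG) - 2 * r ≤ 16`. So one of them is
three, or all are four and `r = 0`. When one is three, the other bounds exclude a split `3 + 0`, and
the face contributing two has length at least four. -/
theorem cut_arith {pF qF pG qG r LF LG : ℕ} (h1 : pF + qF + r = LF) (h2 : pG + qG + r = LG)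
    (hF : LF ≤ 5) (hG : LG ≤ 5) (hL : LF + LG ≤ 8)
    (a : 3 ≤ pF + pG) (b : 3 ≤ qF + qG) (c : 3 ≤ pF + qG + r) (d : 3 ≤ qF + pG + r) :
    (pF + pG = 3 ∧ (pF = 2 ∧ 4 ≤ LF ∨ pG = 2 ∧ 4 ≤ LG)) ∨
    (qF + qG = 3 ∧ (qF = 2 ∧ 4 ≤ LF ∨ qG = 2 ∧ 4 ≤ LG)) ∨
    (pF + qG + r = 3 ∧ (pF + r = 2 ∧ 4 ≤ LF ∨ qG + r = 2 ∧ 4 ≤ LG)) ∨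
    (qF + pG + r = 3 ∧ (qF + r = 2 ∧ 4 ≤ LF ∨ pG + r = 2 ∧ 4 ≤ LG)) ∨
    (LF = 4 ∧ LG = 4 ∧ pF = 2 ∧ pG = 2 ∧ qF = 2 ∧ qG = 2 ∧ r = 0) := by
  have : pF + pG = 3 ∨ qF + qG = 3 ∨ pF + qG + r = 3 ∨ qF + pG + r = 3 ∨
     (LF + LG = 8 ∧ pF + pG = 4 ∧ qF + qG = 4 ∧ pF + qG = 4 ∧ qF + pG = 4 ∧ r = 0) := by omega
  obtain h | h | h | h | h := this
  · exact .inl ⟨h, by omega⟩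
  · exact .inr (.inl ⟨h, by omega⟩)
  · exact .inr (.inr (.inl ⟨h, by omega⟩))
  · exact .inr (.inr (.inr (.inl ⟨h, by omega⟩)))
  · refine .inr (.inr (.inr (.inr ?_)))
    omega

end DartMap

/-! ### Ears: regions cut off by two consecutive edges of a face and a third edge -/

namespace DartMap

variable {V D : Type*} {M : DartMap V D} {K : D → Prop}

/-- All faces are triangles, except for two quadrangles. -/
def HasTwoQuads (M : DartMap V D) : Prop :=
  ∃ q r, ¬ M.face.SameCycle q r ∧ M.faceLen q = 4 ∧ M.faceLen r = 4 ∧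
    ∀ d, ¬ M.face.SameCycle q d → ¬ M.face.SameCycle r d → M.faceLen d = 3

/-- All faces are triangles, except for a pentagon. -/
def HasPentagon (M : DartMap V D) : Prop :=
  ∃ q, M.faceLen q = 5 ∧ ∀ d, ¬ M.face.SameCycle q d → M.faceLen d = 3

namespace Ear

variable {f d e : D}

/-- The faces outside `K` other than `f`. -/
abbrev rest (M : DartMap V D) (K : D → Prop) (f : D) : D → Prop :=
  fun d => ¬ K d ∧ ¬ M.face.SameCycle f d

theorem isFaceSet_rest (hK : M.IsFaceSet K) : M.IsFaceSet (rest M K f) :=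
  hK.not.and (isFaceSet_sameCycle f).not

variable [Finite D]

theorem not_mem_of_sameCycle (h : M.Ear K f d e) {d' : D} (hd : M.face.SameCycle f d') : ¬ K d' :=
  mt (h.isFaceSet.sameCycle hd).2 h.not_mem

theorem bdry_iff (h : M.Ear K f d e) (u w : V) : M.Bdry K u w ↔
    (u = M.tail (M.face d) ∧ w = M.tail d) ∨
    (u = M.tail (M.face (M.face d)) ∧ w = M.tail (M.face d)) ∨
    (u = M.tail d ∧ w = M.tail (M.face (M.face d))) := by
  constructor
  · rintro ⟨d', rfl, rfl, h1, h2⟩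
    obtain rfl | rfl | rfl := h.eq_or d' h1 h2
    · exact .inl ⟨(M.tail_face d).symm, by rw [M.inv_inv]⟩
    · exact .inr (.inl ⟨(M.tail_face _).symm, by rw [M.inv_inv]⟩)
    · exact .inr (.inr ⟨h.tail_edge, h.tail_inv_edge⟩)
  · rintro (⟨rfl, rfl⟩ | ⟨rfl, rfl⟩ | ⟨rfl, rfl⟩)
    · refine ⟨M.inv d, (M.tail_face d).symm, by rw [M.inv_inv], h.mem, ?_⟩
      rw [M.inv_inv]
      exact h.not_mem_of_sameCycle h.sameCycle
    · refine ⟨M.inv (M.face d), (M.tail_face _).symm, by rw [M.inv_inv], h.mem', ?_⟩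
      rw [M.inv_inv]
      exact h.not_mem_of_sameCycle (Equiv.Perm.sameCycle_apply_right.2 h.sameCycle)
    · exact ⟨e, h.tail_edge, h.tail_inv_edge, h.mem_edge, h.not_mem_edge⟩

/-- The remaining faces are bounded by the reverse of `e` and the reverses of the other edges of
`f`; that `f` does not border itself (`not_sameCycle_inv`) puts the latter into `rest`. -/
theorem bdry_rest (h3 : ∀ v, 3 ≤ M.deg v) (hf : M.faceLen f ≤ 5) (h : M.Ear K f d e) (u w : V) :
    M.Bdry (rest M K f) u w ↔
    (u = M.tail (M.face (M.face d)) ∧ w = M.tail d) ∨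
    ∃ d', M.face.SameCycle f d' ∧ d' ≠ d ∧ d' ≠ M.face d ∧ u = M.tail (M.face d') ∧
      w = M.tail d' := by
  have hne : ∀ {d'}, M.face.SameCycle f d' → ¬ M.face.SameCycle f (M.inv d') := fun hd hc =>
    not_sameCycle_inv h3 (by rwa [M.face_sameCycle_face hd]) (hd.symm.trans hc)
  constructor
  · rintro ⟨d', rfl, rfl, ⟨h1, h2⟩, h4⟩
    by_cases hc : M.face.SameCycle f (M.inv d')
    · refine .inr ⟨M.inv d', hc, ?_, ?_, by rw [M.tail_face, M.inv_inv], rfl⟩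
      · rintro rfl
        have := h.mem
        rw [M.inv_inv] at this
        exact h1 this
      · intro hd
        have := h.mem'
        rw [← hd, M.inv_inv] at this
        exact h1 this
    · have h5 : K (M.inv d') := by
        by_contra h5
        exact h4 ⟨h5, hc⟩
      obtain h6 | h6 | rfl := h.eq_or (M.inv d') h5 (by rwa [M.inv_inv])
      · exact absurd (M.inv.injective h6 ▸ h.sameCycle) h2
      · exact absurd (M.inv.injective h6 ▸ Equiv.Perm.sameCycle_apply_right.2 h.sameCycle) h2
      · refine .inl ⟨?_, h.tail_edge⟩
        have := h.tail_inv_edge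
        rwa [M.inv_inv] at this
  · rintro (⟨rfl, rfl⟩ | ⟨d', h1, h2, h4, rfl, rfl⟩)
    · refine ⟨M.inv e, h.tail_inv_edge, by rw [M.inv_inv, h.tail_edge],
        ⟨h.not_mem_edge, h.not_sameCycle⟩, ?_⟩
      rw [M.inv_inv]
      exact fun h' => h'.1 h.mem_edge
    · refine ⟨M.inv d', (M.tail_face _).symm, by rw [M.inv_inv], ⟨fun hc => ?_, hne h1⟩, ?_⟩
      · obtain h6 | h6 | rfl := h.eq_or _ hc
          (by rw [M.inv_inv]; exact h.not_mem_of_sameCycle h1)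
        · exact h2 (M.inv.injective h6)
        · exact h4 (M.inv.injective h6)
        · exact h.not_sameCycle (by rwa [M.inv_inv])
      · rw [M.inv_inv]
        exact fun h' => h'.2 h1

/-- A vertex off the boundary of a face set, one of whose darts is outside, sees no corner. -/
theorem no_corner {K : D → Prop} (hK : M.IsFaceSet K) {u : V}
    (hB : ∀ w, ¬ M.Bdry K u w ∧ ¬ M.Bdry K w u)
    {d : D} (hd : M.tail d = u) (hn : ¬ K d) (s t : V) : ¬ M.Corner K u s t := by
  rintro ⟨d', h1, -, -, h2⟩
  exact hn (hK.const hB ((M.tail_rot _).trans h1) hd h2)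

theorem sameCycle_iterate {k : ℕ} (hk : minimalPeriod M.face f = k) (h : M.face.SameCycle f d)
    {d' : D}
    (hd : M.face.SameCycle f d') : ∃ i < k, M.face^[i] d = d' := by
  have : minimalPeriod M.face d = k := (M.face_sameCycle_face h).trans hk
  rw [← this]
  exact M.face.sameCycle_iff_exists_iterate.1 (h.symm.trans hd)

/-- An ear on a quadrangle makes both `K` and `rest` triangular regions on the common edge `e`. The
second quadrangle `r` lies in one of them, and the other, purely triangulated one serves as first
region in `Region.quad_aux`. -/
theorem false_of_quad (h3 : ∀ v, 3 ≤ M.deg v) {N : V} (h5 : ∀ v, v ≠ N → M.deg v = 5)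
    (h : M.Ear K f d e) (hf : M.faceLen f = 4) {r : D} (hr : M.faceLen r = 4)
    (hfr : ¬ M.face.SameCycle f r)
    (hL : ∀ d, ¬ M.face.SameCycle f d → ¬ M.face.SameCycle r d → M.faceLen d = 3) : False := by
  have h4 : M.face (M.face (M.face (M.face d))) = d := by
    have := M.iterate_faceLen d
    rwa [M.face_sameCycle_face h.sameCycle, hf] at this
  have hB := h.bdry_iff
  have hs : ∀ i, M.face.SameCycle f (M.face^[i] d) := fun i =>
    h.sameCycle.trans (M.face.sameCycle_iterate _ _)
  have hB' : ∀ u w, M.Bdry (rest M K f) u w ↔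
    (u = M.tail (M.face (M.face (M.face d))) ∧ w = M.tail (M.face (M.face d))) ∨
    (u = M.tail d ∧ w = M.tail (M.face (M.face (M.face d)))) ∨
    (u = M.tail (M.face (M.face d)) ∧ w = M.tail d) := by
    intro u w
    rw [h.bdry_rest h3 (by omega)]
    constructor
    · rintro (h' | ⟨d', h1, h2, h2', rfl, rfl⟩)
      · exact .inr (.inr h')
      · obtain ⟨i, hi, rfl⟩ := sameCycle_iterate hf h.sameCycle h1
        interval_cases i
        · exact absurd rfl h2
        · exact absurd rfl h2'
        · exact .inl ⟨rfl, rfl⟩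
        · exact .inr (.inl ⟨congrArg M.tail h4, rfl⟩)
    · have hne : ∀ i j, i < 4 → j < 4 → i ≠ j → M.face^[i] d ≠ M.face^[j] d := by
        intro i j hi hj hij hc
        have : minimalPeriod M.face d = 4 := (M.face_sameCycle_face h.sameCycle).trans hf
        exact hij ((iterate_eq_iterate_iff_of_lt_minimalPeriod (by rwa [this])
          (by rwa [this])).1 hc)
      rintro (⟨rfl, rfl⟩ | ⟨rfl, rfl⟩ | h')
      · exact .inr ⟨M.face^[2] d, hs 2, hne 2 0 (by simp) (by simp) (by simp),
          hne 2 1 (by simp) (by simp) (by simp), rfl, rfl⟩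
      · exact .inr ⟨M.face^[3] d, hs 3, hne 3 0 (by simp) (by simp) (by simp),
          hne 3 1 (by simp) (by simp) (by simp), congrArg M.tail h4.symm, rfl⟩
      · exact .inl h'
  have ha := M.corner_face d
  have hy := M.corner_face (M.face d)
  have hb := M.corner_face (M.face (M.face d))
  have hx := M.corner_face (M.face (M.face (M.face d)))
  rw [h4] at hb hx
  have xa := M.tail_face_ne d
  have ay := M.tail_face_ne (M.face d)
  have yb := M.tail_face_ne (M.face (M.face d))
  have bx := M.tail_face_ne (M.face (M.face (M.face d)))
  rw [h4] at bx
  have xy := tail_face_face_ne h3 d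
  have ab := tail_face_face_ne h3 (M.face d)
  have hF := h.isFaceSet
  have hF' := isFaceSet_rest (f := f) hF
  have hNa : ∀ s t, ¬ M.Corner (rest M K f) (M.tail (M.face d)) s t :=
    no_corner hF' (fun w => by rw [hB', hB']; grind) rfl (fun hc => hc.2 (hs 1))
  have hNb : ∀ s t, ¬ M.Corner K (M.tail (M.face (M.face (M.face d)))) s t :=
    no_corner hF (fun w => by rw [hB, hB]; grind) rfl (h.not_mem_of_sameCycle (hs 3))
  -- A vertex other than the two ends of `e` sees faces of at most one of the two regions.
  have hN : ∀ s t s' t', N ≠ M.tail d → N ≠ M.tail (M.face (M.face d)) → M.Corner K N s t →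
      ¬ M.Corner (rest M K f) N s' t' := by
    intro s t s' t' n1 n2 c1 c2
    by_cases hNa' : N = M.tail (M.face d)
    · subst hNa'
      exact hNa _ _ c2
    · obtain ⟨d', h1, -, -, h2⟩ := c2
      exact no_corner hF (fun w => by rw [hB, hB]; grind) ((M.tail_rot d').trans h1) h2.1 _ _ c1
  have h5' : ∀ u ≠ N, FullFive (M.Corner fun _ => True) u := fun u hu => fullFive (h5 u hu)
  by_cases hrK : K r
  · have hR : TriangleCorners (M.Corner (rest M K f)) :=
      triangleCorners h3 (fun d' hd' => hL d' hd'.2 fun hc => hd'.1 ((hF.sameCycle hc).1 hrK)) hF'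
    exact (region hF').quad_aux (region hF) (corners h3 _) hR
      (.inr (quadCorners h3 hF hrK hr fun d' hd' =>
        hL d' fun hc => h.not_mem_of_sameCycle hc hd')) h5'
      hB' hB (fun s t s' t' n1 n2 c1 c2 => hN _ _ _ _ n2 n1 c2 c1) hNb hNa hb hx ha hy ab
  · have hR : TriangleCorners (M.Corner K) :=
      triangleCorners h3 (fun d' hd' => hL d' (fun hc => h.not_mem_of_sameCycle hc hd')
        fun hc => hrK ((hF.sameCycle hc).2 hd')) hF
    exact (region hF).quad_aux (region hF') (corners h3 _) hR
      (.inr (quadCorners h3 hF' ⟨hrK, hfr⟩ hr fun d' hd' =>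
        hL d' hd'.2)) h5' hB hB' hN hNa hNb ha hy hb hx ab.symm

/-- An ear on the pentagon leaves a triangulated triangle `K` and a triangulated quadrangle `rest`,
the situation of `Region.pentagon_aux`. -/
theorem false_of_pentagon (h3 : ∀ v, 3 ≤ M.deg v) {N : V} (h5 : ∀ v, v ≠ N → M.deg v = 5)
    (h : M.Ear K f d e) (hf : M.faceLen f = 5)
    (hL : ∀ d, ¬ M.face.SameCycle f d → M.faceLen d = 3) : False := by
  have h4 : M.face (M.face (M.face (M.face (M.face d)))) = d := by
    have := M.iterate_faceLen d
    rwa [M.face_sameCycle_face h.sameCycle, hf] at this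
  have hd5 : M.faceLen d = 5 := (M.face_sameCycle_face h.sameCycle).trans hf
  have hB := h.bdry_iff
  have hs : ∀ i, M.face.SameCycle f (M.face^[i] d) := fun i =>
    h.sameCycle.trans (M.face.sameCycle_iterate _ _)
  have hne : ∀ i j, i < 5 → j < 5 → i ≠ j → M.tail (M.face^[i] d) ≠ M.tail (M.face^[j] d) := by
    intro i j hi hj hij hc
    have := face_simple h3 (by rw [M.face_sameCycle_face (hs i), hf])
      ((hs i).symm.trans (hs j)) hc
    exact hij ((iterate_eq_iterate_iff_of_lt_minimalPeriod (by rwa [← faceLen, hd5])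
      (by rwa [← faceLen, hd5])).1 this)
  have hB' : ∀ u w, M.Bdry (rest M K f) u w ↔
    (u = M.tail (M.face (M.face (M.face d))) ∧ w = M.tail (M.face (M.face d))) ∨
    (u = M.tail (M.face (M.face (M.face (M.face d)))) ∧
      w = M.tail (M.face (M.face (M.face d)))) ∨
    (u = M.tail d ∧ w = M.tail (M.face (M.face (M.face (M.face d))))) ∨
    (u = M.tail (M.face (M.face d)) ∧ w = M.tail d) := by
    intro u w
    rw [h.bdry_rest h3 (by omega)]
    constructor
    · rintro (h' | ⟨d', h1, h2, h2', rfl, rfl⟩)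
      · exact .inr (.inr (.inr h'))
      · obtain ⟨i, hi, rfl⟩ := sameCycle_iterate hf h.sameCycle h1
        interval_cases i
        · exact absurd rfl h2
        · exact absurd rfl h2'
        · exact .inl ⟨rfl, rfl⟩
        · exact .inr (.inl ⟨rfl, rfl⟩)
        · exact .inr (.inr (.inl ⟨congrArg M.tail h4, rfl⟩))
    · have hne' : ∀ i j, i < 5 → j < 5 → i ≠ j → M.face^[i] d ≠ M.face^[j] d :=
        fun i j hi hj hij hc => hne i j hi hj hij (congrArg _ hc)
      rintro (⟨rfl, rfl⟩ | ⟨rfl, rfl⟩ | ⟨rfl, rfl⟩ | h')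
      · exact .inr ⟨M.face^[2] d, hs 2, hne' 2 0 (by simp) (by simp) (by simp),
          hne' 2 1 (by simp) (by simp) (by simp), rfl, rfl⟩
      · exact .inr ⟨M.face^[3] d, hs 3, hne' 3 0 (by simp) (by simp) (by simp),
          hne' 3 1 (by simp) (by simp) (by simp), rfl, rfl⟩
      · exact .inr ⟨M.face^[4] d, hs 4, hne' 4 0 (by simp) (by simp) (by simp),
          hne' 4 1 (by simp) (by simp) (by simp), congrArg M.tail h4.symm, rfl⟩
      · exact .inl h'
  have ha := M.corner_face d
  have hy := M.corner_face (M.face d)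
  have hb := M.corner_face (M.face (M.face d))
  have hc := M.corner_face (M.face (M.face (M.face d)))
  have hx := M.corner_face (M.face (M.face (M.face (M.face d))))
  rw [h4] at hc hx
  have hn : [M.tail d, M.tail (M.face d), M.tail (M.face (M.face d)),
      M.tail (M.face (M.face (M.face d))), M.tail (M.face (M.face (M.face (M.face d))))].Nodup := by
    have : (List.map (fun i => M.tail (M.face^[i] d)) (List.range 5)).Nodup := by
      refine List.Nodup.map_on (fun i hi j hj hij => ?_) List.nodup_range
      rw [List.mem_range] at hi hj
      by_contra hc
      exact hne i j hi hj hc hij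
    exact this
  have hn' := hn
  simp only [List.nodup_cons, List.mem_cons, List.not_mem_nil, or_false, not_or, not_false_eq_true,
    List.nodup_nil, and_true] at hn'
  have hF := h.isFaceSet
  have hF' := isFaceSet_rest (f := f) hF
  have hNa : ∀ s t, ¬ M.Corner (rest M K f) (M.tail (M.face d)) s t :=
    no_corner hF' (fun w => by rw [hB', hB']; grind) rfl (fun hc => hc.2 (hs 1))
  have hNb : ∀ s t, ¬ M.Corner K (M.tail (M.face (M.face (M.face d)))) s t :=
    no_corner hF (fun w => by rw [hB, hB]; grind) rfl (h.not_mem_of_sameCycle (hs 3))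
  have hNc : ∀ s t, ¬ M.Corner K (M.tail (M.face (M.face (M.face (M.face d))))) s t :=
    no_corner hF (fun w => by rw [hB, hB]; grind) rfl (h.not_mem_of_sameCycle (hs 4))
  have hN : ∀ s t s' t', N ≠ M.tail d → N ≠ M.tail (M.face (M.face d)) → M.Corner K N s t →
      ¬ M.Corner (rest M K f) N s' t' := by
    intro s t s' t' n1 n2 c1 c2
    by_cases hNa' : N = M.tail (M.face d)
    · subst hNa'
      exact hNa _ _ c2
    · obtain ⟨d', h1, -, -, h2⟩ := c2
      exact no_corner hF (fun w => by rw [hB, hB]; grind) ((M.tail_rot d').trans h1) h2.1 _ _ c1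
  have hR : TriangleCorners (M.Corner K) :=
    triangleCorners h3 (fun d' hd' => hL d' (fun hc => h.not_mem_of_sameCycle hc hd')) hF
  have hR' : TriangleCorners (M.Corner (rest M K f)) :=
    triangleCorners h3 (fun d' hd' => hL d' hd'.2) hF'
  exact (region hF).pentagon_aux (region hF') (corners h3 _) hR hR'
    (fun u hu => fullFive (h5 u hu)) hB hB' hN hNa hNb hNc ha hy hb hc hx hn

end Ear

end DartMap

/-! ### Two quadrangles with two edges each on the same face set -/

namespace DartMap

variable {V D : Type*} {M : DartMap V D} {P Q : D → Prop}

theorem face_four [Finite D] {f d : D} (hf : M.faceLen f = 4) (h : M.face.SameCycle f d) :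
    M.face (M.face (M.face (M.face d))) = d := by
  have := M.iterate_faceLen d
  rwa [M.face_sameCycle_face h, hf] at this

theorem eq_or_of_ncard_two {α : Type*} {S : Set α} (hS : S.ncard = 2) {a b : α} (ha : a ∈ S)
    (hb : b ∈ S) (hab : a ≠ b) {c : α} (hc : c ∈ S) : c = a ∨ c = b := by
  have : S = {a, b} := by
    refine (Set.eq_of_subset_of_ncard_le ?_ (by rw [hS, Set.ncard_pair hab])
      (Set.finite_of_ncard_ne_zero (by omega))).symm
    rintro _ (rfl | rfl) <;> assumption
  rw [this] at hc
  exact hc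

/-- Up to the choice of the starting dart, two of the four sides of a quadrangle are consecutive or
opposite. -/
theorem two_of_four [Finite D] (h3 : ∀ v, 3 ≤ M.deg v) {f : D} (hf : M.faceLen f = 4)
    {T : D → Prop} (h2 : {d | M.face.SameCycle f d ∧ T d}.ncard = 2) :
    ∃ d, M.face.SameCycle f d ∧ T d ∧ ¬ T (M.face (M.face (M.face d))) ∧
      (T (M.face d) ∧ ¬ T (M.face (M.face d)) ∨ ¬ T (M.face d) ∧ T (M.face (M.face d))) := by
  obtain ⟨d₁, d₂, hne, h12⟩ := Set.ncard_eq_two.1 h2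
  have hm : ∀ d, M.face.SameCycle f d ∧ T d ↔ d = d₁ ∨ d = d₂ := fun d => Set.ext_iff.1 h12 d
  have m1 := (hm d₁).2 (.inl rfl)
  have m2 := (hm d₂).2 (.inr rfl)
  have h4 := face_four hf m1.1
  have hr := rot_ne h3
  have e1 : ∀ d, M.face d ≠ d := M.face_ne
  have e2 : ∀ d, M.face (M.face d) ≠ d := fun d => M.face_face_ne d (hr d)
  have hs : ∀ d, M.face.SameCycle f d → M.face.SameCycle f (M.face d) :=
    fun d => Equiv.Perm.sameCycle_apply_right.2
  obtain ⟨i, hi, h⟩ := Ear.sameCycle_iterate hf m1.1 m2.1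
  have e3 := M.face.injective
  interval_cases i
  · exact absurd h hne
  · replace h : M.face d₁ = d₂ := h
    refine ⟨d₁, m1.1, m1.2, fun hT => ?_, .inl ⟨h ▸ m2.2, fun hT => ?_⟩⟩
    · rcases (hm _).1 ⟨hs _ (hs _ (hs _ m1.1)), hT⟩ with h' | h' <;> grind
    · rcases (hm _).1 ⟨hs _ (hs _ m1.1), hT⟩ with h' | h' <;> grind
  · replace h : M.face (M.face d₁) = d₂ := h
    refine ⟨d₁, m1.1, m1.2, fun hT => ?_, .inr ⟨fun hT => ?_, h ▸ m2.2⟩⟩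
    · rcases (hm _).1 ⟨hs _ (hs _ (hs _ m1.1)), hT⟩ with h' | h' <;> grind
    · rcases (hm _).1 ⟨hs _ m1.1, hT⟩ with h' | h' <;> grind
  · replace h : M.face (M.face (M.face d₁)) = d₂ := h
    have h' : M.face d₂ = d₁ := by rw [← h, h4]
    refine ⟨d₂, m2.1, m2.2, fun hT => ?_, .inl ⟨h' ▸ m1.2, fun hT => ?_⟩⟩
    · rcases (hm _).1 ⟨hs _ (hs _ (hs _ m2.1)), hT⟩ with h' | h' <;> grind
    · rcases (hm _).1 ⟨hs _ (hs _ m2.1), hT⟩ with h' | h' <;> grind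

/-- A set of faces that has two edges in common with each of two quadrangles. -/
theorem exists_lens [Finite D] (h3 : ∀ v, 3 ≤ M.deg v) (hP : M.IsFaceSet P) {f g : D}
    (hfg : ¬ M.face.SameCycle f g) (hf : M.faceLen f = 4) (hg : M.faceLen g = 4) (hPf : ¬ P f)
    (hPg : ¬ P g)
    (h2f : {d | M.face.SameCycle f d ∧ P (M.inv d)}.ncard = 2)
    (h2g : {d | M.face.SameCycle g d ∧ P (M.inv d)}.ncard = 2)
    (hB : ∀ d ∈ M.bdrySet P, M.face.SameCycle f (M.inv d) ∨ M.face.SameCycle g (M.inv d)) :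
    ∃ d e, M.face.SameCycle f d ∧ M.face.SameCycle g e ∧ P (M.inv d) ∧ P (M.inv (M.face d)) ∧
      P (M.inv e) ∧ P (M.inv (M.face e)) ∧ M.tail e = M.tail (M.face (M.face d)) ∧
      M.tail (M.face (M.face e)) = M.tail d := by
  have hF : ∀ {d}, M.face.SameCycle f d → ¬ P d := fun hd => mt (hP.sameCycle hd).2 hPf
  have hG : ∀ {d}, M.face.SameCycle g d → ¬ P d := fun hd => mt (hP.sameCycle hd).2 hPg
  obtain ⟨d, hd, p0, p3, hd'⟩ := two_of_four h3 hf h2f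
  have hs : ∀ {d}, M.face.SameCycle f d → M.face.SameCycle f (M.face d) :=
    Equiv.Perm.sameCycle_apply_right.2
  have hfs : ∀ {d e}, M.face.SameCycle f d → M.face.SameCycle f e → M.tail d = M.tail e → d = e :=
    fun h1 h2 => face_simple h3 (by rw [M.face_sameCycle_face h1]; omega) (h1.symm.trans h2)
  have t1 := M.tail_face_ne d
  have t2 := tail_face_face_ne h3 d
  have t3 := M.tail_face_ne (M.face d)
  have t4 := tail_face_face_ne h3 (M.face d)
  have t5 := M.tail_face_ne (M.face (M.face d))
  have t6 := M.tail_face_ne (M.face (M.face (M.face d)))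
  have h4 := face_four hf hd
  rw [h4] at t6
  have b0 : M.inv d ∈ M.bdrySet P := ⟨p0, by rw [M.inv_inv]; exact hF hd⟩
  have i0 : M.tail (M.inv d) = M.tail (M.face d) := (M.tail_face d).symm
  have i1 : M.tail (M.inv (M.face d)) = M.tail (M.face (M.face d)) := (M.tail_face _).symm
  have i2 : M.tail (M.inv (M.face (M.face d))) = M.tail (M.face (M.face (M.face d))) :=
    (M.tail_face _).symm
  have i3 : M.tail (M.inv (M.face (M.face (M.face d)))) = M.tail d := by
    rw [← M.tail_face, h4]
  have hext : ∀ {d e}, M.tail d = M.tail e → M.tail (M.inv d) = M.tail (M.inv e) → d = e :=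
    @fun d e => M.dart_ext d e
  have gtype : ∀ s ∈ M.bdrySet P, (∀ e, M.face.SameCycle f e → P (M.inv e) → s ≠ M.inv e) →
      M.face.SameCycle g (M.inv s) := by
    intro s hs hc
    refine (hB s hs).resolve_left fun h => hc _ h ?_ (M.inv_inv s).symm
    rw [M.inv_inv]
    exact hs.1
  have two : ∀ {s t u}, s ∈ M.bdrySet P → t ∈ M.bdrySet P → u ∈ M.bdrySet P →
      M.face.SameCycle g (M.inv s) → M.face.SameCycle g (M.inv t) → M.face.SameCycle g (M.inv u) →
      s ≠ t → u = s ∨ u = t := by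
    intro s t u hs ht hu gs gt gu hst
    have hm : ∀ {s}, s ∈ M.bdrySet P → M.face.SameCycle g (M.inv s) →
        M.inv s ∈ {d | M.face.SameCycle g d ∧ P (M.inv d)} := fun hs gs =>
      ⟨gs, by rw [M.inv_inv]; exact hs.1⟩
    have := eq_or_of_ncard_two h2g (hm hs gs) (hm ht gt) (M.inv.injective.ne hst) (hm hu gu)
    exact this.imp (fun h => M.inv.injective h) fun h => M.inv.injective h
  have twof : ∀ {e' e}, M.face.SameCycle f e' → P (M.inv e') → d ≠ e' →
      M.face.SameCycle f e → P (M.inv e) → e = d ∨ e = e' := 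
    fun h1 h2 hne h5 h6 => eq_or_of_ncard_two h2f ⟨hd, p0⟩ ⟨h1, h2⟩ hne ⟨h5, h6⟩
  obtain ⟨p1, p2⟩ | ⟨p1, p2⟩ := hd'
  -- Consecutive sides: the boundary of `P` runs through `t`, `inv (face d)`, `inv d` and `s`, where
  -- `s` and `t` lie on `g`.
  · have b1 : M.inv (M.face d) ∈ M.bdrySet P := ⟨p1, by rw [M.inv_inv]; exact hF (hs hd)⟩
    obtain ⟨s, bs, ts⟩ := exists_next hP b0
    obtain ⟨t, bt, tt⟩ := exists_prev hP b1
    rw [M.inv_inv] at ts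
    rw [i1] at tt
    have hne : d ≠ M.face d := (M.face_ne d).symm
    have gs := gtype s bs fun e h5 h6 => by
      rintro rfl
      obtain rfl | rfl := twof (hs hd) p1 hne h5 h6 <;> grind
    have gt := gtype t bt fun e h5 h6 => by
      rintro rfl
      rw [M.inv_inv] at tt
      obtain rfl | rfl := twof (hs hd) p1 hne h5 h6 <;> grind
    have all : ∀ u ∈ M.bdrySet P, u = M.inv d ∨ u = M.inv (M.face d) ∨
        M.face.SameCycle g (M.inv u) := by
      intro u hu
      by_contra hc
      push Not at hc
      refine hc.2.2 (gtype u hu fun e h5 h6 => ?_)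
      rintro rfl
      obtain rfl | rfl := twof (hs hd) p1 hne h5 h6
      · exact hc.1 rfl
      · exact hc.2.1 rfl
    -- If `s = t`, the three darts already form a triangle, and the second side `h` of `g` must join
    -- two of its vertices, parallel to an existing edge.
    by_cases hst : s = t
    · subst hst
      have : ∃ h, h ∈ M.bdrySet P ∧ M.face.SameCycle g (M.inv h) ∧ h ≠ s := by
        obtain ⟨d₁, d₂, hne, h12⟩ := Set.ncard_eq_two.1 h2g
        have m1 : d₁ ∈ {d | M.face.SameCycle g d ∧ P (M.inv d)} := by rw [h12]; simp
        have m2 : d₂ ∈ {d | M.face.SameCycle g d ∧ P (M.inv d)} := by rw [h12]; simp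
        by_cases h : M.inv d₁ = s
        · refine ⟨M.inv d₂, ⟨m2.2, ?_⟩, ?_, fun h' => hne (M.inv.injective (h.trans h'.symm))⟩
          · rw [M.inv_inv]; exact hG m2.1
          · rw [M.inv_inv]; exact m2.1
        · refine ⟨M.inv d₁, ⟨m1.2, ?_⟩, ?_, h⟩
          · rw [M.inv_inv]; exact hG m1.1
          · rw [M.inv_inv]; exact m1.1
      obtain ⟨h, bh, gh, hs'⟩ := this
      obtain ⟨n, bn, tn⟩ := exists_next hP bh
      obtain ⟨r, br, tr⟩ := exists_prev hP bh
      have alls : ∀ u ∈ M.bdrySet P, u = M.inv d ∨ u = M.inv (M.face d) ∨ u = s ∨ u = h := by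
        intro u hu
        obtain h' | h' | h' := all u hu
        · exact .inl h'
        · exact .inr (.inl h')
        · exact .inr (.inr (two bs bh hu gs gh h' hs'.symm))
      have k1 : h ≠ M.inv d := by
        rintro rfl
        rw [M.inv_inv] at gh
        exact hfg (hd.trans gh.symm)
      have k2 : h ≠ M.inv (M.face d) := by
        rintro rfl
        rw [M.inv_inv] at gh
        exact hfg ((hs hd).trans gh.symm)
      have k3 : M.tail (M.inv h) = M.tail d ∨ M.tail (M.inv h) = M.tail (M.face d) ∨
          M.tail (M.inv h) = M.tail (M.face (M.face d)) := by
        have := M.tail_inv_ne h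
        rcases alls n bn with rfl | rfl | rfl | rfl <;> grind
      have k4 : M.tail h = M.tail d ∨ M.tail h = M.tail (M.face d) ∨
          M.tail h = M.tail (M.face (M.face d)) := by
        have := M.tail_inv_ne h
        have := M.inv_inv
        rcases alls r br with rfl | rfl | rfl | rfl <;> grind
      have k5 := M.tail_inv_ne h
      have k6 : h ≠ d := fun hc => hF hd (hc ▸ bh.1)
      have k7 : h ≠ M.face d := fun hc => hF (hs hd) (hc ▸ bh.1)
      have k8 : h ≠ M.inv s := fun hc => bs.2 (hc ▸ bh.1)
      have := M.inv_inv
      rcases k3 with k3 | k3 | k3 <;> rcases k4 with k4 | k4 | k4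
      · exact (k5 (k3.trans k4.symm)).elim
      · exact (k1 (hext (k4.trans i0.symm) (by rw [this, k3]))).elim
      · exact (k8 (hext (k4.trans tt.symm) (by rw [this, k3, ts]))).elim
      · exact (k6 (hext k4 (by rw [k3, i0]))).elim
      · exact (k5 (k3.trans k4.symm)).elim
      · exact (k2 (hext (k4.trans i1.symm) (by rw [this, k3]))).elim
      · exact (hs' (hext (k4.trans ts.symm) (by rw [tt, k3]))).elim
      · exact (k7 (hext k4 (by rw [k3, i1]))).elim
      · exact (k5 (k3.trans k4.symm)).elim
    · have alls : ∀ u ∈ M.bdrySet P, u = M.inv d ∨ u = M.inv (M.face d) ∨ u = s ∨ u = t := by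
        intro u hu
        obtain h' | h' | h' := all u hu
        · exact .inl h'
        · exact .inr (.inl h')
        · exact .inr (.inr (two bs bt hu gs gt h' hst))
      -- With only four boundary darts, the successor of `s` can be none but `t`.
      have hst' : M.tail t = M.tail (M.inv s) := by
        obtain ⟨w, bw, tw⟩ := exists_next hP bs
        obtain rfl | rfl | rfl | rfl := alls w bw
        · exact (hF hd (hext ts (by rw [← tw]) ▸ bs.1)).elim
        · exfalso
          obtain ⟨z, bz, tz⟩ := exists_prev hP bt
          obtain rfl | rfl | rfl | rfl := alls z bz
          · rw [M.inv_inv] at tz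
            exact hst (hext (ts.trans tz) (by rw [tt, ← i1, tw]))
          · rw [M.inv_inv] at tz
            exact hF (hs hd) (hext tz.symm (by rw [tt, i1]) ▸ bt.1)
          · exact M.tail_inv_ne t (by rw [tt, ← i1, tw, tz])
          · exact M.tail_inv_ne _ tz
        · exact absurd tw.symm (M.tail_inv_ne _)
        · exact tw
      have hse : M.inv s = M.face (M.inv t) := face_simple h3
        (by rw [M.face_sameCycle_face gs]; omega)
        (gs.symm.trans (Equiv.Perm.sameCycle_apply_right.2 gt))
        (by rw [M.tail_face, M.inv_inv, hst'])
      refine ⟨d, M.inv t, hd, gt, p0, p1, by rw [M.inv_inv]; exact bt.1,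
        by rw [← hse, M.inv_inv]; exact bs.1, tt, ?_⟩
      rw [← hse, M.tail_face, M.inv_inv, ts]
  -- Opposite sides: the boundary darts at their ends all belong to `g`, and since `g` contributes
  -- only two, one of them is the reverse of a further side of `f`, which is not adjacent to `P`.
  · exfalso
    have b2 : M.inv (M.face (M.face d)) ∈ M.bdrySet P :=
      ⟨p2, by rw [M.inv_inv]; exact hF (hs (hs hd))⟩
    have hne : d ≠ M.face (M.face d) := fun h => t2 (congrArg M.tail h.symm)
    obtain ⟨s, bs, ts⟩ := exists_next hP b0
    obtain ⟨t, bt, tt⟩ := exists_next hP b2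
    obtain ⟨r, br, tr⟩ := exists_prev hP b0
    obtain ⟨u, bu, tu⟩ := exists_prev hP b2
    rw [M.inv_inv] at ts tt
    rw [i0] at tr
    rw [i2] at tu
    have t7 : M.tail (M.face (M.face (M.face d))) ≠ M.tail d := t6.symm
    have gs := gtype s bs fun e h5 h6 => by
      rintro rfl
      obtain rfl | rfl := twof (hs (hs hd)) p2 hne h5 h6 <;> grind
    have gt := gtype t bt fun e h5 h6 => by
      rintro rfl
      obtain rfl | rfl := twof (hs (hs hd)) p2 hne h5 h6 <;> grind
    have gr := gtype r br fun e h5 h6 => by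
      rintro rfl
      rw [M.inv_inv] at tr
      obtain rfl | rfl := twof (hs (hs hd)) p2 hne h5 h6 <;> grind
    have gu := gtype u bu fun e h5 h6 => by
      rintro rfl
      rw [M.inv_inv] at tu
      obtain rfl | rfl := twof (hs (hs hd)) p2 hne h5 h6 <;> grind
    have hst : s ≠ t := fun h => t2 (by rw [← tt, ← h, ts])
    have hrs : r ≠ s := by
      rintro rfl
      exact hF hd (hext ts (by rw [tr, i0]) ▸ br.1)
    have hru : r ≠ u := by
      rintro rfl
      exact t4 (tu.symm.trans tr)
    obtain rfl : r = t := (two bs bt br gs gt gr hst).resolve_left hrs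
    obtain rfl : u = s := (two bs bt bu gs gt gu hst).resolve_right hru.symm
    have : u = M.inv (M.face (M.face (M.face d))) := hext (by rw [ts, i3]) (by rw [tu, M.inv_inv])
    exact p3 (this ▸ bu.1)

theorem quad_sides [Finite D] {f d : D} (hf : M.faceLen f = 4)
    (hd : M.face.SameCycle f d) {T : D → Prop}
    (h2 : {d | M.face.SameCycle f d ∧ T d}.ncard = 2) (h0 : T d) (h1 : T (M.face d)) (d' : D)
    (hd' : M.face.SameCycle f d') :
    T d' ∧ (d' = d ∨ d' = M.face d) ∨
      ¬ T d' ∧ (d' = M.face (M.face d) ∨ d' = M.face (M.face (M.face d))) := by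
  have key := fun c hc => eq_or_of_ncard_two h2 (a := d) (b := M.face d) ⟨hd, h0⟩
    ⟨Equiv.Perm.sameCycle_apply_right.2 hd, h1⟩ (M.face_ne d).symm (c := c) hc
  by_cases hT : T d'
  · exact .inl ⟨hT, key d' ⟨hd', hT⟩⟩
  · refine .inr ⟨hT, ?_⟩
    obtain ⟨i, hi, rfl⟩ := Ear.sameCycle_iterate hf hd hd'
    interval_cases i
    · exact absurd h0 hT
    · exact absurd h1 hT
    · exact .inl rfl
    · exact .inr rfl

theorem face_two_ne [Finite D] (h3 : ∀ v, 3 ≤ M.deg v) {f d : D} (hf : M.faceLen f = 4)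
    (hd : M.face.SameCycle f d) {T : D → Prop}
    (h2 : {d | M.face.SameCycle f d ∧ T d}.ncard = 2) (h0 : T d) (h1 : T (M.face d)) :
    ¬ T (M.face (M.face d)) ∧ ¬ T (M.face (M.face (M.face d))) := by
  have t2 := tail_face_face_ne h3 d
  have t3 := M.tail_face_ne (M.face d)
  have t4 := tail_face_face_ne h3 (M.face d)
  have t6 := M.tail_face_ne (M.face (M.face (M.face d)))
  rw [face_four hf hd] at t6
  have hs : ∀ {d}, M.face.SameCycle f d → M.face.SameCycle f (M.face d) :=
    Equiv.Perm.sameCycle_apply_right.2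
  refine ⟨fun h => ?_, fun h => ?_⟩
  · rcases quad_sides hf hd h2 h0 h1 _ (hs (hs hd)) with ⟨-, h' | h'⟩ | h'
    · exact t2 (congrArg _ h')
    · exact t3 (congrArg _ h')
    · exact h'.1 h
  · rcases quad_sides hf hd h2 h0 h1 _ (hs (hs (hs hd))) with ⟨-, h' | h'⟩ | h'
    · exact t6 (congrArg _ h'.symm)
    · exact t4 (congrArg _ h')
    · exact h'.1 h

/-- Two quadrangles do not separate the other faces into two parts that have two edges in common
with each of them. -/
theorem false_of_lens [Finite D] (h3 : ∀ v, 3 ≤ M.deg v) {N : V}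
    (h5 : ∀ v, v ≠ N → M.deg v = 5) (hP : M.IsFaceSet P) (hQ : M.IsFaceSet Q)
    (hPQ : ∀ d, P d → ¬ Q d) {f g : D} (hfg : ¬ M.face.SameCycle f g)
    (hf : M.faceLen f = 4) (hg : M.faceLen g = 4) (hPf : ¬ P f) (hPg : ¬ P g) (hQf : ¬ Q f)
    (hQg : ¬ Q g) (h2f : {d | M.face.SameCycle f d ∧ P (M.inv d)}.ncard = 2)
    (h2g : {d | M.face.SameCycle g d ∧ P (M.inv d)}.ncard = 2)
    (hfQ : ∀ d, M.face.SameCycle f d → P (M.inv d) ∨ Q (M.inv d))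
    (hgQ : ∀ d, M.face.SameCycle g d → P (M.inv d) ∨ Q (M.inv d))
    (hBP : ∀ d ∈ M.bdrySet P, M.face.SameCycle f (M.inv d) ∨ M.face.SameCycle g (M.inv d))
    (hBQ : ∀ d ∈ M.bdrySet Q, M.face.SameCycle f (M.inv d) ∨ M.face.SameCycle g (M.inv d))
    (hLP : ∀ d, P d → M.faceLen d = 3) (hLQ : ∀ d, Q d → M.faceLen d = 3) : False := by
  obtain ⟨d, e, hd, he, d0, d1, e0, e1, tail_e, tail_d⟩ :=
    exists_lens h3 hP hfg hf hg hPf hPg h2f h2g hBP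
  have sf : ∀ {d}, M.face.SameCycle f d → M.face.SameCycle f (M.face d) :=
    Equiv.Perm.sameCycle_apply_right.2
  have sg : ∀ {d}, M.face.SameCycle g d → M.face.SameCycle g (M.face d) :=
    Equiv.Perm.sameCycle_apply_right.2
  have hF : ∀ {d}, M.face.SameCycle f d → ¬ P d := fun hd => mt (hP.sameCycle hd).2 hPf
  have hG : ∀ {d}, M.face.SameCycle g d → ¬ P d := fun hd => mt (hP.sameCycle hd).2 hPg
  have hF' : ∀ {d}, M.face.SameCycle f d → ¬ Q d := fun hd => mt (hQ.sameCycle hd).2 hQf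
  have hG' : ∀ {d}, M.face.SameCycle g d → ¬ Q d := fun hd => mt (hQ.sameCycle hd).2 hQg
  have df := quad_sides hf hd h2f d0 d1
  have eg := quad_sides hg he h2g e0 e1
  have d23 := face_two_ne h3 hf hd h2f d0 d1
  have e23 := face_two_ne h3 hg he h2g e0 e1
  have d2 := (hfQ _ (sf (sf hd))).resolve_left d23.1
  have d3 := (hfQ _ (sf (sf (sf hd)))).resolve_left d23.2
  have e2 := (hgQ _ (sg (sg he))).resolve_left e23.1
  have e3 := (hgQ _ (sg (sg (sg he)))).resolve_left e23.2
  have d4 := face_four hf hd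
  have e4 := face_four hg he
  have ti : ∀ d, M.tail (M.inv d) = M.tail (M.face d) := fun d => (M.tail_face d).symm
  have bd : ∀ u w, M.Bdry P u w ↔ (u = M.tail (M.face d) ∧ w = M.tail d) ∨
      (u = M.tail (M.face (M.face d)) ∧ w = M.tail (M.face d)) ∨
      (u = M.tail (M.face e) ∧ w = M.tail (M.face (M.face d))) ∨
      (u = M.tail d ∧ w = M.tail (M.face e)) := by
    intro u w
    constructor
    · rintro ⟨s, rfl, rfl, h1, h2⟩
      rcases hBP s ⟨h1, h2⟩ with h | h
      · obtain ⟨-, h' | h'⟩ | ⟨h', -⟩ := df _ h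
        · exact .inl ⟨by rw [← h', M.tail_face, M.inv_inv], by rw [h']⟩
        · exact .inr (.inl ⟨by rw [← h', M.tail_face, M.inv_inv], by rw [h']⟩)
        · exact absurd (by rwa [M.inv_inv]) h'
      · obtain ⟨-, h' | h'⟩ | ⟨h', -⟩ := eg _ h
        · exact .inr (.inr (.inl ⟨by rw [← h', M.tail_face, M.inv_inv], by rw [h', tail_e]⟩))
        · exact .inr (.inr (.inr ⟨by rw [← tail_d, ← h', M.tail_face, M.inv_inv], by rw [h']⟩))
        · exact absurd (by rwa [M.inv_inv]) h'
    · rintro (⟨rfl, rfl⟩ | ⟨rfl, rfl⟩ | ⟨rfl, rfl⟩ | ⟨rfl, rfl⟩)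
      · exact ⟨_, ti d, by rw [M.inv_inv], d0, by rw [M.inv_inv]; exact hF hd⟩
      · exact ⟨_, ti _, by rw [M.inv_inv], d1, by rw [M.inv_inv]; exact hF (sf hd)⟩
      · exact ⟨_, ti _, by rw [M.inv_inv, tail_e], e0, by rw [M.inv_inv]; exact hG he⟩
      · exact ⟨_, (ti _).trans tail_d, by rw [M.inv_inv], e1, by rw [M.inv_inv]; exact hG (sg he)⟩
  have bd' : ∀ u w, M.Bdry Q u w ↔
      (u = M.tail (M.face (M.face (M.face d))) ∧ w = M.tail (M.face (M.face d))) ∨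
      (u = M.tail d ∧ w = M.tail (M.face (M.face (M.face d)))) ∨
      (u = M.tail (M.face (M.face (M.face e))) ∧ w = M.tail d) ∨
      (u = M.tail (M.face (M.face d)) ∧ w = M.tail (M.face (M.face (M.face e)))) := by
    intro u w
    constructor
    · rintro ⟨s, rfl, rfl, h1, h2⟩
      rcases hBQ s ⟨h1, h2⟩ with h | h
      · obtain ⟨h', -⟩ | ⟨-, h' | h'⟩ := df _ h
        · exact absurd h1 (hPQ _ (by rwa [M.inv_inv] at h'))
        · exact .inl ⟨by rw [← h', M.tail_face, M.inv_inv], by rw [h']⟩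
        · exact .inr (.inl ⟨by rw [← d4, ← h', M.tail_face, M.inv_inv], by rw [h']⟩)
      · obtain ⟨h', -⟩ | ⟨-, h' | h'⟩ := eg _ h
        · exact absurd h1 (hPQ _ (by rwa [M.inv_inv] at h'))
        · exact .inr (.inr (.inl ⟨by rw [← h', M.tail_face, M.inv_inv], by rw [h', tail_d]⟩))
        · exact .inr (.inr (.inr ⟨by rw [← tail_e, ← e4, ← h', M.tail_face, M.inv_inv],
            by rw [h']⟩))
    · rintro (⟨rfl, rfl⟩ | ⟨rfl, rfl⟩ | ⟨rfl, rfl⟩ | ⟨rfl, rfl⟩)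
      · exact ⟨_, ti _, by rw [M.inv_inv], d2, by rw [M.inv_inv]; exact hF' (sf (sf hd))⟩
      · exact ⟨_, (ti _).trans (by rw [d4]), by rw [M.inv_inv], d3,
          by rw [M.inv_inv]; exact hF' (sf (sf (sf hd)))⟩
      · exact ⟨_, ti _, by rw [M.inv_inv, tail_d], e2, by rw [M.inv_inv]; exact hG' (sg (sg he))⟩
      · exact ⟨_, (ti _).trans (by rw [e4, tail_e]), by rw [M.inv_inv], e3,
          by rw [M.inv_inv]; exact hG' (sg (sg (sg he)))⟩
  have fa := M.corner_face d
  have fy := M.corner_face (M.face d)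
  have fb := M.corner_face (M.face (M.face d))
  have fx := M.corner_face (M.face (M.face (M.face d)))
  rw [d4] at fb fx
  have gc := M.corner_face e
  have gx := M.corner_face (M.face e)
  have gd := M.corner_face (M.face (M.face e))
  have gy := M.corner_face (M.face (M.face (M.face e)))
  rw [e4] at gd gy
  rw [tail_e] at gc gd gy
  rw [tail_d] at gc gx gd
  have xa := M.tail_face_ne d
  have ay := M.tail_face_ne (M.face d)
  have yb := M.tail_face_ne (M.face (M.face d))
  have bx := M.tail_face_ne (M.face (M.face (M.face d)))
  rw [d4] at bx
  have xy := tail_face_face_ne h3 d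
  have ab := tail_face_face_ne h3 (M.face d)
  have yc := M.tail_face_ne e
  have cx := M.tail_face_ne (M.face e)
  have xd := M.tail_face_ne (M.face (M.face e))
  have dy := M.tail_face_ne (M.face (M.face (M.face e)))
  rw [e4] at dy
  rw [tail_e] at yc dy
  rw [tail_d] at cx xd
  have cd := tail_face_face_ne h3 (M.face e)
  -- If these two vertices agreed, the sides of `f` and of `g` from `x` to this vertex would be the
  -- same dart, on two different faces.
  have had : M.tail (M.face d) ≠ M.tail (M.face (M.face (M.face e))) := fun h =>
    hfg (hd.trans (M.dart_ext d (M.face (M.face e)) tail_d.symm (by rw [ti, ti, h]) ▸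
      (sg (sg he)).symm))
  have hbc : M.tail (M.face (M.face (M.face d))) ≠ M.tail (M.face e) := fun h =>
    hfg ((sf (sf (sf hd))).trans (M.dart_ext (M.face (M.face (M.face d))) (M.face e) h
      (by rw [ti, ti, d4, tail_d]) ▸ (sg he).symm))
  have nQ : ∀ {u d}, (∀ w, ¬ M.Bdry Q u w ∧ ¬ M.Bdry Q w u) → M.tail d = u → ¬ Q d →
      ∀ s t, ¬ M.Corner Q u s t := fun hB hd hn => Ear.no_corner hQ hB hd hn
  have nP : ∀ {u d}, (∀ w, ¬ M.Bdry P u w ∧ ¬ M.Bdry P w u) → M.tail d = u → ¬ P d →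
      ∀ s t, ¬ M.Corner P u s t := fun hB hd hn => Ear.no_corner hP hB hd hn
  have not_a : ∀ s t, ¬ M.Corner Q (M.tail (M.face d)) s t :=
    nQ (fun w => by rw [bd', bd']; grind) rfl (hF' (sf hd))
  have not_c : ∀ s t, ¬ M.Corner Q (M.tail (M.face e)) s t :=
    nQ (fun w => by rw [bd', bd']; grind) rfl (hG' (sg he))
  have not_b : ∀ s t, ¬ M.Corner P (M.tail (M.face (M.face (M.face d)))) s t :=
    nP (fun w => by rw [bd, bd]; grind) rfl (hF (sf (sf (sf hd))))
  have not_d : ∀ s t, ¬ M.Corner P (M.tail (M.face (M.face (M.face e)))) s t :=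
    nP (fun w => by rw [bd, bd]; grind) rfl (hG (sg (sg (sg he))))
  refine TwoQuads.false (C := M.Corner fun _ => True) (R := M.Corner P) (R' := M.Corner Q)
    (B := M.Bdry P) (B' := M.Bdry Q) (N := N) ⟨region hP, region hQ, corners h3 _,
    triangleCorners h3 hLP hP, triangleCorners h3 hLQ hQ, fun u hu => fullFive (h5 u hu), bd, bd',
    ?_, not_a, not_c, not_b, not_d, fa, fy, fb, fx, gx, gd, gy, gc⟩
  intro s t s' t' n1 n2 c1 c2
  by_cases hNa : N = M.tail (M.face d)
  · subst hNa
    exact not_a _ _ c2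
  by_cases hNc : N = M.tail (M.face e)
  · subst hNc
    exact not_c _ _ c2
  obtain ⟨d', k1, -, -, k2⟩ := c2
  exact nP (fun w => by rw [bd, bd]; grind) ((M.tail_rot d').trans k1)
    (fun h => hPQ _ h k2) _ _ c1

end DartMap

/-! ### Two faces do not separate the others: counting edges between classes of faces -/

namespace DartMap

variable {V D : Type*} {M : DartMap V D}

section Classes

variable {ι : Type*} (M) (c : D → ι)

/-- The number of darts of class `i` whose reverse has class `j`. -/
noncomputable def classCount (i j : ι) : ℕ := {d | c d = i ∧ c (M.inv d) = j}.ncard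

theorem classCount_comm (i j : ι) : M.classCount c i j = M.classCount c j i := by
  have : {d | c d = j ∧ c (M.inv d) = i} = M.inv '' {d | c d = i ∧ c (M.inv d) = j} := by
    ext d
    constructor
    · exact fun h => ⟨M.inv d, ⟨h.2, by rw [M.inv_inv]; exact h.1⟩, M.inv_inv d⟩
    · rintro ⟨d, h, rfl⟩
      exact ⟨h.2, by rw [M.inv_inv]; exact h.1⟩
  rw [classCount, classCount, this, Set.ncard_image_of_injective _ M.inv.injective]

theorem ncard_eq_sum_classCount [Finite D] [DecidableEq ι] (A B : Finset ι) :
    {d | c d ∈ A ∧ c (M.inv d) ∈ B}.ncard = ∑ i ∈ A, ∑ j ∈ B, M.classCount c i j := by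
  classical
  have := Fintype.ofFinite D
  rw [Set.ncard_eq_toFinset_card', ← Finset.sum_product',
    Finset.card_eq_sum_card_fiberwise (f := fun d => (c d, c (M.inv d))) (t := A ×ˢ B)]
  · refine Finset.sum_congr rfl fun x hx => ?_
    rw [Finset.mem_product] at hx
    rw [classCount, Set.ncard_eq_toFinset_card']
    congr 1
    ext d
    simp only [Finset.mem_filter, Set.mem_toFinset, Set.mem_ofPred_eq, Prod.ext_iff]
    constructor
    · exact fun h => h.2
    · rintro ⟨h1, h2⟩
      exact ⟨⟨h1 ▸ hx.1, h2 ▸ hx.2⟩, h1, h2⟩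
  · intro d hd
    simpa using hd

end Classes

variable [Finite D]

/-- A face of length at least four is one of the exceptional faces, so this combines the ear on a
quadrangle with the ear on the pentagon. -/
theorem false_of_ear (h3 : ∀ v, 3 ≤ M.deg v) {N : V} (h5 : ∀ v, v ≠ N → M.deg v = 5)
    (hM : M.HasTwoQuads ∨ M.HasPentagon) {K : D → Prop} (hK : M.IsFaceSet K)
    (h : (M.bdrySet K).ncard = 3) {f : D} (hf : ¬ K f) (hf4 : 4 ≤ M.faceLen f)
    (h2 : {d | M.face.SameCycle f d ∧ K (M.inv d)}.ncard = 2) : False := by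
  have key : ∀ {q}, M.face.SameCycle q f → ∀ {d}, M.face.SameCycle q d ↔ M.face.SameCycle f d :=
    fun h => ⟨fun h' => h.symm.trans h', fun h' => h.trans h'⟩
  obtain ⟨q, r, hqr, hq, hr, hL⟩ | ⟨q, hq, hL⟩ := hM
  · have : M.face.SameCycle q f ∨ M.face.SameCycle r f := by
      by_contra hc
      push Not at hc
      have := hL f hc.1 hc.2
      omega
    obtain hqf | hqf := this
    · have hf := M.face_sameCycle_face hqf
      obtain ⟨d, e, hE⟩ := exists_ear h3 hK h ‹_› (by omega) h2
      simp only [key hqf] at hqr hL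
      exact hE.false_of_quad h3 h5 (by omega) hr hqr hL
    · have hf := M.face_sameCycle_face hqf
      obtain ⟨d, e, hE⟩ := exists_ear h3 hK h ‹_› (by omega) h2
      simp only [key hqf] at hL
      exact hE.false_of_quad h3 h5 (by omega) hq (fun h => hqr (hqf.trans h).symm)
        fun d h1 h2 => hL d h2 h1
  · have hqf : M.face.SameCycle q f := by
      by_contra hc
      have := hL f hc
      omega
    have hf := M.face_sameCycle_face hqf
    obtain ⟨d, e, hE⟩ := exists_ear h3 hK h ‹_› (by omega) h2
    simp only [key hqf] at hL
    exact hE.false_of_pentagon h3 h5 (by omega) hL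

theorem faceLen_le_five (hM : M.HasTwoQuads ∨ M.HasPentagon) (f : D) : M.faceLen f ≤ 5 := by
  obtain ⟨q, r, -, hq, hr, hL⟩ | ⟨q, hq, hL⟩ := hM
  · by_cases h1 : M.face.SameCycle q f
    · rw [M.face_sameCycle_face h1]; omega
    · by_cases h2 : M.face.SameCycle r f
      · rw [M.face_sameCycle_face h2]; omega
      · rw [hL f h1 h2]; omega
  · by_cases h1 : M.face.SameCycle q f
    · rw [M.face_sameCycle_face h1]; omega
    · rw [hL f h1]; omega

theorem faceLen_add_le (hM : M.HasTwoQuads ∨ M.HasPentagon) {f g : D}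
    (hfg : ¬ M.face.SameCycle f g) : M.faceLen f + M.faceLen g ≤ 8 := by
  obtain ⟨q, r, -, hq, hr, hL⟩ | ⟨q, hq, hL⟩ := hM
  · have : ∀ f, M.faceLen f ≤ 4 := fun f => by
      by_cases h1 : M.face.SameCycle q f
      · rw [M.face_sameCycle_face h1]; omega
      · by_cases h2 : M.face.SameCycle r f
        · rw [M.face_sameCycle_face h2]; omega
        · rw [hL f h1 h2]; omega
    exact (add_le_add (this f) (this g)).trans (by norm_num)
  · by_cases h1 : M.face.SameCycle q f
    · rw [M.face_sameCycle_face h1, hL g fun h => hfg (h1.symm.trans h)]; omega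
    · have := faceLen_le_five (M := M) (.inr ⟨q, hq, hL⟩) g
      rw [hL f h1]; omega

/-- Two different faces of length four must be the two exceptional ones, so all faces of `P` and `Q`
are triangles, and every boundary edge of `P` or `Q` lies on `f` or `g`. These are the conditions of
a lens. -/
theorem false_of_quads_cut (h3 : ∀ v, 3 ≤ M.deg v) {N : V} (h5 : ∀ v, v ≠ N → M.deg v = 5)
    (hM : M.HasTwoQuads ∨ M.HasPentagon) {P Q : D → Prop} (hP : M.IsFaceSet P)
    (hQ : M.IsFaceSet Q) (hPQ : ∀ d, P d → ¬ Q d) (hadj : ∀ d, P d → ¬ Q (M.inv d)) {f g : D}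
    (hf : M.faceLen f = 4) (hg : M.faceLen g = 4) (hfg : ¬ M.face.SameCycle f g)
    (hPf : ¬ P f) (hPg : ¬ P g) (hQf : ¬ Q f) (hQg : ¬ Q g)
    (h2f : {d | M.face.SameCycle f d ∧ P (M.inv d)}.ncard = 2)
    (h2g : {d | M.face.SameCycle g d ∧ P (M.inv d)}.ncard = 2)
    (hcut : ∀ d, P d ∨ Q d ∨ M.face.SameCycle f d ∨ M.face.SameCycle g d)
    (hFG : ∀ d, M.face.SameCycle f d → ¬ M.face.SameCycle g (M.inv d)) : False := by
  have hL : ∀ d, ¬ M.face.SameCycle f d → ¬ M.face.SameCycle g d → M.faceLen d = 3 := by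
    intro d hfd hgd
    obtain ⟨q, r, hqr, hq, hr, hL⟩ | ⟨q, hq, hL⟩ := hM
    · have key : ∀ {f : D}, M.faceLen f = 4 → M.face.SameCycle q f ∨ M.face.SameCycle r f := by
        intro f hf
        by_contra hc
        push Not at hc
        have := hL f hc.1 hc.2
        omega
      refine hL d (fun h => ?_) (fun h => ?_) <;> rcases key hf with h1 | h1 <;>
        rcases key hg with h2 | h2
      all_goals first
        | exact hfg (h1.symm.trans h2)
        | exact hfd (h1.symm.trans h)
        | exact hgd (h2.symm.trans h)
    · by_cases h : M.face.SameCycle q f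
      · have := M.face_sameCycle_face h
        omega
      · have := hL f h
        omega
  have hself : ∀ {f d}, M.face.SameCycle f d → ¬ M.face.SameCycle f (M.inv d) := fun h hc =>
    not_sameCycle_inv h3 (faceLen_le_five hM _) (h.symm.trans hc)
  refine false_of_lens h3 h5 hP hQ hPQ hfg hf hg hPf hPg hQf hQg h2f h2g ?_ ?_ ?_ ?_ ?_ ?_
  · intro d hd
    rcases hcut (M.inv d) with h | h | h | h
    · exact .inl h
    · exact .inr h
    · exact absurd h (hself hd)
    · exact absurd h (hFG d hd)
  · intro d hd
    rcases hcut (M.inv d) with h | h | h | h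
    · exact .inl h
    · exact .inr h
    · exact absurd (by rwa [M.inv_inv]) (hFG _ h)
    · exact absurd h (hself hd)
  · intro d hd
    rcases hcut (M.inv d) with h | h | h | h
    · exact absurd h hd.2
    · exact absurd h (hadj d hd.1)
    · exact .inl h
    · exact .inr h
  · intro d hd
    rcases hcut (M.inv d) with h | h | h | h
    · exact absurd (by rw [M.inv_inv]; exact hd.1) (hadj _ h)
    · exact absurd h hd.2
    · exact .inl h
    · exact .inr h
  · exact fun d hd => hL d (fun h => hPf ((hP.sameCycle h).2 hd)) fun h =>
      hPg ((hP.sameCycle h).2 hd)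
  · exact fun d hd => hL d (fun h => hQf ((hQ.sameCycle h).2 hd)) fun h =>
      hQg ((hQ.sameCycle h).2 hd)

/-- Two faces do not separate the other faces. -/
theorem false_of_cut (h3 : ∀ v, 3 ≤ M.deg v) {N : V} (h5 : ∀ v, v ≠ N → M.deg v = 5)
    (hM : M.HasTwoQuads ∨ M.HasPentagon) {P Q : D → Prop} (hP : M.IsFaceSet P)
    (hQ : M.IsFaceSet Q) (hPQ : ∀ d, P d → ¬ Q d) (hadj : ∀ d, P d → ¬ Q (M.inv d))
    {p q : D} (hp : P p) (hq : Q q) {f g : D}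
    (hPf : ¬ P f) (hPg : ¬ P g) (hQf : ¬ Q f) (hQg : ¬ Q g)
    (hcut : ∀ d, P d ∨ Q d ∨ M.face.SameCycle f d ∨ M.face.SameCycle g d) : False := by
  classical
  have hF : ∀ {d}, M.face.SameCycle f d → ¬ P d ∧ ¬ Q d := fun hd =>
    ⟨mt (hP.sameCycle hd).2 hPf, mt (hQ.sameCycle hd).2 hQf⟩
  have hself : ∀ {f d}, M.face.SameCycle f d → ¬ M.face.SameCycle f (M.inv d) := fun h hc =>
    not_sameCycle_inv h3 (faceLen_le_five hM _) (h.symm.trans hc)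
  -- The classes 0, 1, 2, 3 stand for `P`, `Q`, `f` and `g`.
  let c : D → Fin 4 := fun d =>
    if P d then 0 else if Q d then 1 else if M.face.SameCycle f d then 2 else 3
  have c0 : ∀ d, c d = 0 ↔ P d := fun d => by grind
  have c1 : ∀ d, c d = 1 ↔ Q d := fun d => by grind
  have c2 : ∀ d, c d = 2 ↔ M.face.SameCycle f d := fun d => by grind
  have c3 : ∀ d, c d = 3 → M.face.SameCycle g d := fun d => by grind
  have hc : ∀ S : Finset (Fin 4), M.IsFaceSet fun d => c d ∈ S := by
    intro S d
    have : c (M.face d) = c d := by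
      simp only [c]
      rw [propext (hP d), propext (hQ d), propext (isFaceSet_sameCycle f d)]
    simp only [this]
  have hb : ∀ S : Finset (Fin 4), (M.bdrySet fun d => c d ∈ S).ncard =
      ∑ i ∈ S, ∑ j ∈ Sᶜ, M.classCount c i j := by
    intro S
    rw [← ncard_eq_sum_classCount]
    simp [bdrySet]
  -- A union of classes that contains `P` and avoids `Q` is a nontrivial face set, so it has at
  -- least three boundary edges.
  have hb3 : ∀ S : Finset (Fin 4), 0 ∈ S → 1 ∉ S →
      3 ≤ ∑ i ∈ S, ∑ j ∈ Sᶜ, M.classCount c i j := by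
    intro S h0 h1
    rw [← hb]
    exact three_le_ncard_bdrySet (hc S) (d := p) (e := q) (by rwa [(c0 p).2 hp])
      (by rwa [(c1 q).2 hq])
  have z01 : M.classCount c 0 1 = 0 := by
    rw [classCount, Set.ncard_eq_zero]
    ext d
    simpa [c0, c1] using hadj d
  have z22 : M.classCount c 2 2 = 0 := by
    rw [classCount, Set.ncard_eq_zero]
    ext d
    simpa [c2] using hself
  have z33 : M.classCount c 3 3 = 0 := by
    rw [classCount, Set.ncard_eq_zero]
    ext d
    simp only [Set.mem_ofPred_eq, Set.mem_empty_iff_false, iff_false, not_and]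
    exact fun h1 h2 => hself (c3 _ h1) (c3 _ h2)
  have hsum : ∀ i, {d | c d = i}.ncard = ∑ j, M.classCount c i j := by
    intro i
    have := M.ncard_eq_sum_classCount c {i} Finset.univ
    simpa using this
  have hLf : M.faceLen f = ∑ j, M.classCount c 2 j := by
    rw [← hsum, faceLen, ← Equiv.Perm.ncard_sameCycle]
    simp only [c2]
  have hf5 := faceLen_le_five hM f
  have hg5 := faceLen_le_five hM g
  -- If `f` and `g` are the same face, class 3 is empty. This covers cuts by a single face.
  have hLg : (∑ j, M.classCount c 3 j = 0) ∨
      (¬ M.face.SameCycle f g ∧ M.faceLen g = ∑ j, M.classCount c 3 j) := by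
    by_cases hfg : M.face.SameCycle f g
    · left
      rw [← hsum, Set.ncard_eq_zero]
      ext d
      simp only [Set.mem_ofPred_eq, Set.mem_empty_iff_false, iff_false]
      intro h
      have := (c2 d).2 (hfg.trans (c3 d h))
      rw [h] at this
      exact absurd this (by decide)
    · right
      refine ⟨hfg, ?_⟩
      rw [← hsum, faceLen, ← Equiv.Perm.ncard_sameCycle]
      congr 1
      ext d
      refine ⟨fun h => ?_, c3 d⟩
      have h1 : ¬ P d := mt (hP.sameCycle h).2 hPg
      have h2 : ¬ Q d := mt (hQ.sameCycle h).2 hQg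
      have h4 : ¬ M.face.SameCycle f d := fun h' => hfg (h'.trans h.symm)
      simp [c, h1, h2, h4]
  have hc3 : ¬ M.face.SameCycle f g → ∀ d, c d = 3 ↔ M.face.SameCycle g d := by
    intro hfg d
    refine ⟨c3 d, fun h => ?_⟩
    have h1 : ¬ P d := mt (hP.sameCycle h).2 hPg
    have h2 : ¬ Q d := mt (hQ.sameCycle h).2 hQg
    have h4 : ¬ M.face.SameCycle f d := fun h' => hfg (h'.trans h.symm)
    simp [c, h1, h2, h4]
  have symm := M.classCount_comm c
  have i0 := hb3 {0} (by decide) (by decide)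
  have i03 := hb3 {0, 3} (by decide) (by decide)
  have i023 := hb3 {0, 2, 3} (by decide) (by decide)
  have i02 := hb3 {0, 2} (by decide) (by decide)
  have hcount : ∀ i, ∀ S : Finset (Fin 4), {d | c d = i ∧ c (M.inv d) ∈ S}.ncard =
      ∑ j ∈ S, M.classCount c i j := by
    intro i S
    have := M.ncard_eq_sum_classCount c {i} S
    simpa using this
  have ear : ∀ S : Finset (Fin 4), ∑ i ∈ S, ∑ j ∈ Sᶜ, M.classCount c i j = 3 → ∀ i, ∀ h,
      (∀ d, c d = i ↔ M.face.SameCycle h d) → 4 ≤ M.faceLen h → i ∉ S →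
      ∑ j ∈ S, M.classCount c i j = 2 → False := by
    intro S hS i h hi h4 hiS h2
    refine false_of_ear h3 h5 hM (hc S) ((hb S).trans hS) (f := h) ?_ h4 ?_
    · rwa [(hi h).2 (Equiv.Perm.SameCycle.refl _ _)]
    · rw [← hcount] at h2
      simpa only [hi] using h2
  have earF := fun S hS h4 hiS h2 => ear S hS 2 f c2 h4 hiS h2
  have s1 := symm 1 0
  have s02 := symm 0 2
  have s03 := symm 0 3
  have s12 := symm 1 2
  have s13 := symm 1 3
  have s32 := symm 3 2
  rw [show ({0} : Finset (Fin 4))ᶜ = {1, 2, 3} from rfl] at i0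
  rw [show ({0, 3} : Finset (Fin 4))ᶜ = {1, 2} from rfl] at i03
  rw [show ({0, 2} : Finset (Fin 4))ᶜ = {1, 3} from rfl] at i02
  rw [show ({0, 2, 3} : Finset (Fin 4))ᶜ = {1} from rfl] at i023
  simp [Fin.sum_univ_four] at hLf hLg
  simp only [Finset.mem_insert, Finset.mem_singleton, Finset.sum_insert, Finset.sum_singleton,
    Fin.reduceEq, or_self, not_false_eq_true] at i0 i03 i02 i023
  have hG : M.classCount c 3 0 + M.classCount c 3 1 + M.classCount c 2 3 ≤ 5 ∧
      M.faceLen f + (M.classCount c 3 0 + M.classCount c 3 1 + M.classCount c 2 3) ≤ 8 := by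
    obtain hLg | ⟨hfg, hLg⟩ := hLg
    · omega
    · have := faceLen_add_le hM hfg
      omega
  have hLg' : 4 ≤ M.classCount c 3 0 + M.classCount c 3 1 + M.classCount c 2 3 →
      ¬ M.face.SameCycle f g ∧
        M.faceLen g = M.classCount c 3 0 + M.classCount c 3 1 + M.classCount c 2 3 := by
    intro h
    obtain hLg | ⟨hfg, hLg⟩ := hLg
    · omega
    · exact ⟨hfg, by omega⟩
  have earG : ∀ S : Finset (Fin 4), ∑ i ∈ S, ∑ j ∈ Sᶜ, M.classCount c i j = 3 →
      4 ≤ M.classCount c 3 0 + M.classCount c 3 1 + M.classCount c 2 3 → 3 ∉ S →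
      ∑ j ∈ S, M.classCount c 3 j = 2 → False := by
    intro S hS h4 hiS h2
    obtain ⟨hfg, hLg⟩ := hLg' h4
    exact ear S hS 3 g (hc3 hfg) (by omega) hiS h2
  -- The first eight cases yield an ear on `f` or on `g`, the last one a lens.
  obtain ⟨h1, ⟨h2, h4⟩ | ⟨h2, h4⟩⟩ | ⟨h1, ⟨h2, h4⟩ | ⟨h2, h4⟩⟩ | ⟨h1, ⟨h2, h4⟩ | ⟨h2, h4⟩⟩ |
      ⟨h1, ⟨h2, h4⟩ | ⟨h2, h4⟩⟩ | ⟨k1, k2, k3, k4, k5, k6, k7⟩ :=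
    cut_arith (pF := M.classCount c 2 0) (qF := M.classCount c 2 1) (pG := M.classCount c 3 0)
      (qG := M.classCount c 3 1) (r := M.classCount c 2 3) (LF := M.faceLen f) (by omega) rfl hf5
      hG.1 hG.2 (by omega) (by omega) (by omega) (by omega)
  · refine earF {0} ?_ h4 (by decide) (by simpa using h2)
    rw [show ({0} : Finset (Fin 4))ᶜ = {1, 2, 3} from rfl]
    simp
    omega
  · refine earG {0} ?_ h4 (by decide) (by simpa using h2)
    rw [show ({0} : Finset (Fin 4))ᶜ = {1, 2, 3} from rfl]
    simp
    omega
  · refine earF {1} ?_ h4 (by decide) (by simpa using h2)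
    rw [show ({1} : Finset (Fin 4))ᶜ = {0, 2, 3} from rfl]
    simp
    omega
  · refine earG {1} ?_ h4 (by decide) (by simpa using h2)
    rw [show ({1} : Finset (Fin 4))ᶜ = {0, 2, 3} from rfl]
    simp
    omega
  · refine earF {0, 3} ?_ h4 (by decide) (by simpa using h2)
    rw [show ({0, 3} : Finset (Fin 4))ᶜ = {1, 2} from rfl]
    simp
    omega
  -- An ear must not contain the face on which it sits, so for `g` the complementary union is taken.
  · refine earG {1, 2} ?_ h4 (by decide) (by simp; omega)
    rw [show ({1, 2} : Finset (Fin 4))ᶜ = {0, 3} from rfl]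
    simp
    omega
  · refine earF {1, 3} ?_ h4 (by decide) (by simpa using h2)
    rw [show ({1, 3} : Finset (Fin 4))ᶜ = {0, 2} from rfl]
    simp
    omega
  · refine earG {0, 2} ?_ h4 (by decide) (by simp; omega)
    rw [show ({0, 2} : Finset (Fin 4))ᶜ = {1, 3} from rfl]
    simp
    omega
  · obtain ⟨hfg, hLg⟩ := hLg' k2.ge
    have m0 : ∀ d, c d ∈ ({0} : Finset (Fin 4)) ↔ P d := fun d => by
      rw [Finset.mem_singleton, c0]
    have h2f := hcount 2 {0}
    have h2g := hcount 3 {0}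
    simp only [c2, hc3 hfg, m0, Finset.sum_singleton] at h2f h2g
    refine false_of_quads_cut h3 h5 hM hP hQ hPQ hadj k1 (by omega) hfg hPf hPg hQf hQg
      (by omega) (by omega) hcut fun d hd hd' => ?_
    rw [classCount, Set.ncard_eq_zero] at k7
    have : d ∈ {d | c d = 2 ∧ c (M.inv d) = 3} := ⟨(c2 d).2 hd, (hc3 hfg _).2 hd'⟩
    rw [k7] at this
    exact this

end DartMap

/-! ### Counting darts, and the dual of a near-triangulation -/

namespace DartMap

variable {V D : Type*} {M : DartMap V D}

theorem card_eq_sum_deg [Finite D] [Fintype V] : Nat.card D = ∑ v, M.deg v := by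
  classical
  rw [Nat.card_congr (Equiv.sigmaFiberEquiv M.tail).symm, Nat.card_sigma]
  exact Finset.sum_congr rfl fun v _ => by rw [deg, ← Nat.card_coe_set_eq]; rfl

theorem card_eq_sum_faceLen [Finite D] [Fintype M.FaceSet] :
    Nat.card D = ∑ q : M.FaceSet, M.faceLen q.out :=
  M.face.card_eq_sum_cycles

theorem mk_eq_iff {d e : D} : (Quotient.mk (Equiv.Perm.SameCycle.setoid M.face) d : M.FaceSet) =
    Quotient.mk _ e ↔ M.face.SameCycle d e := Quotient.eq

theorem card_dart_of_faces [Finite D] (hM : M.HasTwoQuads ∨ M.HasPentagon) :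
    Nat.card D = 3 * Nat.card M.FaceSet + 2 := by
  classical
  have := Fintype.ofFinite M.FaceSet
  rw [card_eq_sum_faceLen (M := M), Nat.card_eq_fintype_card]
  have hmk : ∀ (d : D) (x : M.FaceSet), x = Quotient.mk _ d ↔ M.face.SameCycle d x.out := by
    intro d x
    conv_lhs => rw [← Quotient.out_eq x]
    exact mk_eq_iff.trans Equiv.Perm.sameCycle_comm
  obtain ⟨q, r, hqr, hq, hr, hL⟩ | ⟨q, hq, hL⟩ := hM
  · have : ∀ x : M.FaceSet, M.faceLen x.out =
        3 + (if x = Quotient.mk _ q then 1 else 0) + (if x = Quotient.mk _ r then 1 else 0) := by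
      intro x
      simp only [hmk]
      split_ifs with h1 h2 h2
      · exact absurd (h1.trans h2.symm) hqr
      · rw [M.face_sameCycle_face h1, hq]
      · rw [M.face_sameCycle_face h2, hr]
      · exact hL _ h1 h2
    simp only [this, Finset.sum_add_distrib, Finset.sum_const, Finset.card_univ,
      Finset.sum_ite_eq', Finset.mem_univ, if_true]
    simp [mul_comm]
  · have : ∀ x : M.FaceSet, M.faceLen x.out =
        3 + (if x = Quotient.mk _ q then 2 else 0) := by
      intro x
      simp only [hmk]
      split_ifs with h1
      · rw [M.face_sameCycle_face h1, hq]
      · exact hL _ h1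
    simp only [this, Finset.sum_add_distrib, Finset.sum_const, Finset.card_univ,
      Finset.sum_ite_eq', Finset.mem_univ, if_true]
    simp [mul_comm]

/-- The total excess of the face lengths over three is two; it is concentrated on one face or split
between two. -/
theorem faces_of_card [Finite D] (h3 : ∀ d, 3 ≤ M.faceLen d)
    (h : Nat.card D = 3 * Nat.card M.FaceSet + 2) : M.HasTwoQuads ∨ M.HasPentagon := by
  classical
  have := Fintype.ofFinite M.FaceSet
  rw [card_eq_sum_faceLen (M := M), Nat.card_eq_fintype_card] at h
  let g : M.FaceSet → ℕ := fun q => M.faceLen q.out - 3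
  have hg : ∀ q : M.FaceSet, M.faceLen q.out = g q + 3 := fun q => by
    have := h3 q.out
    simp only [g]
    omega
  simp only [hg, Finset.sum_add_distrib, Finset.sum_const, Finset.card_univ, smul_eq_mul] at h
  have hsum : ∑ q, g q = 2 := by omega
  have hmk : ∀ (d : D) (x : M.FaceSet), x = Quotient.mk _ d ↔ M.face.SameCycle x.out d := by
    intro d x
    conv_lhs => rw [← Quotient.out_eq x]
    exact mk_eq_iff
  have hlen : ∀ d, M.faceLen d = g (Quotient.mk _ d) + 3 := fun d => by
    rw [← hg]
    exact M.face_sameCycle_face ((hmk d _).1 rfl)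
  have hne : ∀ (q : M.FaceSet) (d : D), ¬ M.face.SameCycle q.out d →
      (Quotient.mk _ d : M.FaceSet) ≠ q := fun q d h h' => h ((hmk d q).1 h'.symm)
  obtain ⟨q, -, hq⟩ : ∃ q ∈ Finset.univ, g q ≠ 0 := Finset.exists_ne_zero_of_sum_ne_zero
    (by omega)
  have h1 := Finset.add_sum_erase Finset.univ g (Finset.mem_univ q)
  by_cases hq2 : g q = 2
  · right
    refine ⟨q.out, by rw [hg, hq2], fun d hd => ?_⟩
    have := Finset.sum_eq_zero_iff.1 (show ∑ x ∈ Finset.univ.erase q, g x = 0 by omega) _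
      (Finset.mem_erase.2 ⟨hne q d hd, Finset.mem_univ _⟩)
    rw [hlen, this]
  · left
    obtain ⟨r, hr', hr⟩ : ∃ r ∈ Finset.univ.erase q, g r ≠ 0 :=
      Finset.exists_ne_zero_of_sum_ne_zero (by omega)
    have h2 := Finset.add_sum_erase _ g hr'
    have h0 : ∑ x ∈ (Finset.univ.erase q).erase r, g x = 0 := by omega
    refine ⟨q.out, r.out, fun h => ?_, by rw [hg]; omega, by rw [hg]; omega, fun d hd hd' => ?_⟩
    · rw [← hmk, Quotient.out_eq] at h
      exact (Finset.mem_erase.1 hr').1 h.symm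
    · have := Finset.sum_eq_zero_iff.1 h0 _ (Finset.mem_erase.2 ⟨hne r d hd',
        Finset.mem_erase.2 ⟨hne q d hd, Finset.mem_univ _⟩⟩)
      rw [hlen, this]

/-- A plane map with `n + 11` vertices, one of degree `n` and the others of degree five, that is
a triangulation with two missing edges. -/
structure IsNear (M : DartMap V D) (n : ℕ) (N : V) : Prop where
  card : Nat.card V = n + 11
  deg_eq : M.deg N = n
  deg_five : ∀ v, v ≠ N → M.deg v = 5
  faces : M.HasTwoQuads ∨ M.HasPentagon

theorem IsNear.three_le_deg {n : ℕ} {N : V} (hN : M.IsNear n N) (hn : 3 ≤ n) (v : V) :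
    3 ≤ M.deg v := by
  by_cases h : v = N
  · rw [h, hN.deg_eq]; exact hn
  · rw [hN.deg_five v h]; norm_num

section Dual

variable [Finite D]

/-- On a simple face the reverses of `d` and `face d` would also be consecutive, and their common
vertex would have degree two. -/
theorem not_sameCycle_consecutive (h3 : ∀ v, 3 ≤ M.deg v) {d : D} (h5 : M.faceLen (M.inv d) ≤ 5)
    (h : M.face.SameCycle (M.inv d) (M.inv (M.face d))) : False := by
  have h1 : M.face (M.inv (M.face d)) = M.inv d := by
    refine (face_simple h3 h5 (Equiv.Perm.sameCycle_apply_right.2 h) ?_).symm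
    rw [M.face_inv, M.tail_rot, M.tail_face]
  rw [M.face_inv] at h1
  refine rot_rot_ne h3 (M.face d) ?_
  rw [h1, ← M.face_apply]

/-- This makes the dual a simple graph. Two common edges cannot be consecutive, so both faces have
length at least four. As the lengths add up to at most eight, both are quadrangles and the common
edges are opposite. Simplicity then makes the two faces share a third side as well, next to the
first. -/
theorem two_faces_meet_once (h3 : ∀ v, 3 ≤ M.deg v) (hM : M.HasTwoQuads ∨ M.HasPentagon)
    {d e : D} (h : M.face.SameCycle d e) (h' : M.face.SameCycle (M.inv d) (M.inv e)) : d = e := by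
  by_contra hne
  have h5 := faceLen_le_five hM
  have hcons : ∀ {d e : D}, M.face.SameCycle (M.inv d) (M.inv e) → M.face d ≠ e := by
    rintro d _ h rfl
    exact not_sameCycle_consecutive h3 (h5 _) h
  have hs : ¬ M.face.SameCycle d (M.inv d) := not_sameCycle_inv h3 (h5 d)
  have hsum := faceLen_add_le hM hs
  have key : ∀ {d e : D}, d ≠ e → M.face.SameCycle d e → M.face.SameCycle (M.inv d) (M.inv e) →
      ∃ i, M.face^[i] d = e ∧ 2 ≤ i ∧ i + 2 ≤ M.faceLen d := by
    intro d e hne h h'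
    obtain ⟨i, hi, rfl⟩ := M.face.sameCycle_iff_exists_iterate.1 h
    refine ⟨i, rfl, ?_, ?_⟩
    · by_contra hlt
      have : i = 0 ∨ i = 1 := by omega
      rcases this with rfl | rfl
      · exact hne rfl
      · exact hcons h' rfl
    · by_contra hlt
      have : i + 1 = M.faceLen d := by
        rw [faceLen] at hlt ⊢
        omega
      refine hcons h'.symm ?_
      rw [← iterate_succ_apply' (M.face), Nat.succ_eq_add_one, this, M.iterate_faceLen]
  -- From `2 ≤ i` and `i + 2 ≤ faceLen` on both sides, and the bound eight on the total length, all
  -- these inequalities are equalities.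
  obtain ⟨i, h1, h2, h4⟩ := key hne h h'
  obtain ⟨j, k1, k2, k4⟩ := key (M.inv.injective.ne hne) h' (by rwa [M.inv_inv, M.inv_inv])
  obtain rfl : i = 2 := by omega
  obtain rfl : j = 2 := by omega
  have hL : M.faceLen (M.inv d) = 4 := by omega
  have hf : M.face (M.inv e) = M.inv (M.face d) := by
    refine M.dart_ext _ _ ?_ ?_
    · rw [M.face_inv, M.tail_rot, ← M.tail_face, ← h1]
      rfl
    · rw [M.inv_inv, ← M.tail_face, M.tail_face d, ← k1]
      exact congrArg M.tail (face_four hL (Equiv.Perm.SameCycle.refl _ _))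
  refine not_sameCycle_consecutive h3 (h5 (M.inv d)) ?_
  rw [← hf]
  exact Equiv.Perm.sameCycle_apply_right.2 h'

/-- The dual map. -/
def dual (M : DartMap V D) (h3 : ∀ v, 3 ≤ M.deg v) (hM : M.HasTwoQuads ∨ M.HasPentagon) :
    DartMap M.FaceSet D where
  rot := M.face
  inv := M.inv
  tail := Quotient.mk _
  inv_inv := M.inv_inv
  tail_rot d := mk_eq_iff.2 (M.face.sameCycle_apply_self d).symm
  sameCycle d e h := mk_eq_iff.1 h
  tail_inv_ne d h := not_sameCycle_inv h3 (faceLen_le_five hM d) (mk_eq_iff.1 h).symm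
  dart_ext d e h h' := two_faces_meet_once h3 hM (mk_eq_iff.1 h) (mk_eq_iff.1 h')
  surj := Quotient.mk_surjective
  conn K h1 h2 := M.conn K (fun d hd => by rw [← M.face_inv]; exact h1 _ (h2 _ hd)) h2

variable (h3 : ∀ v, 3 ≤ M.deg v) (hM : M.HasTwoQuads ∨ M.HasPentagon)

theorem dual_face : (M.dual h3 hM).face = M.rot := by
  ext d
  exact M.face_inv d

theorem dual_faceLen (d : D) : (M.dual h3 hM).faceLen d = M.deg (M.tail d) := by
  rw [faceLen, dual_face, minimalPeriod_rot]

theorem card_faceSet_dual : Nat.card (M.dual h3 hM).FaceSet = Nat.card V := by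
  refine Nat.card_congr (Equiv.ofBijective (Quotient.lift M.tail fun d e h => ?_) ⟨?_, ?_⟩)
  · change (M.dual h3 hM).face.SameCycle d e at h
    rw [dual_face] at h
    exact M.tail_eq_iff.2 h
  · rintro ⟨d⟩ ⟨e⟩ h
    refine Quotient.sound ?_
    change (M.dual h3 hM).face.SameCycle d e
    rw [dual_face]
    exact M.tail_eq_iff.1 h
  · intro v
    obtain ⟨d, rfl⟩ := M.surj v
    exact ⟨Quotient.mk _ d, rfl⟩

end Dual

variable [Finite D] {n : ℕ} {N : V}

/-- The degree sum is `n + 5 * (n + 10)`. -/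
theorem card_dart_of_deg [Finite V] (hc : Nat.card V = n + 11) (hN : M.deg N = n)
    (h5 : ∀ v, v ≠ N → M.deg v = 5) : Nat.card D = 6 * n + 50 := by
  classical
  have := Fintype.ofFinite V
  have : ∀ v, M.deg v + (if v = N then 5 else 0) = (if v = N then n else 0) + 5 := by
    intro v
    split_ifs with h
    · rw [h, hN]
    · rw [h5 v h]
  have h := Finset.sum_congr rfl fun v (_ : v ∈ Finset.univ) => this v
  rw [Finset.sum_add_distrib, Finset.sum_add_distrib, ← card_eq_sum_deg] at h
  rw [Nat.card_eq_fintype_card] at hc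
  simp [hc] at h
  omega

theorem IsNear.card_dart (hN : M.IsNear n N) [Finite V] : Nat.card D = 6 * n + 50 :=
  card_dart_of_deg hN.card hN.deg_eq hN.deg_five

/-- The removal of at most two dual vertices is the removal of at most two faces, so this is
`false_of_cut` for the faces reachable from `x` and the remaining ones. -/
theorem dual_isVertexConnected (h3 : ∀ v, 3 ≤ M.deg v) (hM : M.HasTwoQuads ∨ M.HasPentagon)
    (h5 : ∀ v, v ≠ N → M.deg v = 5) (hc : 3 < Nat.card M.FaceSet) :
    (M.dual h3 hM).graph.IsVertexConnected 3 := by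
  classical
  refine ⟨hc, fun S hS => ?_⟩
  have hne : Nonempty {v | v ∉ S} := by
    by_contra h
    have := Fintype.ofFinite M.FaceSet
    have : S = Finset.univ := by
      ext v
      simp only [Finset.mem_univ, iff_true]
      by_contra hv
      exact h ⟨⟨v, hv⟩⟩
    rw [this, Finset.card_univ, ← Nat.card_eq_fintype_card] at hS
    omega
  refine (SimpleGraph.connected_iff _).2 ⟨fun x y => ?_, hne⟩
  by_contra hxy
  let P : D → Prop := fun d => ∃ h : (Quotient.mk _ d : M.FaceSet) ∉ S,
    ((M.dual h3 hM).graph.induce {v | v ∉ S}).Reachable x ⟨Quotient.mk _ d, h⟩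
  let Q : D → Prop := fun d => (Quotient.mk _ d : M.FaceSet) ∉ S ∧ ¬ P d
  have hmk : ∀ d, (Quotient.mk _ (M.face d) : M.FaceSet) = Quotient.mk _ d := fun d =>
    mk_eq_iff.2 (M.face.sameCycle_apply_self d).symm
  have hP : M.IsFaceSet P := fun d => by simp only [P, hmk]
  have hQ : M.IsFaceSet Q := fun d => by simp only [Q, hmk, propext (hP d)]
  have hstep : ∀ d, P d → (Quotient.mk _ (M.inv d) : M.FaceSet) ∉ S → P (M.inv d) := by
    rintro d ⟨hd, hr⟩ hd'
    refine ⟨hd', hr.trans (SimpleGraph.Adj.reachable ?_)⟩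
    exact ⟨d, rfl, rfl⟩
  obtain ⟨p, hp⟩ := Quotient.exists_rep x.1
  obtain ⟨q, hq⟩ := Quotient.exists_rep y.1
  have hPp : P p := by
    have h : (Quotient.mk _ p : M.FaceSet) ∉ S := by rw [hp]; exact x.2
    refine ⟨h, ?_⟩
    have : (⟨Quotient.mk _ p, h⟩ : {v | v ∉ S}) = x := Subtype.ext hp
    rw [this]
  have hQq : Q q := by
    have h : (Quotient.mk _ q : M.FaceSet) ∉ S := by rw [hq]; exact y.2
    refine ⟨h, fun ⟨_, hr⟩ => hxy ?_⟩
    have : (⟨Quotient.mk _ q, h⟩ : {v | v ∉ S}) = y := Subtype.ext hq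
    rwa [this] at hr
  have cut : ∀ f g, S = {Quotient.mk _ f, Quotient.mk _ g} → False := by
    intro f g hfg
    have hf : (Quotient.mk _ f : M.FaceSet) ∈ S := by rw [hfg]; simp
    have hg : (Quotient.mk _ g : M.FaceSet) ∈ S := by rw [hfg]; simp
    refine false_of_cut h3 h5 hM hP hQ (fun d h1 h2 => h2.2 h1)
      (fun d h1 h2 => h2.2 (hstep d h1 h2.1)) hPp hQq (f := f) (g := g) (fun h => h.1 hf)
      (fun h => h.1 hg) (fun h => h.1 hf) (fun h => h.1 hg) fun d => ?_
    by_cases hPd : P d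
    · exact .inl hPd
    by_cases hS : (Quotient.mk _ d : M.FaceSet) ∈ S
    · rw [hfg, Finset.mem_insert, Finset.mem_singleton] at hS
      obtain h | h := hS
      · exact .inr (.inr (.inl (mk_eq_iff.1 h.symm)))
      · exact .inr (.inr (.inr (mk_eq_iff.1 h.symm)))
    · exact .inr (.inl ⟨hS, hPd⟩)
  obtain h0 | h0 | h0 : S.card = 0 ∨ S.card = 1 ∨ S.card = 2 := by omega
  · rw [Finset.card_eq_zero] at h0
    have hinv : ∀ d, P d → P (M.inv d) := fun d hd => hstep d hd (by rw [h0]; simp)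
    exact hQq.2 (M.conn P (fun d hd => (hP.rot d).2 (hinv d hd)) hinv p q hPp)
  -- A single removed face is treated as a cut with `f = g`.
  · obtain ⟨a, ha⟩ := Finset.card_eq_one.1 h0
    obtain ⟨f, rfl⟩ := Quotient.exists_rep a
    exact cut f f (by rw [ha]; simp)
  · obtain ⟨a, b, -, hab⟩ := Finset.card_eq_two.1 h0
    obtain ⟨f, rfl⟩ := Quotient.exists_rep a
    obtain ⟨g, rfl⟩ := Quotient.exists_rep b
    exact cut f g hab

theorem IsNear.exists_pentagulation {V D : Type} [Finite V] [Finite D] {M : DartMap V D} {N : V}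
    (hn : 3 ≤ n) (hN : M.IsNear n N) : ∃ (V : Type) (_ : Finite V) (G : PlaneGraph V),
      G.graph.IsVertexConnected 3 ∧ G.IsPentagulation n (n + 10) := by
  classical
  have h3 := hN.three_le_deg hn
  have hM := hN.faces
  have hD := hN.card_dart
  have hF := card_dart_of_faces hM
  have hV := card_faceSet_dual h3 hM
  have hcV := hN.card
  have hne : Nonempty M.FaceSet := (Nat.card_pos_iff.1 (by omega)).1
  obtain ⟨d₀, hd₀⟩ := M.surj N
  have hsc : ∀ {d e}, (M.dual h3 hM).face.SameCycle d e ↔ M.tail d = M.tail e := by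
    intro d e
    rw [dual_face, M.tail_eq_iff]
  refine ⟨M.FaceSet, inferInstance, (M.dual h3 hM).toPlaneGraph (by omega),
    dual_isVertexConnected h3 hM hN.deg_five (by omega),
    (M.dual h3 hM).toRotationSystem.faceOf ((M.dual h3 hM).dartEquiv d₀), ?_, ?_, ?_, ?_⟩
  · exact ((M.dual h3 hM).toRotationSystem_faceLength d₀).trans
      (by rw [dual_faceLen, hd₀, hN.deg_eq])
  · change Set.InjOn _ ((M.dual h3 hM).toRotationSystem.boundary _)
    rw [toRotationSystem_boundary]
    -- In the original map, this says that no face passes twice through `N`.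
    rintro _ ⟨d, hd, rfl⟩ _ ⟨e, he, rfl⟩ hde
    congr 1
    refine face_simple h3 (faceLen_le_five hM d) (mk_eq_iff.1 hde) ?_
    rw [← hsc.1 hd, ← hsc.1 he]
  · intro f hf
    obtain ⟨d, rfl⟩ := (M.dual h3 hM).exists_faceOf f
    refine ((M.dual h3 hM).toRotationSystem_faceLength d).trans ?_
    rw [dual_faceLen]
    refine hN.deg_five _ fun h => hf ?_
    exact (M.dual h3 hM).toRotationSystem_faceOf_eq_iff.2 (hsc.2 (h.trans hd₀.symm))
  · have h1 : Nat.card (M.dual h3 hM).toRotationSystem.Face = n + 11 := by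
      rw [← Nat.card_congr (M.dual h3 hM).faceEquiv, hV, hcV]
    have hfin : Finite (M.dual h3 hM).toRotationSystem.Face := Nat.finite_of_card_ne_zero (by omega)
    have := Fintype.ofFinite (M.dual h3 hM).toRotationSystem.Face
    rw [Nat.card_eq_fintype_card] at h1
    change Nat.card {f : (M.dual h3 hM).toRotationSystem.Face // f ≠ _} = _
    rw [Nat.card_eq_fintype_card, Fintype.card_subtype_compl, h1, Fintype.card_subtype_eq]
    rfl

end DartMap

/-! ### Mod-two homology of a plane graph -/

section Incidence

variable {V X : Type*} {G : SimpleGraph V} [Fintype G.Dart] [DecidableEq V]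
  [DecidableEq X]

/-- The incidence matrix, modulo two, of the edges of a graph with the classes of their darts. -/
def dartIncidence (p : G.Dart → X) : Matrix G.edgeSet X (ZMod 2) :=
  fun e x => ∑ d : G.Dart, if d.edge = e ∧ p d = x then 1 else 0

theorem dartIncidence_mulVec [Fintype X] (p : G.Dart → X) (h : X → ZMod 2) (d : G.Dart) :
    (dartIncidence p).mulVec h ⟨d.edge, d.edge_mem⟩ = h (p d) + h (p d.symm) := by
  classical
  have hne : d ≠ d.symm := d.symm_ne.symm
  have h1 : (dartIncidence p).mulVec h ⟨d.edge, d.edge_mem⟩ =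
      ∑ d' : G.Dart, if d'.edge = d.edge then h (p d') else 0 := by
    simp only [Matrix.mulVec, dotProduct, dartIncidence, Finset.sum_mul]
    rw [Finset.sum_comm]
    refine Finset.sum_congr rfl fun d' _ => ?_
    by_cases hd : d'.edge = d.edge <;> simp [hd]
  rw [h1, ← Finset.sum_filter]
  have h2 : Finset.univ.filter (fun d' : G.Dart => d'.edge = d.edge) = {d, d.symm} := by
    ext d'
    simp [SimpleGraph.dart_edge_eq_iff]
  rw [h2, Finset.sum_pair hne]

theorem dartIncidence_transpose_mulVec [Fintype G.edgeSet] (p : G.Dart → X)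
    (x : Sym2 V → ZMod 2) (f : X) :
    (dartIncidence p).transpose.mulVec (fun e => x e) f =
      ∑ d : G.Dart, if p d = f then x d.edge else 0 := by
  simp only [Matrix.mulVec, dotProduct, dartIncidence, Matrix.transpose_apply, Finset.sum_mul]
  rw [Finset.sum_comm]
  refine Finset.sum_congr rfl fun d _ => ?_
  rw [Finset.sum_eq_single ⟨d.edge, d.edge_mem⟩]
  · by_cases hd : p d = f <;> simp [hd]
  · intro e _ he
    have : d.edge ≠ e := fun h => he (Subtype.ext h.symm)
    simp [this]
  · simp

/-- The kernel consists of the functions that agree on the two classes of every edge. By the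
connectedness assumption `hp` these are the constants, a space of dimension one. -/
theorem rank_dartIncidence [Fintype G.edgeSet] [Fintype X] [Nonempty X] (p : G.Dart → X)
    (hp : ∀ h : X → ZMod 2, (∀ d, h (p d) = h (p d.symm)) → ∀ x y, h x = h y) :
    (dartIncidence p).rank + 1 = Fintype.card X := by
  have h1 := (dartIncidence p).mulVecLin.finrank_range_add_finrank_ker
  rw [Module.finrank_fintype_fun_eq_card] at h1
  rw [Matrix.rank, ← h1]
  congr 1
  have : LinearMap.ker (dartIncidence p).mulVecLin = Submodule.span (ZMod 2) {fun _ => 1} := by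
    ext h
    rw [LinearMap.mem_ker, Matrix.mulVecLin_apply, Submodule.mem_span_singleton]
    constructor
    · intro hh
      obtain ⟨x⟩ := ‹Nonempty X›
      refine ⟨h x, funext fun y => ?_⟩
      have := hp h (fun d => ?_) x y
      · simpa using this
      · have := congrFun hh ⟨d.edge, d.edge_mem⟩
        rw [dartIncidence_mulVec] at this
        exact CharTwo.add_eq_zero.1 this
    · rintro ⟨a, rfl⟩
      ext ⟨e, he⟩
      induction e using Sym2.ind with
      | _ u v =>
        have := dartIncidence_mulVec p (a • fun _ => 1) ⟨(u, v), he⟩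
        exact this.trans (CharTwo.add_self_eq_zero _)
  rw [this, finrank_span_singleton]
  obtain ⟨x⟩ := ‹Nonempty X›
  exact fun h => one_ne_zero (congrFun h x)

end Incidence

theorem RotationSystem.fst_facePerm {V : Type*} (R : RotationSystem V) (d : R.graph.Dart) :
    (R.facePerm d).fst = d.snd := R.rot_fst d.symm

theorem RotationSystem.faceOf_facePerm {V : Type*} (R : RotationSystem V) (d : R.graph.Dart) :
    R.faceOf (R.facePerm d) = R.faceOf d :=
  R.faceOf_eq_iff.2 (R.facePerm.sameCycle_apply_self d).symm

/-- A set of edges of a plane graph that has an even number of edges on each face is a cut. -/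
theorem PlaneGraph.exists_potential {V : Type*} [Finite V] (G : PlaneGraph V)
    [Fintype G.graph.Dart] [DecidableEq G.Face] (x : Sym2 V → ZMod 2)
    (hx : ∀ f : G.Face, ∑ d : G.graph.Dart, (if G.faceOf d = f then x d.edge else 0) = 0) :
    ∃ h : V → ZMod 2, ∀ d : G.graph.Dart, x d.edge = h d.fst + h d.snd := by
  classical
  have := Fintype.ofFinite V
  have : Fintype G.graph.edgeSet := Fintype.ofFinite _
  have : Finite G.Face := Quotient.finite _
  have := Fintype.ofFinite G.Face
  have hV : Nonempty V := G.connected.nonempty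
  let A := dartIncidence G.faceOf
  let B := dartIncidence fun d : G.graph.Dart => d.fst
  -- Without darts there are no faces and only one vertex, against Euler's formula.
  have hD : Nonempty G.graph.Dart := by
    by_contra hD
    rw [not_nonempty_iff] at hD
    have h1 := G.euler
    have h2 : Nat.card G.Face = 0 := by
      have : IsEmpty G.Face := ⟨fun f => by
        obtain ⟨d, -⟩ := Quotient.exists_rep f
        exact hD.false d⟩
      exact Nat.card_of_isEmpty
    have h3 := DartMap.two_mul_card_edgeSet G.graph
    rw [Nat.card_of_isEmpty (α := G.graph.Dart)] at h3
    have h4 : Subsingleton V := by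
      by_contra h4
      rw [not_subsingleton_iff_nontrivial] at h4
      obtain ⟨v⟩ := hV
      obtain ⟨w, hw⟩ := G.connected.preconnected.exists_adj_of_nontrivial v
      exact hD.false ⟨(v, w), hw⟩
    have h5 : Nat.card V ≤ 1 := Finite.card_le_one_iff_subsingleton.2 h4
    omega
  have hF : Nonempty G.Face := hD.map G.faceOf
  have rA : A.rank + 1 = Fintype.card G.Face := by
    refine rank_dartIncidence _ fun h hh => ?_
    rintro ⟨d⟩ ⟨e⟩
    refine G.dart_conn G.connected (fun e => h (G.faceOf d) = h (G.faceOf e)) ?_ ?_ d e rfl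
    · intro e he
      have := G.faceOf_facePerm e.symm
      change G.faceOf (G.rot e.symm.symm) = _ at this
      rw [e.symm_symm] at this
      rw [he, this, hh]
    · exact fun e he => he.trans (hh e)
  have rB : B.rank + 1 = Fintype.card V := by
    refine rank_dartIncidence _ fun h hh v w => ?_
    obtain ⟨p⟩ := G.connected.preconnected v w
    induction p with
    | nil => rfl
    | cons hadj p ih => exact (hh ⟨(_, _), hadj⟩).trans ih
  -- A cut meets every face evenly: along the boundary walk of a face, each value of the potential
  -- `h` occurs once as start and once as end, which `facePerm` matches up.
  have hle : LinearMap.range B.mulVecLin ≤ LinearMap.ker A.transpose.mulVecLin := by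
    rintro _ ⟨h, rfl⟩
    rw [LinearMap.mem_ker]
    ext f
    have hB : B.mulVecLin h = fun e : G.graph.edgeSet => (Sym2.lift ⟨fun u v => h u + h v,
        fun _ _ => add_comm _ _⟩ (e : Sym2 V) : ZMod 2) := by
      ext ⟨e, he⟩
      induction e using Sym2.ind with
      | _ u v => exact dartIncidence_mulVec (fun d : G.graph.Dart => d.fst) h ⟨(u, v), he⟩
    rw [hB, Matrix.mulVecLin_apply]
    refine (dartIncidence_transpose_mulVec _ _ _).trans ?_
    have : ∀ d : G.graph.Dart, (if G.faceOf d = f then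
        (Sym2.lift ⟨fun u v => h u + h v, fun _ _ => add_comm _ _⟩ d.edge : ZMod 2) else 0) =
        (if G.faceOf d = f then h d.fst else 0) +
          (if G.faceOf (G.facePerm d) = f then h (G.facePerm d).fst else 0) := by
      intro d
      rw [G.faceOf_facePerm, G.fst_facePerm]
      split_ifs
      · rfl
      · simp
    rw [Finset.sum_congr rfl fun d _ => this d, Finset.sum_add_distrib,
      Equiv.sum_comp G.facePerm fun d => if G.faceOf d = f then h d.fst else 0]
    exact CharTwo.add_self_eq_zero _
  -- The dimensions are `V - 1` and `E - (F - 1)`, equal by Euler's formula.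
  have hrank : Module.finrank (ZMod 2) (LinearMap.range B.mulVecLin) =
      Module.finrank (ZMod 2) (LinearMap.ker A.transpose.mulVecLin) := by
    have h1 := A.transpose.mulVecLin.finrank_range_add_finrank_ker
    rw [Module.finrank_fintype_fun_eq_card, ← Matrix.rank, Matrix.rank_transpose] at h1
    rw [← Matrix.rank]
    have := G.euler
    rw [Nat.card_eq_fintype_card, Nat.card_eq_fintype_card, Nat.card_eq_fintype_card] at this
    omega
  have heq := Submodule.eq_of_le_of_finrank_eq hle hrank
  have hmem : (fun e : G.graph.edgeSet => x e) ∈ LinearMap.ker A.transpose.mulVecLin := by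
    rw [LinearMap.mem_ker]
    ext f
    rw [Matrix.mulVecLin_apply, dartIncidence_transpose_mulVec, hx]
    rfl
  rw [← heq] at hmem
  obtain ⟨h, hh⟩ := hmem
  refine ⟨h, fun d => ?_⟩
  exact (congrFun hh ⟨d.edge, d.edge_mem⟩).symm.trans
    (dartIncidence_mulVec (fun d : G.graph.Dart => d.fst) h d)

/-! ### Consequences of 3-connectedness -/

namespace SimpleGraph.IsVertexConnected

variable {V : Type*} {G : SimpleGraph V}

/-- The graph without `v` and `w` is connected. The case `v = w` is allowed and removes only one
vertex. -/
theorem eq_of_ne (hG : G.IsVertexConnected 3) {X : Type*} (h : V → X) (v w : V)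
    (hh : ∀ a b, G.Adj a b → a ≠ v → a ≠ w → b ≠ v → b ≠ w → h a = h b) {a b : V} (hav : a ≠ v)
    (haw : a ≠ w) (hbv : b ≠ v) (hbw : b ≠ w) : h a = h b := by
  classical
  have hc := hG.2 {v, w} (Finset.card_le_two.trans_lt (by norm_num))
  obtain ⟨p⟩ := hc.preconnected ⟨a, by simp [hav, haw]⟩ ⟨b, by simp [hbv, hbw]⟩
  have key : ∀ x y : {u | u ∉ ({v, w} : Finset V)}, ∀ _ : (G.induce _).Walk x y,
      h x = h y := by
    intro x y p
    induction p with
    | nil => rfl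
    | @cons x z y hadj p ih =>
      rw [← ih]
      have hx := x.2
      have hz := z.2
      simp only [Finset.mem_insert, Finset.mem_singleton, not_or, Set.mem_ofPred_eq] at hx hz
      exact hh x z hadj hx.1 hx.2 hz.1 hz.2
  exact key _ _ p

/-- Removing two or fewer neighbours would isolate `v`, while more than three vertices guarantee
another one that survives. -/
theorem three_le_ncard_neighborSet [Finite V] (hG : G.IsVertexConnected 3) (v : V) :
    3 ≤ (G.neighborSet v).ncard := by
  classical
  by_contra hlt
  have := Fintype.ofFinite V
  let S : Finset V := (G.neighborSet v).toFinset
  have hS : S.card < 3 := by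
    rw [← Set.ncard_eq_toFinset_card']
    omega
  have hV := hG.1
  rw [Nat.card_eq_fintype_card] at hV
  have : ∃ u, u ∉ insert v S := by
    by_contra hc
    push Not at hc
    have : insert v S = Finset.univ := Finset.eq_univ_iff_forall.2 hc
    have h1 := Finset.card_insert_le v S
    rw [this, Finset.card_univ] at h1
    omega
  obtain ⟨u, hu⟩ := this
  rw [Finset.mem_insert, not_or] at hu
  have hvS : v ∉ S := by simp [S]
  obtain ⟨p⟩ := (hG.2 S hS).preconnected ⟨v, hvS⟩ ⟨u, hu.2⟩
  cases p with
  | nil => exact hu.1 rfl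
  | @cons _ z _ hadj p =>
    refine z.2 ?_
    have : G.Adj v z := hadj
    simpa [S] using this

end SimpleGraph.IsVertexConnected

/-! ### Faces around a vertex of a 3-connected plane graph -/

namespace PlaneGraph

variable {V : Type*} [Finite V] (G : PlaneGraph V)

theorem faceOf_symm (d : G.graph.Dart) : G.faceOf d.symm = G.faceOf (G.rot d) := by
  rw [← G.faceOf_facePerm d.symm]
  change G.faceOf (G.rot d.symm.symm) = _
  rw [d.symm_symm]

theorem fst_iterate_rot (d : G.graph.Dart) (i : ℕ) : (G.rot^[i] d).fst = d.fst := by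
  induction i with
  | zero => rfl
  | succ i ih => rw [iterate_succ_apply', G.rot_fst, ih]

theorem minimalPeriod_rot [Finite G.graph.Dart] (d : G.graph.Dart) :
    minimalPeriod G.rot d = (G.graph.neighborSet d.fst).ncard := by
  rw [← Equiv.Perm.ncard_sameCycle]
  have : G.graph.neighborSet d.fst = (fun e : G.graph.Dart => e.snd) '' {e | e.fst = d.fst} := by
    ext w
    constructor
    · exact fun h => ⟨⟨(d.fst, w), h⟩, rfl, rfl⟩
    · rintro ⟨e, he, rfl⟩
      exact (he : e.fst = d.fst) ▸ e.adj
  rw [this, Set.InjOn.ncard_image]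
  · congr 1
    ext e
    refine ⟨fun h => ?_, fun h => G.rot_sameCycle _ _ (Eq.symm h)⟩
    obtain ⟨i, -, rfl⟩ := G.rot.sameCycle_iff_exists_iterate.1 h
    exact G.fst_iterate_rot d i
  · intro e he f hf hef
    exact SimpleGraph.Dart.ext _ _ (Prod.ext (Eq.trans he (Eq.symm hf)) hef)

theorem snd_iterate_rot_ne {d : G.graph.Dart} {i j : ℕ} (hi : i < minimalPeriod G.rot d)
    (hj : j < minimalPeriod G.rot d) (hij : i ≠ j) : (G.rot^[i] d).snd ≠ (G.rot^[j] d).snd :=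
  fun h => hij ((iterate_eq_iterate_iff_of_lt_minimalPeriod hi hj).1
    (SimpleGraph.Dart.ext _ _ (Prod.ext ((G.fst_iterate_rot d i).trans
      (G.fst_iterate_rot d j).symm) h)))

variable {G}

section Parity

variable [Fintype G.graph.Dart] [DecidableEq G.Face]

/-- An edge set that meets all faces evenly is a cut. If all its edges contain `v` or `w`, its
potential is constant off these two vertices, so the edges from `v` to vertices other than `w` are
all in the set or all outside it. -/
theorem false_of_even (hG : G.graph.IsVertexConnected 3) (x : Sym2 V → ZMod 2)
    (hx : ∀ f : G.Face, ∑ d : G.graph.Dart, (if G.faceOf d = f then x d.edge else 0) = 0)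
    {v w : V} (hs : ∀ d : G.graph.Dart, d.fst ≠ v → d.fst ≠ w → d.snd ≠ v → d.snd ≠ w →
      x d.edge = 0) {d₁ d₂ : G.graph.Dart} (h₁ : d₁.fst = v) (h₂ : d₂.fst = v) (h₁' : d₁.snd ≠ w)
    (h₂' : d₂.snd ≠ w) (h : x d₁.edge ≠ x d₂.edge) : False := by
  obtain ⟨p, hp⟩ := G.exists_potential x hx
  have hc : p d₁.snd = p d₂.snd := by
    refine hG.eq_of_ne p v w (fun a b hab h1 h2 h3 h4 => ?_) (h₁ ▸ d₁.snd_ne_fst) h₁'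
      (h₂ ▸ d₂.snd_ne_fst) h₂'
    have := hs ⟨(a, b), hab⟩ h1 h2 h3 h4
    rw [hp] at this
    exact CharTwo.add_eq_zero.1 this
  exact h (by rw [hp, hp, h₁, h₂, hc])

/-- The number, modulo two, of darts over the edge of `c` on a face. -/
theorem sum_edge_on_face [DecidableEq V] (c : G.graph.Dart) (f : G.Face) :
    ∑ d : G.graph.Dart, (if G.faceOf d = f then (if c.edge = d.edge then 1 else 0 : ZMod 2) else 0) =
      (if G.faceOf c = f then 1 else 0) + if G.faceOf c.symm = f then 1 else 0 := by
  have h1 : ∀ d : G.graph.Dart,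
      (if G.faceOf d = f then (if c.edge = d.edge then 1 else 0 : ZMod 2) else 0) =
      if d.edge = c.edge then (if G.faceOf d = f then 1 else 0) else 0 := by
    intro d
    simp only [eq_comm (a := d.edge)]
    split_ifs <;> rfl
  rw [Finset.sum_congr rfl fun d _ => h1 d, ← Finset.sum_filter]
  have h2 : Finset.univ.filter (fun d' : G.graph.Dart => d'.edge = c.edge) = {c, c.symm} := by
    ext d'
    simp [SimpleGraph.dart_edge_eq_iff]
  rw [h2, Finset.sum_pair c.symm_ne.symm]

/-- The first `k` edges around the start of `d` lead from the face of `d` to the face of `rot^[k]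
d`. An edge set `y` with the same two odd faces closes this arc to a closed curve; it must not
separate an edge `i` in the arc from an edge `j` outside it. -/
theorem false_of_arc (hG : G.graph.IsVertexConnected 3) (d : G.graph.Dart) {k : ℕ}
    (y : Sym2 V → ZMod 2)
    (hy : ∀ f : G.Face, ∑ d : G.graph.Dart, (if G.faceOf d = f then y d.edge else 0) =
      (if G.faceOf d = f then 1 else 0) + if G.faceOf (G.rot^[k] d) = f then 1 else 0)
    {w : V} (hs : ∀ e : G.graph.Dart, e.fst ≠ w → e.snd ≠ w → y e.edge = 0)
    (hs' : ∀ e : G.graph.Dart, e.fst = d.fst → e.snd ≠ w → y e.edge = 0)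
    {i j : ℕ} (hi : i < k) (hj : k ≤ j) (hj' : j < minimalPeriod G.rot d)
    (hiw : (G.rot^[i] d).snd ≠ w) (hjw : (G.rot^[j] d).snd ≠ w) : False := by
  classical
  let x : Sym2 V → ZMod 2 := fun e =>
    (∑ i ∈ Finset.range k, if (G.rot^[i] d).edge = e then 1 else 0) + y e
  have hedge : ∀ i j, i < minimalPeriod G.rot d → j < minimalPeriod G.rot d →
      ((G.rot^[i] d).edge = (G.rot^[j] d).edge ↔ i = j) := by
    intro i j hi hj
    refine ⟨fun h => ?_, fun h => by rw [h]⟩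
    rw [SimpleGraph.dart_edge_eq_iff] at h
    obtain h | h := h
    · exact (iterate_eq_iterate_iff_of_lt_minimalPeriod hi hj).1 h
    · have h1 := G.fst_iterate_rot d i
      have h2 := G.fst_iterate_rot d j
      rw [h] at h1
      exact absurd (h1.trans h2.symm) (G.rot^[j] d).snd_ne_fst
  have hxi : ∀ j, j < minimalPeriod G.rot d → (G.rot^[j] d).snd ≠ w →
      x (G.rot^[j] d).edge = if j < k then 1 else 0 := by
    intro j hj hw
    simp only [x]
    rw [hs' _ (G.fst_iterate_rot d j) hw, add_zero]
    have : ∀ i ∈ Finset.range k, (if (G.rot^[i] d).edge = (G.rot^[j] d).edge then (1 : ZMod 2) else 0) =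
        if i = j then 1 else 0 := by
      intro i hi
      rw [Finset.mem_range] at hi
      rw [if_congr (hedge i j (by omega) hj) rfl rfl]
    rw [Finset.sum_congr rfl this]
    simp
  refine false_of_even hG x (v := d.fst) (w := w) (fun f => ?_) (fun e h1 h2 h3 h4 => ?_)
    (G.fst_iterate_rot d i) (G.fst_iterate_rot d j) hiw hjw ?_
  · simp only [x]
    have : ∀ e : G.graph.Dart, (if G.faceOf e = f then
        (∑ i ∈ Finset.range k, if (G.rot^[i] d).edge = e.edge then (1 : ZMod 2) else 0) + y e.edge
        else 0) = (∑ i ∈ Finset.range k, if G.faceOf e = f then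
          (if (G.rot^[i] d).edge = e.edge then (1 : ZMod 2) else 0) else 0) +
            if G.faceOf e = f then y e.edge else 0 := by
      intro e
      split_ifs <;> simp
    rw [Finset.sum_congr rfl fun e _ => this e, Finset.sum_add_distrib, hy, Finset.sum_comm]
    -- Edge `i` lies between the faces of `rot^[i] d` and `rot^[i + 1] d`, so the sum telescopes.
    have htel : ∀ k, (∑ i ∈ Finset.range k, ∑ e : G.graph.Dart, if G.faceOf e = f then
          (if (G.rot^[i] d).edge = e.edge then (1 : ZMod 2) else 0) else 0) =
        (if G.faceOf d = f then 1 else 0) + if G.faceOf (G.rot^[k] d) = f then 1 else 0 := by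
      intro k
      induction k with
      | zero => exact (CharTwo.add_self_eq_zero _).symm
      | succ k ih =>
        rw [Finset.sum_range_succ, ih, sum_edge_on_face, faceOf_symm, iterate_succ_apply']
        rw [add_assoc, ← add_assoc _ _ (ite _ _ _), CharTwo.add_self_eq_zero, zero_add]
    rw [htel]
    exact CharTwo.add_self_eq_zero _
  · simp only [x]
    rw [hs e h2 h4, add_zero]
    refine Finset.sum_eq_zero fun i _ => if_neg fun h => ?_
    rw [SimpleGraph.dart_edge_eq_iff] at h
    have := G.fst_iterate_rot d i
    obtain h | h := h
    · rw [h] at this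
      exact h1 this
    · rw [h] at this
      exact h3 this
  · rw [hxi i (by omega) hiw, hxi j hj' hjw, if_pos hi, if_neg (by omega)]
    exact one_ne_zero

end Parity

/-- A face that occurs twice around a vertex closes the arc by itself, so the vertex would be a cut
vertex. -/
theorem faceOf_iterate_rot_ne (hG : G.graph.IsVertexConnected 3) (d : G.graph.Dart) {k : ℕ}
    (hk : 0 < k) (hk' : k < minimalPeriod G.rot d) : G.faceOf d ≠ G.faceOf (G.rot^[k] d) := by
  classical
  have := DartMap.finite_dart G.graph
  have := Fintype.ofFinite G.graph.Dart
  intro h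
  -- No further edge is needed, and the choice `w = d.fst` removes only one vertex.
  refine false_of_arc hG d (fun _ => 0) (w := d.fst) (k := k) (fun f => ?_) (fun _ _ _ => rfl)
    (fun _ _ _ => rfl) hk le_rfl hk' d.snd_ne_fst ?_
  · rw [h, CharTwo.add_self_eq_zero]
    simp
  · rw [← G.fst_iterate_rot d k]
    exact (G.rot^[k] d).snd_ne_fst

/-- An edge `c` between the two faces closes the arc; the start of `d` and one end `w` of `c` would
then separate the graph. -/
theorem false_of_chord (hG : G.graph.IsVertexConnected 3) (d c : G.graph.Dart) {k : ℕ}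
    (h : G.faceOf c = G.faceOf d) (h' : G.faceOf c.symm = G.faceOf (G.rot^[k] d))
    {w : V} (hw : w = c.fst ∨ w = c.snd) (hwd : w ≠ d.fst)
    {i j : ℕ} (hi : i < k) (hj : k ≤ j) (hj' : j < minimalPeriod G.rot d)
    (hiw : (G.rot^[i] d).snd ≠ w) (hjw : (G.rot^[j] d).snd ≠ w) : False := by
  classical
  have := DartMap.finite_dart G.graph
  have := Fintype.ofFinite G.graph.Dart
  have hs : ∀ e : G.graph.Dart, e.fst ≠ w → e.snd ≠ w →
      (if c.edge = e.edge then 1 else 0 : ZMod 2) = 0 := by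
    intro e h1 h2
    refine if_neg fun h => ?_
    rw [SimpleGraph.dart_edge_eq_iff] at h
    obtain rfl | rfl := h
    · exact hw.elim (fun h => h1 h.symm) fun h => h2 h.symm
    · exact hw.elim (fun h => h2 h.symm) fun h => h1 h.symm
  refine false_of_arc hG d (fun e => if c.edge = e then 1 else 0) (w := w) (k := k) (fun f => ?_) hs
    (fun e h1 h2 => hs e (h1 ▸ hwd.symm) h2) hi hj hj' hiw hjw
  rw [sum_edge_on_face, h, h']

theorem three_le_minimalPeriod_rot (hG : G.graph.IsVertexConnected 3) (d : G.graph.Dart) :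
    3 ≤ minimalPeriod G.rot d := by
  have := DartMap.finite_dart G.graph
  rw [minimalPeriod_rot]
  exact hG.three_le_ncard_neighborSet _

/-- A second edge `c` between the two faces at `d` closes the arc consisting of `d` alone. As `c`
has an end `w` off `d`, and there are at least two further edges at the start of `d`, one of these
avoids `w`. -/
theorem faces_meet_once (hG : G.graph.IsVertexConnected 3) {d c : G.graph.Dart}
    (h : G.faceOf c = G.faceOf d) (h' : G.faceOf c.symm = G.faceOf d.symm) : c = d := by
  by_contra hne
  have h3 := three_le_minimalPeriod_rot hG d
  have hne' : c ≠ d.symm := by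
    rintro rfl
    refine faceOf_iterate_rot_ne hG d (k := 1) (by norm_num) (by omega) ?_
    rw [← h, faceOf_symm]
    rfl
  have : ∃ w, (w = c.fst ∨ w = c.snd) ∧ w ≠ d.fst ∧ w ≠ d.snd := by
    by_contra hc
    push Not at hc
    have h1 := hc c.fst (.inl rfl)
    have h2 := hc c.snd (.inr rfl)
    by_cases hcd : c.fst = d.fst
    · exact hne (SimpleGraph.Dart.ext _ _ (Prod.ext hcd (h2 fun h => c.snd_ne_fst (h.trans hcd.symm))))
    · refine hne' (SimpleGraph.Dart.ext _ _ (Prod.ext (h1 hcd) ?_))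
      by_contra h
      exact c.snd_ne_fst ((h2 h).trans (h1 hcd).symm)
  obtain ⟨w, hw, hwd, hwd'⟩ := this
  have key := fun j => false_of_chord hG d c (k := 1) h (h'.trans (G.faceOf_symm d)) hw hwd (i := 0)
    (j := j) (by norm_num)
  have h12 := G.snd_iterate_rot_ne (d := d) (i := 1) (j := 2) (by omega) (by omega) (by norm_num)
  by_cases h1 : (G.rot^[1] d).snd = w
  · exact key 2 (by norm_num) (by omega) hwd'.symm (h1 ▸ h12.symm)
  · exact key 1 (by norm_num) (by omega) hwd'.symm h1

/-- The two faces divide the edges at the vertex into arcs with at least two edges each, so each arc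
has an edge that avoids `w`. This is what makes the dual free of chords. -/
theorem not_adj_of_far (hG : G.graph.IsVertexConnected 3) {d c : G.graph.Dart} {k : ℕ} (hk : 2 ≤ k)
    (hk' : k + 2 ≤ minimalPeriod G.rot d) (h : G.faceOf c = G.faceOf d) :
    G.faceOf c.symm ≠ G.faceOf (G.rot^[k] d) := by
  intro h'
  have : ∃ w, (w = c.fst ∨ w = c.snd) ∧ w ≠ d.fst := by
    by_cases hc : c.fst = d.fst
    · exact ⟨c.snd, .inr rfl, hc ▸ c.snd_ne_fst⟩
    · exact ⟨c.fst, .inl rfl, hc⟩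
  obtain ⟨w, hw, hwd⟩ := this
  have h1 := G.snd_iterate_rot_ne (d := d) (i := 0) (j := 1) (by omega) (by omega) (by norm_num)
  have h2 := G.snd_iterate_rot_ne (d := d) (i := k) (j := k + 1) (by omega) (by omega) (by omega)
  have key : ∀ i j, i < k → k ≤ j → j < minimalPeriod G.rot d → (G.rot^[i] d).snd ≠ w →
      (G.rot^[j] d).snd ≠ w → False := fun i j => false_of_chord hG d c (k := k) h h' hw hwd
  by_cases e1 : (G.rot^[0] d).snd = w
  · by_cases e2 : (G.rot^[k] d).snd = w
    · exact key 1 (k + 1) (by omega) (by omega) (by omega) (e1 ▸ h1.symm) (e2 ▸ h2.symm)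
    · exact key 1 k (by omega) (by omega) (by omega) (e1 ▸ h1.symm) e2
  · by_cases e2 : (G.rot^[k] d).snd = w
    · exact key 0 (k + 1) (by omega) (by omega) (by omega) e1 (e2 ▸ h2.symm)
    · exact key 0 k (by omega) (by omega) (by omega) e1 e2

end PlaneGraph

/-- Nonconsecutive vertices of a face are not adjacent. -/
def DartMap.ChordFree {V D : Type*} (M : DartMap V D) : Prop :=
  ∀ d k, 2 ≤ k → k + 2 ≤ M.faceLen d → ¬ M.graph.Adj (M.tail d) (M.tail (M.face^[k] d))

/-! ### The dual of a 3-connected pentagulation -/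

namespace PlaneGraph

variable {V : Type*} [Finite V] {G : PlaneGraph V}

/-- The dual of a three-connected plane graph. -/
def dualDartMap (hG : G.graph.IsVertexConnected 3) : DartMap G.Face G.graph.Dart where
  rot := G.facePerm
  inv := (SimpleGraph.Dart.symm_involutive (G := G.graph)).toPerm
  tail := G.faceOf
  inv_inv d := d.symm_symm
  tail_rot := G.faceOf_facePerm
  sameCycle d e := G.faceOf_eq_iff.1
  tail_inv_ne d h := faceOf_iterate_rot_ne hG d (k := 1) (by norm_num)
    (by have := three_le_minimalPeriod_rot hG d; omega) (h.symm.trans (G.faceOf_symm d))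
  dart_ext d e h h' := faces_meet_once hG h h'
  surj := Quotient.mk_surjective
  conn K h1 h2 := G.dart_conn G.connected K (fun d hd => by
    have := h1 _ (h2 d hd)
    change K (G.rot d.symm.symm) at this
    rwa [d.symm_symm] at this) h2

variable (hG : G.graph.IsVertexConnected 3)

theorem dualDartMap_face : (dualDartMap hG).face = G.rot := by
  ext1 d
  change G.rot d.symm.symm = _
  rw [d.symm_symm]

theorem dualDartMap_chordFree : (dualDartMap hG).ChordFree := by
  rintro d k hk hk' ⟨c, h1, h2⟩
  rw [DartMap.faceLen, dualDartMap_face] at hk'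
  rw [dualDartMap_face] at h2
  exact not_adj_of_far hG hk hk' h1 h2

theorem card_faceSet_dualDartMap : Nat.card (dualDartMap hG).FaceSet = Nat.card V := by
  have := DartMap.finite_dart G.graph
  refine Nat.card_congr (Equiv.ofBijective (Quotient.lift (fun d => d.fst) fun d e h => ?_)
    ⟨?_, ?_⟩)
  · change (dualDartMap hG).face.SameCycle d e at h
    rw [dualDartMap_face] at h
    obtain ⟨i, -, rfl⟩ := G.rot.sameCycle_iff_exists_iterate.1 h
    exact (G.fst_iterate_rot d i).symm
  · rintro ⟨d⟩ ⟨e⟩ h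
    refine Quotient.sound ?_
    change (dualDartMap hG).face.SameCycle d e
    rw [dualDartMap_face]
    exact G.rot_sameCycle d e h
  · intro v
    have h3 := hG.three_le_ncard_neighborSet v
    obtain ⟨w, hw⟩ := Set.nonempty_of_ncard_ne_zero (s := G.graph.neighborSet v) (by omega)
    exact ⟨Quotient.mk _ ⟨(v, w), hw⟩, rfl⟩

/-- The counts of faces and darts, with Euler's formula, give three times the number of dual faces
plus two darts, and 3-connectedness makes all dual faces have length at least three. -/
theorem dualDartMap_isNear {n : ℕ} (h : G.IsPentagulation n (n + 10)) :
    ∃ N, (dualDartMap hG).IsNear n N := by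
  obtain ⟨N, hN, -, h5, hc⟩ := h
  have := DartMap.finite_dart G.graph
  have hfin : Finite G.Face := Quotient.finite _
  have hdeg : ∀ f, (dualDartMap hG).deg f = G.faceLength f := fun f => rfl
  have hcard : Nat.card G.Face = n + 11 := by
    classical
    have := Fintype.ofFinite G.Face
    rw [Nat.card_eq_fintype_card, Fintype.card_subtype_compl, Fintype.card_subtype_eq] at hc
    have : 0 < Fintype.card G.Face := Fintype.card_pos_iff.2 ⟨N⟩
    rw [Nat.card_eq_fintype_card]
    omega
  have hD := DartMap.card_dart_of_deg (M := dualDartMap hG) hcard ((hdeg N).trans hN)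
    fun v hv => (hdeg v).trans (h5 v hv)
  refine ⟨N, hcard, hN, h5, DartMap.faces_of_card (fun d => ?_) ?_⟩
  · rw [DartMap.faceLen, dualDartMap_face]
    exact three_le_minimalPeriod_rot hG d
  · rw [card_faceSet_dualDartMap, hD]
    have h1 := G.euler
    have h2 := DartMap.two_mul_card_edgeSet G.graph
    rw [hcard] at h1
    rw [hD] at h2
    push_cast at h1
    omega

end PlaneGraph

/-! ### Adding an edge inside a face -/

namespace DartMap

variable {V D : Type*} (M : DartMap V D)

theorem deg_eq_sum [Fintype D] [DecidableEq V] (v : V) :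
    M.deg v = ∑ d, if M.tail d = v then 1 else 0 := by
  rw [deg, Set.ncard_eq_toFinset_card', ← Finset.card_filter]
  congr 1
  ext
  simp

theorem iterate_face_ne_iterate {M : DartMap V D} {x : D} {k i j : ℕ} (hx : M.faceLen x = k)
    (hi : i < k) (hj : j < k)
    (hij : i ≠ j) : M.face^[i] x ≠ M.face^[j] x := fun h =>
  hij ((iterate_eq_iterate_iff_of_lt_minimalPeriod (hi.trans_eq hx.symm)
    (hj.trans_eq hx.symm)).1 h)

section AddEdge

variable [DecidableEq D]

/-- The rotation after the insertion of the two darts of a new edge before `x` and `y`. -/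
def addRot (x y : D) : Equiv.Perm (D ⊕ Bool) :=
  Equiv.swap (.inr false) (.inl x) * (Equiv.swap (.inr true) (.inl y) * Equiv.sumCongr M.rot 1)

theorem addRot_inl {x y : D} (hxy : x ≠ y) (d : D) : M.addRot x y (.inl d) =
    if M.rot d = x then .inr false else if M.rot d = y then .inr true else .inl (M.rot d) := by
  simp only [addRot, Equiv.Perm.mul_apply, Equiv.sumCongr_apply, Sum.map_inl, Equiv.swap_apply_def]
  grind

theorem addRot_false (x y : D) : M.addRot x y (.inr false) = .inl x := by
  simp [addRot, Equiv.swap_apply_def]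

theorem addRot_true {x y : D} (hxy : x ≠ y) : M.addRot x y (.inr true) = .inl y := by
  simp [addRot, Equiv.swap_apply_def, hxy.symm]

theorem addRot_sameCycle [Finite D] {x y : D} (hxy : x ≠ y) {d e : D} (h : M.tail d = M.tail e) :
    (M.addRot x y).SameCycle (.inl d) (.inl e) := by
  refine (M.sameCycle d e h).induction M.rot
    (K := fun e => (M.addRot x y).SameCycle (.inl d) (.inl e)) (fun e he => ?_)
    (Equiv.Perm.SameCycle.refl _ _)
  refine he.trans ?_
  have h1 := Equiv.Perm.sameCycle_apply_self (M.addRot x y) (.inl e)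
  rw [M.addRot_inl hxy] at h1
  split_ifs at h1 with hx hy
  · have h2 := Equiv.Perm.sameCycle_apply_self (M.addRot x y) (.inr false)
    rw [addRot_false] at h2
    rw [hx]
    exact h1.trans h2
  · have h2 := Equiv.Perm.sameCycle_apply_self (M.addRot x y) (.inr true)
    rw [M.addRot_true hxy] at h2
    rw [hy]
    exact h1.trans h2
  · exact h1

/-- The map with a new edge between the starting vertices of `x` and `y`, inserted before `x`
and `y`. -/
def addEdge [Finite D] (x y : D) (hxy : M.tail x ≠ M.tail y)
    (hadj : ¬ M.graph.Adj (M.tail x) (M.tail y)) : DartMap V (D ⊕ Bool) where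
  rot := M.addRot x y
  inv := Equiv.sumCongr M.inv Equiv.boolNot
  tail := Sum.elim M.tail fun i => bif i then M.tail y else M.tail x
  inv_inv := by rintro (d | _ | _) <;> simp [M.inv_inv]
  tail_rot := by
    have hne : x ≠ y := fun h => hxy (congrArg _ h)
    rintro (d | _ | _)
    · rw [M.addRot_inl hne]
      split_ifs with h1 h2
      · simp [← h1, M.tail_rot]
      · simp [← h2, M.tail_rot]
      · simp [M.tail_rot]
    · rw [addRot_false]
      rfl
    · rw [M.addRot_true hne]
      rfl
  sameCycle := by
    have hne : x ≠ y := fun h => hxy (congrArg _ h)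
    have hf := Equiv.Perm.sameCycle_apply_self (M.addRot x y) (.inr false)
    rw [addRot_false] at hf
    have ht := Equiv.Perm.sameCycle_apply_self (M.addRot x y) (.inr true)
    rw [M.addRot_true hne] at ht
    rintro (d | _ | _) (e | _ | _) h
    · exact M.addRot_sameCycle hne h
    · exact (M.addRot_sameCycle hne h).trans hf.symm
    · exact (M.addRot_sameCycle hne h).trans ht.symm
    · exact hf.trans (M.addRot_sameCycle hne h)
    · rfl
    · exact absurd h hxy
    · exact ht.trans (M.addRot_sameCycle hne h)
    · exact absurd h.symm hxy
    · rfl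
  tail_inv_ne := by
    rintro (d | _ | _)
    · exact M.tail_inv_ne d
    · exact hxy.symm
    · exact hxy
  dart_ext := by
    rintro (d | _ | _) (e | _ | _) h h'
    · rw [M.dart_ext d e h h']
    · exact absurd ⟨d, h, h'⟩ hadj
    · exact absurd ⟨M.inv d, h', by rw [M.inv_inv]; exact h⟩ hadj
    · exact absurd ⟨e, h.symm, h'.symm⟩ hadj
    · rfl
    · exact absurd h hxy
    · exact absurd ⟨M.inv e, h'.symm, by rw [M.inv_inv]; exact h.symm⟩ hadj
    · exact absurd h.symm hxy
    · rfl
  surj v := (M.surj v).elim fun d hd => ⟨.inl d, hd⟩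
  conn K h1 h2 := by
    have hne : x ≠ y := fun h => hxy (congrArg _ h)
    have hf := Equiv.Perm.sameCycle_apply_self (M.addRot x y) (.inr false)
    rw [addRot_false] at hf
    have ht := Equiv.Perm.sameCycle_apply_self (M.addRot x y) (.inr true)
    rw [M.addRot_true hne] at ht
    have hs : ∀ {d e}, (M.addRot x y).SameCycle d e → K d → K e := fun h hd =>
      h.induction _ h1 hd
    have hl : ∀ d e, K (.inl d) → K (.inl e) := M.conn (fun d => K (.inl d))
      (fun d hd => hs (M.addRot_sameCycle hne (M.tail_rot d).symm) hd) (fun d hd => h2 _ hd)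
    have key : ∀ e, K (.inl x) → K e := by
      rintro (e | _ | _) h
      · exact hl _ _ h
      · exact hs hf.symm h
      · exact hs ht.symm (hl _ _ h)
    rintro (d | _ | _) e h
    · exact key e (hl _ _ h)
    · exact key e (hs hf h)
    · exact key e (hl _ _ (hs ht h))

variable [Finite D] {M} {x y : D} {hxy : M.tail x ≠ M.tail y}
  {hadj : ¬ M.graph.Adj (M.tail x) (M.tail y)}

theorem addEdge_face_inl (d : D) : (M.addEdge x y hxy hadj).face (.inl d) =
    if M.face d = x then .inr false else if M.face d = y then .inr true else .inl (M.face d) :=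
  M.addRot_inl (fun h => hxy (congrArg _ h)) (M.inv d)

theorem addEdge_face_false : (M.addEdge x y hxy hadj).face (.inr false) = .inl y :=
  M.addRot_true fun h => hxy (congrArg _ h)

theorem addEdge_face_true : (M.addEdge x y hxy hadj).face (.inr true) = .inl x :=
  M.addRot_false x y

theorem addEdge_iterate_face {d : D} (hx : ¬ M.face.SameCycle x d) (hy : ¬ M.face.SameCycle y d)
    (i : ℕ) : (M.addEdge x y hxy hadj).face^[i] (.inl d) = .inl (M.face^[i] d) := by
  induction i with
  | zero => rfl
  | succ i ih =>
    rw [iterate_succ_apply', ih, addEdge_face_inl, iterate_succ_apply', if_neg, if_neg]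
    · rintro rfl
      exact hy (Equiv.Perm.sameCycle_apply_left.2 (M.face.sameCycle_iterate d i).symm)
    · rintro rfl
      exact hx (Equiv.Perm.sameCycle_apply_left.2 (M.face.sameCycle_iterate d i).symm)

theorem addEdge_faceLen {d : D} (hx : ¬ M.face.SameCycle x d) (hy : ¬ M.face.SameCycle y d) :
    (M.addEdge x y hxy hadj).faceLen (.inl d) = M.faceLen d := by
  rw [faceLen, faceLen, minimalPeriod_eq_minimalPeriod_iff]
  intro n
  rw [IsPeriodicPt, IsPeriodicPt, IsFixedPt, IsFixedPt, addEdge_iterate_face hx hy]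
  exact Sum.inl_injective.eq_iff

theorem addEdge_deg [DecidableEq V] (v : V) : (M.addEdge x y hxy hadj).deg v =
    M.deg v + (if v = M.tail x then 1 else 0) + if v = M.tail y then 1 else 0 := by
  have := Fintype.ofFinite D
  rw [deg_eq_sum, deg_eq_sum, Fintype.sum_sum_type, Fintype.sum_bool]
  simp only [eq_comm (a := v)]
  change _ + ((if M.tail y = v then 1 else 0) + if M.tail x = v then 1 else 0) = _
  rw [add_comm (ite _ _ _), add_assoc]
  rfl

theorem addEdge_adj {u w : V} : (M.addEdge x y hxy hadj).graph.Adj u w ↔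
    M.graph.Adj u w ∨ s(u, w) = s(M.tail x, M.tail y) := by
  constructor
  · rintro ⟨d | _ | _, rfl, rfl⟩
    · exact .inl ⟨d, rfl, rfl⟩
    · exact .inr rfl
    · exact .inr Sym2.eq_swap
  · rintro (⟨d, rfl, rfl⟩ | h)
    · exact ⟨.inl d, rfl, rfl⟩
    · rw [Sym2.eq_iff] at h
      obtain ⟨rfl, rfl⟩ | ⟨rfl, rfl⟩ := h
      · exact ⟨.inr false, rfl, rfl⟩
      · exact ⟨.inr true, rfl, rfl⟩

/-- A diagonal divides a quadrangle into two triangles. -/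
theorem addEdge_faceLen_of_quad {hxy : M.tail x ≠ M.tail (M.face (M.face x))}
    {hadj : ¬ M.graph.Adj (M.tail x) (M.tail (M.face (M.face x)))} (hx : M.faceLen x = 4)
    (d : D ⊕ Bool) : (M.addEdge x (M.face (M.face x)) hxy hadj).faceLen d = 3 ∨
      ∃ e, d = .inl e ∧ ¬ M.face.SameCycle x e ∧
        (M.addEdge x (M.face (M.face x)) hxy hadj).faceLen d = M.faceLen e := by
  have hne := fun i j => iterate_face_ne_iterate hx (i := i) (j := j)
  have h4 : M.face (M.face (M.face (M.face x))) = x := by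
    have := M.iterate_faceLen x
    rwa [hx] at this
  have n1 : M.face x ≠ x := hne 1 0 (by norm_num) (by norm_num) (by norm_num)
  have n2 : M.face x ≠ M.face (M.face x) := hne 1 2 (by norm_num) (by norm_num) (by norm_num)
  have n3 : M.face (M.face (M.face x)) ≠ x := hne 3 0 (by norm_num) (by norm_num) (by norm_num)
  have n4 : M.face (M.face (M.face x)) ≠ M.face (M.face x) :=
    hne 3 2 (by norm_num) (by norm_num) (by norm_num)
  have n5 : M.face (M.face x) ≠ x := hne 2 0 (by norm_num) (by norm_num) (by norm_num)
  rcases d with d | _ | _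
  · by_cases hd : M.face.SameCycle x d
    · obtain ⟨i, hi, rfl⟩ := Ear.sameCycle_iterate hx (Equiv.Perm.SameCycle.refl _ _) hd
      refine .inl (faceLen_eq_three _ ?_)
      interval_cases i <;>
        simp [addEdge_face_inl, addEdge_face_false, addEdge_face_true, h4, n1, n2, n3, n4, n5]
    · refine .inr ⟨d, rfl, hd, addEdge_faceLen hd fun h => hd ?_⟩
      exact Equiv.Perm.sameCycle_apply_left.1 (Equiv.Perm.sameCycle_apply_left.1 h)
  · refine .inl (faceLen_eq_three _ ?_)
    simp [addEdge_face_inl, addEdge_face_false, h4, n3, n4]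
  · refine .inl (faceLen_eq_three _ ?_)
    simp [addEdge_face_inl, addEdge_face_true, n1, n2, n5]

end AddEdge

end DartMap

open Classical in
/-- The removal of two different edges `u₁ w₁` and `u₂ w₂` of `G` leaves the vertex `N` with degree
`n` and the other vertices with degree five. -/
structure SimpleGraph.TwoEdges {V : Type*} (G : SimpleGraph V) (n : ℕ) (N u₁ w₁ u₂ w₂ : V) :
    Prop where
  adj₁ : G.Adj u₁ w₁
  adj₂ : G.Adj u₂ w₂
  ne : s(u₁, w₁) ≠ s(u₂, w₂)
  ncard : ∀ v, (G.neighborSet v).ncard = (if v = N then n else 5) +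
    (if v = u₁ ∨ v = w₁ then 1 else 0) + if v = u₂ ∨ v = w₂ then 1 else 0

/-! ### Completion to a triangulation by two diagonals -/

namespace DartMap

variable {V D : Type*} [Finite D] {M : DartMap V D} {n : ℕ} {N : V}

theorem twoEdges_of_addEdge [DecidableEq D] (h5 : M.deg N = n) (hN : ∀ v, v ≠ N → M.deg v = 5)
    {x y : D} {hxy : M.tail x ≠ M.tail y} {hadj : ¬ M.graph.Adj (M.tail x) (M.tail y)}
    {x' y' : D ⊕ Bool}
    {hxy' : (M.addEdge x y hxy hadj).tail x' ≠ (M.addEdge x y hxy hadj).tail y'}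
    {hadj' : ¬ (M.addEdge x y hxy hadj).graph.Adj ((M.addEdge x y hxy hadj).tail x')
      ((M.addEdge x y hxy hadj).tail y')} :
    ((M.addEdge x y hxy hadj).addEdge x' y' hxy' hadj').graph.TwoEdges n N (M.tail x) (M.tail y)
      ((M.addEdge x y hxy hadj).tail x') ((M.addEdge x y hxy hadj).tail y') where
  adj₁ := addEdge_adj.2 (.inl (addEdge_adj.2 (.inr rfl)))
  adj₂ := addEdge_adj.2 (.inr rfl)
  ne h := hadj' (addEdge_adj.2 (.inr h.symm))
  ncard v := by
    classical
    rw [ncard_neighborSet, addEdge_deg, addEdge_deg]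
    have h1 : M.deg v = if v = N then n else 5 := by
      split_ifs with h
      · rw [h, h5]
      · exact hN v h
    rw [h1]
    have key : ∀ {a b : V}, a ≠ b → (if v = a ∨ v = b then 1 else 0) =
        (if v = a then 1 else 0) + if v = b then 1 else 0 := by
      intro a b hab
      split_ifs <;> grind
    rw [key hxy, key hxy', ← add_assoc, ← add_assoc]

/-- Two edges complete the map to a triangulation. -/
theorem IsNear.exists_twoEdges {V D : Type} [Finite D] {M : DartMap V D} {n : ℕ} {N : V}
    (hN : M.IsNear n N) (hn : 3 ≤ n) (hC : M.ChordFree) :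
    ∃ (D' : Type) (_ : Finite D') (M' : DartMap V D') (u₁ w₁ u₂ w₂ : V),
      (∀ d, M'.faceLen d = 3) ∧ M'.graph.TwoEdges n N u₁ w₁ u₂ w₂ := by
  classical
  have h3 := hN.three_le_deg hn
  have hchord : ∀ d, 4 ≤ M.faceLen d → ¬ M.graph.Adj (M.tail d) (M.tail (M.face (M.face d))) :=
    fun d hd => hC d 2 le_rfl hd
  have hne : ∀ d, M.tail d ≠ M.tail (M.face (M.face d)) := fun d => (tail_face_face_ne h3 d).symm
  obtain ⟨q, r, hqr, hq, hr, hL⟩ | ⟨q, hq, hL⟩ := hN.faces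
  · have hq' : ∀ d, M.face.SameCycle (M.face (M.face q)) d ↔ M.face.SameCycle q d := fun d => by
      rw [Equiv.Perm.sameCycle_apply_left, Equiv.Perm.sameCycle_apply_left]
    -- The two diagonals of `r` have different end pairs, so at least one of them is not parallel to
    -- the diagonal chosen in `q`.
    obtain ⟨e, he, hse⟩ : ∃ e, M.face.SameCycle r e ∧
        s(M.tail e, M.tail (M.face (M.face e))) ≠ s(M.tail q, M.tail (M.face (M.face q))) := by
      by_contra hc
      push Not at hc
      have h1 := hc r (Equiv.Perm.SameCycle.refl _ _)
      have h2 := hc (M.face r) (M.face.sameCycle_apply_self r)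
      rw [← h1, Sym2.eq_iff] at h2
      obtain ⟨h2, -⟩ | ⟨h2, -⟩ := h2
      · exact M.tail_face_ne r h2
      · exact M.tail_face_ne (M.face r) h2.symm
    have heq : ¬ M.face.SameCycle q e := fun h => hqr (h.trans he.symm)
    let M₁ := M.addEdge q (M.face (M.face q)) (hne q) (hchord q hq.ge)
    have hit := fun i => addEdge_iterate_face (hxy := hne q) (hadj := hchord q hq.ge) heq
      (fun h => heq ((hq' e).1 h)) i
    have hff : M₁.face (M₁.face (.inl e)) = .inl (M.face (M.face e)) := hit 2
    have he4 : M₁.faceLen (.inl e) = 4 :=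
      (addEdge_faceLen heq (fun h => heq ((hq' e).1 h))).trans ((M.face_sameCycle_face he).trans hr)
    have hL₁ : ∀ d, ¬ M₁.face.SameCycle (.inl e) d → M₁.faceLen d = 3 := by
      intro d hd
      obtain h | ⟨d, rfl, hqd, h⟩ := addEdge_faceLen_of_quad (hxy := hne q)
        (hadj := hchord q hq.ge) hq d
      · exact h
      · refine h.trans (hL d hqd fun hrd => hd ?_)
        obtain ⟨i, -, rfl⟩ := M.face.sameCycle_iff_exists_iterate.1 (he.symm.trans hrd)
        rw [← hit i]
        exact M₁.face.sameCycle_iterate _ _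
    have hne₁ : M₁.tail (.inl e) ≠ M₁.tail (M₁.face (M₁.face (.inl e))) := by
      rw [hff]
      exact hne e
    have hadj₁ : ¬ M₁.graph.Adj (M₁.tail (.inl e)) (M₁.tail (M₁.face (M₁.face (.inl e)))) := by
      rw [hff]
      intro h
      obtain h | h := addEdge_adj.1 h
      · exact hchord e ((M.face_sameCycle_face he).trans hr).ge h
      · exact hse h
    refine ⟨_, inferInstance, M₁.addEdge _ _ hne₁ hadj₁, _, _, _, _, fun d => ?_,
      twoEdges_of_addEdge hN.deg_eq hN.deg_five⟩
    obtain h | ⟨d, rfl, h, h'⟩ := addEdge_faceLen_of_quad (hxy := hne₁) (hadj := hadj₁) he4 d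
    · exact h
    · exact h'.trans (hL₁ d h)
  · have h5 : M.face (M.face (M.face (M.face (M.face q)))) = q := by
      have := M.iterate_faceLen q
      rwa [hq] at this
    have hi := fun i j => iterate_face_ne_iterate hq (i := i) (j := j)
    have n10 : M.face q ≠ q := hi 1 0 (by norm_num) (by norm_num) (by norm_num)
    have n12 : M.face q ≠ M.face (M.face q) := hi 1 2 (by norm_num) (by norm_num) (by norm_num)
    have n20 : M.face (M.face q) ≠ q := hi 2 0 (by norm_num) (by norm_num) (by norm_num)
    have n30 : M.face (M.face (M.face q)) ≠ q := hi 3 0 (by norm_num) (by norm_num) (by norm_num)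
    have n32 : M.face (M.face (M.face q)) ≠ M.face (M.face q) :=
      hi 3 2 (by norm_num) (by norm_num) (by norm_num)
    have n40 : M.face (M.face (M.face (M.face q))) ≠ q :=
      hi 4 0 (by norm_num) (by norm_num) (by norm_num)
    have n42 : M.face (M.face (M.face (M.face q))) ≠ M.face (M.face q) :=
      hi 4 2 (by norm_num) (by norm_num) (by norm_num)
    have hq4 : 4 ≤ M.faceLen q := by omega
    -- The first diagonal cuts a triangle off the pentagon. The quadrangle that remains starts at
    -- `face (face q)`, and the second diagonal leaves the same vertex towards the start of the
    -- fifth side.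
    let M₁ := M.addEdge q (M.face (M.face q)) (hne q) (hchord q hq4)
    have f0 : M₁.face (.inl q) = .inl (M.face q) := by
      simp [M₁, addEdge_face_inl, n10, n12]
    have f1 : M₁.face (.inl (M.face q)) = .inr true := by
      simp [M₁, addEdge_face_inl, n20]
    have f2 : M₁.face (.inl (M.face (M.face q))) = .inl (M.face (M.face (M.face q))) := by
      simp [M₁, addEdge_face_inl, n30, n32]
    have f3 : M₁.face (.inl (M.face (M.face (M.face q)))) =
        .inl (M.face (M.face (M.face (M.face q)))) := by
      simp [M₁, addEdge_face_inl, n40, n42]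
    have f4 : M₁.face (.inl (M.face (M.face (M.face (M.face q))))) = .inr false := by
      simp [M₁, addEdge_face_inl, h5]
    have f5 : M₁.face (.inr false) = .inl (M.face (M.face q)) := addEdge_face_false
    have f6 : M₁.face (.inr true) = .inl q := addEdge_face_true
    have he4 : M₁.faceLen (.inl (M.face (M.face q))) = 4 := by
      refine M₁.face.minimalPeriod_eq_of_iterate (by norm_num) ?_ fun i h1 h2 => ?_
      · change M₁.face (M₁.face (M₁.face (M₁.face _))) = _
        rw [f2, f3, f4, f5]
      · interval_cases i
        · change M₁.face _ ≠ _
          rw [f2]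
          simpa using n32
        · change M₁.face (M₁.face _) ≠ _
          rw [f2, f3]
          simpa using n42
        · change M₁.face (M₁.face (M₁.face _)) ≠ _
          rw [f2, f3, f4]
          simp
    have hff : M₁.face (M₁.face (.inl (M.face (M.face q)))) =
        .inl (M.face (M.face (M.face (M.face q)))) := by rw [f2, f3]
    have hL₁ : ∀ d, ¬ M₁.face.SameCycle (.inl (M.face (M.face q))) d → M₁.faceLen d = 3 := by
      have s3 := M₁.face.sameCycle_apply_self (.inl (M.face (M.face q)))
      rw [f2] at s3
      have s4 := s3.trans (M₁.face.sameCycle_apply_self _)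
      rw [f3] at s4
      have s5 := s4.trans (M₁.face.sameCycle_apply_self _)
      rw [f4] at s5
      rintro (d | _ | _) hd
      · by_cases hqd : M.face.SameCycle q d
        · obtain ⟨i, hi, rfl⟩ := Ear.sameCycle_iterate hq (Equiv.Perm.SameCycle.refl _ _) hqd
          interval_cases i
          · refine faceLen_eq_three _ ?_
            change M₁.face (M₁.face (M₁.face (.inl q))) = .inl q
            rw [f0, f1, f6]
          · refine faceLen_eq_three _ ?_
            change M₁.face (M₁.face (M₁.face (.inl (M.face q)))) = .inl (M.face q)
            rw [f1, f6, f0]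
          · exact absurd (Equiv.Perm.SameCycle.refl _ _) hd
          · exact absurd s3 hd
          · exact absurd s4 hd
        · refine (addEdge_faceLen hqd fun h => hqd ?_).trans (hL d hqd)
          exact Equiv.Perm.sameCycle_apply_left.1 (Equiv.Perm.sameCycle_apply_left.1 h)
      · exact absurd s5 hd
      · refine faceLen_eq_three _ ?_
        rw [f6, f0, f1]
    have hne₁ : M₁.tail (.inl (M.face (M.face q))) ≠
        M₁.tail (M₁.face (M₁.face (.inl (M.face (M.face q))))) := by
      rw [hff]
      exact hne _
    have hadj₁ : ¬ M₁.graph.Adj (M₁.tail (.inl (M.face (M.face q))))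
        (M₁.tail (M₁.face (M₁.face (.inl (M.face (M.face q)))))) := by
      rw [hff]
      intro h
      obtain h | h := addEdge_adj.1 h
      · exact hchord (M.face (M.face q)) (by rw [faceLen_face, faceLen_face]; omega) h
      · obtain ⟨-, h⟩ | ⟨-, h⟩ := Sym2.eq_iff.1 h
        · exact hne (M.face (M.face q)) h.symm
        · have := M.tail_face_ne (M.face (M.face (M.face (M.face q))))
          rw [h5] at this
          exact this h.symm
    refine ⟨_, inferInstance, M₁.addEdge _ _ hne₁ hadj₁, _, _, _, _, fun d => ?_,
      twoEdges_of_addEdge hN.deg_eq hN.deg_five⟩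
    obtain h | ⟨d, rfl, h, h'⟩ := addEdge_faceLen_of_quad (hxy := hne₁) (hadj := hadj₁) he4 d
    · exact h
    · exact h'.trans (hL₁ d h)

end DartMap

/-! ### Deleting an edge of a triangle -/

namespace DartMap

variable {V D : Type*} (M : DartMap V D)

theorem rot_ne_inv (b : D) : M.rot b ≠ M.inv b := fun h =>
  M.tail_inv_ne b (by rw [← h, M.tail_rot])

theorem inv_ne_iff {M : DartMap V D} (b d : D) :
    (M.inv d ≠ b ∧ M.inv d ≠ M.inv b) ↔ (d ≠ b ∧ d ≠ M.inv b) := by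
  rw [Ne, M.inv_eq_iff, Ne, M.inv.injective.eq_iff, and_comm]

section DeleteEdge

variable [DecidableEq D]

/-- The rotation after the removal of the dart `b` and its reverse, which become fixed points. -/
def delRot (b : D) : Equiv.Perm D :=
  -- Each swap sends the predecessor of a deleted dart to its successor. Degree at least three
  -- ensures that this successor is not deleted itself.
  Equiv.swap b (M.rot b) * (Equiv.swap (M.inv b) (M.rot (M.inv b)) * M.rot)

/-- The dart at or after `d` that is not deleted. -/
def survivor (b d : D) : D := if d = b ∨ d = M.inv b then M.rot d else d

variable {M}

theorem tail_survivor (b d : D) : M.tail (M.survivor b d) = M.tail d := by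
  rw [survivor]
  split_ifs
  · exact M.tail_rot d
  · rfl

theorem survivor_of_ne {b d : D} (hb : d ≠ b) (hb' : d ≠ M.inv b) : M.survivor b d = d :=
  if_neg (not_or.2 ⟨hb, hb'⟩)

variable [Finite D]

theorem delRot_eq_survivor (h3 : ∀ v, 3 ≤ M.deg v) {b d : D} (hb : d ≠ b) (hb' : d ≠ M.inv b) :
    M.delRot b d = M.survivor b (M.rot d) := by
  have h1 := rot_ne h3 b
  have h2 := rot_ne h3 (M.inv b)
  have h4 := M.rot_ne_inv b
  have h5 := M.rot_ne_inv (M.inv b)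
  rw [M.inv_inv] at h5
  have h6 := M.inv_ne b
  have h7 : M.rot (M.inv b) ≠ M.rot b := fun h => h6 (M.rot.injective h)
  have h8 : M.rot d ≠ M.rot b := fun h => hb (M.rot.injective h)
  have h9 : M.rot d ≠ M.rot (M.inv b) := fun h => hb' (M.rot.injective h)
  simp only [delRot, survivor, Equiv.Perm.mul_apply]
  by_cases e1 : M.rot d = b
  · rw [e1, Equiv.swap_apply_of_ne_of_ne h6.symm h5.symm, Equiv.swap_apply_left, if_pos (.inl rfl)]
  by_cases e2 : M.rot d = M.inv b
  · rw [e2, Equiv.swap_apply_left, Equiv.swap_apply_of_ne_of_ne h5 h7, if_pos (.inr rfl)]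
  rw [Equiv.swap_apply_of_ne_of_ne e2 h9, Equiv.swap_apply_of_ne_of_ne e1 h8,
    if_neg (not_or.2 ⟨e1, e2⟩)]

theorem delRot_self (h3 : ∀ v, 3 ≤ M.deg v) (b : D) : M.delRot b b = b := by
  have h1 := rot_ne h3 b
  have h4 := M.rot_ne_inv b
  have h7 : M.rot (M.inv b) ≠ M.rot b := fun h => M.inv_ne b (M.rot.injective h)
  simp only [delRot, Equiv.Perm.mul_apply, Equiv.swap_apply_def]
  grind

theorem delRot_inv (h3 : ∀ v, 3 ≤ M.deg v) (b : D) : M.delRot b (M.inv b) = M.inv b := by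
  have h2 := rot_ne h3 (M.inv b)
  have h4 := M.rot_ne_inv b
  have h6 := M.inv_ne b
  simp only [delRot, Equiv.Perm.mul_apply, Equiv.swap_apply_def]
  grind

theorem delRot_ne (h3 : ∀ v, 3 ≤ M.deg v) (b d : D) :
    (M.delRot b d ≠ b ∧ M.delRot b d ≠ M.inv b) ↔ (d ≠ b ∧ d ≠ M.inv b) := by
  have h1 := delRot_self h3 b
  have h2 := delRot_inv h3 b
  have : ∀ d e, M.delRot b d = M.delRot b e ↔ d = e := fun d e => (M.delRot b).injective.eq_iff
  simp only [ne_eq]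
  rw [← this d b, ← this d (M.inv b), h1, h2]

theorem survivor_ne (h3 : ∀ v, 3 ≤ M.deg v) (b d : D) :
    M.survivor b d ≠ b ∧ M.survivor b d ≠ M.inv b := by
  have h1 := rot_ne h3 b
  have h2 := rot_ne h3 (M.inv b)
  have h4 := M.rot_ne_inv b
  have h5 := M.rot_ne_inv (M.inv b)
  rw [M.inv_inv] at h5
  simp only [survivor]
  grind

/-- A property of the remaining darts that is preserved by the new rotation extends along the
old one. -/
theorem survivor_rot (h3 : ∀ v, 3 ≤ M.deg v) (b : D) {K : D → Prop}
    (hK : ∀ d, d ≠ b → d ≠ M.inv b → K d → K (M.delRot b d)) (d : D) (hd : K (M.survivor b d)) :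
    K (M.survivor b (M.rot d)) := by
  by_cases h : d = b ∨ d = M.inv b
  · rw [survivor, if_pos h] at hd
    have : M.rot d ≠ b ∧ M.rot d ≠ M.inv b := by
      have := survivor_ne h3 b d
      rwa [survivor, if_pos h] at this
    rwa [survivor_of_ne this.1 this.2]
  · rw [not_or] at h
    rw [survivor_of_ne h.1 h.2] at hd
    rw [← delRot_eq_survivor h3 h.1 h.2]
    exact hK d h.1 h.2 hd

theorem delRot_sameCycle (h3 : ∀ v, 3 ≤ M.deg v) (b : D) {d e : D} (h : M.tail d = M.tail e) :
    (M.delRot b).SameCycle (M.survivor b d) (M.survivor b e) :=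
  (M.sameCycle d e h).induction M.rot
    (K := fun e => (M.delRot b).SameCycle (M.survivor b d) (M.survivor b e))
    (survivor_rot h3 b fun _ _ _ he => Equiv.Perm.sameCycle_apply_right.2 he)
    (Equiv.Perm.SameCycle.refl _ _)

theorem tail_delRot (h3 : ∀ v, 3 ≤ M.deg v) (b d : D) : M.tail (M.delRot b d) = M.tail d := by
  by_cases h1 : d = b
  · rw [h1, delRot_self h3]
  by_cases h2 : d = M.inv b
  · rw [h2, delRot_inv h3]
  rw [delRot_eq_survivor h3 h1 h2, tail_survivor, M.tail_rot]

/-- The map without the edge of the dart `b` of a triangle. -/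
def deleteEdge (h3 : ∀ v, 3 ≤ M.deg v) (b : D) (hb : M.faceLen b = 3) :
    DartMap V {d // d ≠ b ∧ d ≠ M.inv b} where
  rot := (M.delRot b).subtypePerm (delRot_ne h3 b)
  inv := M.inv.subtypePerm (inv_ne_iff b)
  tail d := M.tail d
  inv_inv d := Subtype.ext (M.inv_inv d)
  tail_rot d := tail_delRot h3 b d
  sameCycle d e h := by
    rw [Equiv.Perm.sameCycle_subtypePerm]
    have := delRot_sameCycle h3 b h
    rwa [survivor_of_ne d.2.1 d.2.2, survivor_of_ne e.2.1 e.2.2] at this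
  tail_inv_ne d := M.tail_inv_ne d
  dart_ext d e h h' := Subtype.ext (M.dart_ext _ _ h h')
  surj v := by
    obtain ⟨d, rfl⟩ := M.surj v
    exact ⟨⟨M.survivor b d, survivor_ne h3 b d⟩, tail_survivor b d⟩
  conn K h1 h2 := by
    let L : D → Prop := fun d => ∃ h, K ⟨d, h⟩
    have hL : ∀ d, d ≠ b → d ≠ M.inv b → L d → L (M.delRot b d) := fun d _ _ ⟨h, hd⟩ =>
      ⟨(delRot_ne h3 b d).2 h, h1 ⟨d, h⟩ hd⟩
    have hinv : ∀ d, L d → L (M.inv d) := fun d ⟨h, hd⟩ => ⟨(inv_ne_iff b d).2 h, h2 ⟨d, h⟩ hd⟩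
    have htail : ∀ {d e}, M.tail d = M.tail e → (e ≠ b ∧ e ≠ M.inv b) → L d → L e := by
      intro d e h he hd
      have := delRot_sameCycle h3 b h
      rw [survivor_of_ne hd.1.1 hd.1.2, survivor_of_ne he.1 he.2] at this
      exact this.induction _ (fun d hd => hL d hd.1.1 hd.1.2 hd) hd
    have hf := M.face3 hb
    have r1 := rot_ne h3 b
    have r2 := rot_ne h3 (M.inv b)
    have ha : M.face b ≠ b ∧ M.face b ≠ M.inv b := ⟨M.face_ne b, r2⟩
    have ha' : M.face (M.face b) ≠ b ∧ M.face (M.face b) ≠ M.inv b := by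
      refine ⟨M.face_face_ne b r1, fun h => ?_⟩
      rw [h, M.face_inv] at hf
      exact r1 hf
    have hb1 : M.rot b ≠ b ∧ M.rot b ≠ M.inv b := ⟨r1, M.rot_ne_inv b⟩
    have t1 : M.tail (M.rot b) = M.tail (M.inv (M.face (M.face b))) := by
      rw [M.tail_rot, ← M.tail_face, hf]
    have t2 : M.tail (M.face (M.face b)) = M.tail (M.inv (M.face b)) := M.tail_face _
    -- The other two sides of the triangle still connect the ends of the deleted edge; this is where
    -- the face of length three is needed.
    have hbb : L (M.rot b) ↔ L (M.rot (M.inv b)) := by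
      constructor
      · intro h
        have := htail t2 ((inv_ne_iff b _).2 ha)
          (M.inv_inv (M.face (M.face b)) ▸ hinv _ (htail t1 ((inv_ne_iff b _).2 ha') h))
        exact M.inv_inv (M.face b) ▸ hinv _ this
      · intro h
        have : L (M.face b) := h
        exact htail t1.symm hb1 (hinv _ (htail t2.symm ha' (hinv _ this)))
    have hconn : ∀ d e, L (M.survivor b d) → L (M.survivor b e) := by
      refine M.conn (fun d => L (M.survivor b d)) (survivor_rot h3 b hL) fun d hd => ?_
      by_cases e1 : d = b
      · subst e1
        rw [survivor, if_pos (.inl rfl)] at hd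
        rw [survivor, if_pos (.inr rfl)]
        exact hbb.1 hd
      by_cases e2 : d = M.inv b
      · subst e2
        rw [survivor, if_pos (.inr rfl)] at hd
        rw [M.inv_inv, survivor, if_pos (.inl rfl)]
        exact hbb.2 hd
      · rw [survivor_of_ne e1 e2] at hd
        have := (inv_ne_iff b d).2 ⟨e1, e2⟩
        rw [survivor_of_ne this.1 this.2]
        exact hinv d hd
    intro d e hd
    have := hconn d e (by rw [survivor_of_ne d.2.1 d.2.2]; exact ⟨d.2, hd⟩)
    rw [survivor_of_ne e.2.1 e.2.2] at this
    exact this.2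

end DeleteEdge

end DartMap

/-! ### Faces and degrees after a deletion -/

namespace DartMap

variable {V D : Type*} {M : DartMap V D} [Finite D] {b : D}

/-- The darts of the triangle of a deleted edge survive. -/
theorem face_ne_deleted (h3 : ∀ v, 3 ≤ M.deg v) (hb : M.faceLen b = 3) :
    (M.face b ≠ b ∧ M.face b ≠ M.inv b) ∧
      (M.face (M.face b) ≠ b ∧ M.face (M.face b) ≠ M.inv b) := by
  have hf := M.face3 hb
  have r1 := rot_ne h3 b
  refine ⟨⟨M.face_ne b, rot_ne h3 (M.inv b)⟩, M.face_face_ne b r1, fun h => ?_⟩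
  rw [h, M.face_inv] at hf
  exact r1 hf

variable [DecidableEq D] {h3 : ∀ v, 3 ≤ M.deg v} {hb : M.faceLen b = 3}

theorem deleteEdge_face (d : {d // d ≠ b ∧ d ≠ M.inv b}) :
    ((M.deleteEdge h3 b hb).face d : D) = M.survivor b (M.face d) :=
  delRot_eq_survivor h3 ((inv_ne_iff b _).2 d.2).1 ((inv_ne_iff b _).2 d.2).2

theorem deleteEdge_face_mk {d e : D} (hd : d ≠ b ∧ d ≠ M.inv b) (he : e ≠ b ∧ e ≠ M.inv b)
    (h : M.face d = e) : (M.deleteEdge h3 b hb).face ⟨d, hd⟩ = ⟨e, he⟩ := by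
  refine Subtype.ext ((deleteEdge_face _).trans ?_)
  rw [h, survivor_of_ne he.1 he.2]

theorem deleteEdge_face_mk' {d e : D} (hd : d ≠ b ∧ d ≠ M.inv b) (he : e ≠ b ∧ e ≠ M.inv b)
    (h : M.face d = b) (h' : M.face (M.inv b) = e) :
    (M.deleteEdge h3 b hb).face ⟨d, hd⟩ = ⟨e, he⟩ := by
  refine Subtype.ext ((deleteEdge_face _).trans ?_)
  rw [h, survivor, if_pos (.inl rfl), ← M.face_inv]
  exact h'

theorem deleteEdge_face_mk_inv {d e : D} (hd : d ≠ b ∧ d ≠ M.inv b) (he : e ≠ b ∧ e ≠ M.inv b)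
    (h : M.face d = M.inv b) (h' : M.face b = e) :
    (M.deleteEdge h3 b hb).face ⟨d, hd⟩ = ⟨e, he⟩ := by
  refine Subtype.ext ((deleteEdge_face _).trans ?_)
  rw [h, survivor, if_pos (.inr rfl), ← M.face_apply]
  exact h'

theorem deleteEdge_iterate_face (d : {d // d ≠ b ∧ d ≠ M.inv b}) (h : ¬ M.face.SameCycle b d)
    (h' : ¬ M.face.SameCycle (M.inv b) d) (i : ℕ) :
    (((M.deleteEdge h3 b hb).face^[i] d : {d // d ≠ b ∧ d ≠ M.inv b}) : D) = M.face^[i] d := by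
  induction i with
  | zero => rfl
  | succ i ih =>
    rw [iterate_succ_apply', deleteEdge_face, ih, iterate_succ_apply']
    rw [← iterate_succ_apply' M.face]
    have := (M.face.sameCycle_iterate (d : D) i.succ).symm
    refine survivor_of_ne (fun hc => h ?_) fun hc => h' ?_
    · rwa [hc] at this
    · rwa [hc] at this

theorem deleteEdge_faceLen (d : {d // d ≠ b ∧ d ≠ M.inv b}) (h : ¬ M.face.SameCycle b d)
    (h' : ¬ M.face.SameCycle (M.inv b) d) :
    (M.deleteEdge h3 b hb).faceLen d = M.faceLen (d : D) := by
  rw [faceLen, faceLen, minimalPeriod_eq_minimalPeriod_iff]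
  intro n
  rw [IsPeriodicPt, IsPeriodicPt, IsFixedPt, IsFixedPt, ← deleteEdge_iterate_face d h h',
    Subtype.ext_iff]

theorem deleteEdge_deg [DecidableEq V] (v : V) : (M.deleteEdge h3 b hb).deg v +
    ((if M.tail b = v then 1 else 0) + if M.tail (M.inv b) = v then 1 else 0) = M.deg v := by
  have := Fintype.ofFinite D
  rw [deg_eq_sum, deg_eq_sum, ← Finset.sum_add_sum_compl {b, M.inv b}, add_comm,
    Finset.sum_pair (M.inv_ne b).symm]
  congr 1
  exact (Finset.sum_subtype _ (fun d => by simp) fun d => if M.tail d = v then 1 else 0).symm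

/-- The deletion of an edge between two triangles yields a quadrangle. -/
theorem deleteEdge_quad (hb' : M.faceLen (M.inv b) = 3) :
    ∃ q, (M.deleteEdge h3 b hb).faceLen q = 4 ∧ M.face.SameCycle b q ∧
      ∀ d : {d // d ≠ b ∧ d ≠ M.inv b}, (M.face.SameCycle b d ∨ M.face.SameCycle (M.inv b) d) →
        (M.deleteEdge h3 b hb).face.SameCycle q d := by
  obtain ⟨p1, p2⟩ := face_ne_deleted h3 hb
  obtain ⟨q1, q2⟩ := face_ne_deleted h3 hb'
  rw [M.inv_inv, and_comm] at q1 q2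
  have hs : ¬ M.face.SameCycle b (M.inv b) := not_sameCycle_inv h3 (by omega)
  have f1 := deleteEdge_face_mk (hb := hb) (h3 := h3) p1 p2 rfl
  have f2 := deleteEdge_face_mk' (hb := hb) (h3 := h3) p2 q1 (M.face3 hb) rfl
  have f3 := deleteEdge_face_mk (hb := hb) (h3 := h3) q1 q2 rfl
  have f4 := deleteEdge_face_mk_inv (hb := hb) (h3 := h3) q2 p1 (M.face3 hb') rfl
  set F := (M.deleteEdge h3 b hb).face with hF
  have sb : ∀ i, M.face.SameCycle b (M.face^[i] b) := M.face.sameCycle_iterate b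
  have sb' : ∀ i, M.face.SameCycle (M.inv b) (M.face^[i] (M.inv b)) := M.face.sameCycle_iterate _
  have hne : ∀ i j, M.face^[i] (M.inv b) ≠ M.face^[j] b := fun i j h =>
    hs ((sb j).trans (h ▸ (sb' i).symm))
  refine ⟨⟨M.face b, p1⟩, ?_, sb 1, ?_⟩
  · refine F.minimalPeriod_eq_of_iterate (by norm_num) ?_ fun i h1 h2 => ?_
    · change F (F (F (F _))) = _
      rw [f1, f2, f3, f4]
    · interval_cases i
      · change F _ ≠ _
        rw [f1, Ne, Subtype.mk.injEq]
        exact M.face_ne _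
      · change F (F _) ≠ _
        rw [f1, f2, Ne, Subtype.mk.injEq]
        exact hne 1 1
      · change F (F (F _)) ≠ _
        rw [f1, f2, f3, Ne, Subtype.mk.injEq]
        exact hne 2 1
  · have s1 := F.sameCycle_apply_self ⟨M.face b, p1⟩
    rw [f1] at s1
    have s2 := s1.trans (F.sameCycle_apply_self _)
    rw [f2] at s2
    have s3 := s2.trans (F.sameCycle_apply_self _)
    rw [f3] at s3
    rintro ⟨d, hd⟩ (h | h)
    · obtain ⟨i, hi, rfl⟩ := Ear.sameCycle_iterate hb (Equiv.Perm.SameCycle.refl _ _) h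
      interval_cases i
      · exact absurd rfl hd.1
      · exact Equiv.Perm.SameCycle.refl _ _
      · exact s1
    · obtain ⟨i, hi, rfl⟩ := Ear.sameCycle_iterate hb' (Equiv.Perm.SameCycle.refl _ _) h
      interval_cases i
      · exact absurd rfl hd.2
      · exact s2
      · exact s3

/-- The deletion of an edge between a triangle and a quadrangle yields a pentagon. -/
theorem deleteEdge_pentagon (hb' : M.faceLen (M.inv b) = 4) :
    ∃ q, (M.deleteEdge h3 b hb).faceLen q = 5 ∧
      ∀ d : {d // d ≠ b ∧ d ≠ M.inv b}, (M.face.SameCycle b d ∨ M.face.SameCycle (M.inv b) d) →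
        (M.deleteEdge h3 b hb).face.SameCycle q d := by
  obtain ⟨p1, p2⟩ := face_ne_deleted h3 hb
  have hs : ¬ M.face.SameCycle b (M.inv b) := not_sameCycle_inv h3 (by omega)
  have sb : ∀ i, M.face.SameCycle b (M.face^[i] b) := M.face.sameCycle_iterate b
  have sb' : ∀ i, M.face.SameCycle (M.inv b) (M.face^[i] (M.inv b)) := M.face.sameCycle_iterate _
  have hne : ∀ i j, M.face^[i] (M.inv b) ≠ M.face^[j] b := fun i j h =>
    hs ((sb j).trans (h ▸ (sb' i).symm))
  have hi := fun i j => iterate_face_ne_iterate hb' (i := i) (j := j)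
  have q1 : M.face (M.inv b) ≠ b ∧ M.face (M.inv b) ≠ M.inv b :=
    ⟨hne 1 0, hi 1 0 (by norm_num) (by norm_num) (by norm_num)⟩
  have q2 : M.face (M.face (M.inv b)) ≠ b ∧ M.face (M.face (M.inv b)) ≠ M.inv b :=
    ⟨hne 2 0, hi 2 0 (by norm_num) (by norm_num) (by norm_num)⟩
  have q3 : M.face (M.face (M.face (M.inv b))) ≠ b ∧ M.face (M.face (M.face (M.inv b))) ≠ M.inv b :=
    ⟨hne 3 0, hi 3 0 (by norm_num) (by norm_num) (by norm_num)⟩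
  have f1 := deleteEdge_face_mk (hb := hb) (h3 := h3) p1 p2 rfl
  have f2 := deleteEdge_face_mk' (hb := hb) (h3 := h3) p2 q1 (M.face3 hb) rfl
  have f3 := deleteEdge_face_mk (hb := hb) (h3 := h3) q1 q2 rfl
  have f4 := deleteEdge_face_mk (hb := hb) (h3 := h3) q2 q3 rfl
  have f5 := deleteEdge_face_mk_inv (hb := hb) (h3 := h3) q3 p1
    (face_four hb' (Equiv.Perm.SameCycle.refl _ _)) rfl
  set F := (M.deleteEdge h3 b hb).face with hF
  refine ⟨⟨M.face b, p1⟩, ?_, ?_⟩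
  · refine F.minimalPeriod_eq_of_iterate (by norm_num) ?_ fun i h1 h2 => ?_
    · change F (F (F (F (F _)))) = _
      rw [f1, f2, f3, f4, f5]
    · interval_cases i
      · change F _ ≠ _
        rw [f1, Ne, Subtype.mk.injEq]
        exact M.face_ne _
      · change F (F _) ≠ _
        rw [f1, f2, Ne, Subtype.mk.injEq]
        exact hne 1 1
      · change F (F (F _)) ≠ _
        rw [f1, f2, f3, Ne, Subtype.mk.injEq]
        exact hne 2 1
      · change F (F (F (F _))) ≠ _
        rw [f1, f2, f3, f4, Ne, Subtype.mk.injEq]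
        exact hne 3 1
  · have s1 := F.sameCycle_apply_self ⟨M.face b, p1⟩
    rw [f1] at s1
    have s2 := s1.trans (F.sameCycle_apply_self _)
    rw [f2] at s2
    have s3 := s2.trans (F.sameCycle_apply_self _)
    rw [f3] at s3
    have s4 := s3.trans (F.sameCycle_apply_self _)
    rw [f4] at s4
    rintro ⟨d, hd⟩ (h | h)
    · obtain ⟨i, hi, rfl⟩ := Ear.sameCycle_iterate hb (Equiv.Perm.SameCycle.refl _ _) h
      interval_cases i
      · exact absurd rfl hd.1
      · exact Equiv.Perm.SameCycle.refl _ _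
      · exact s1
    · obtain ⟨i, hi, rfl⟩ := Ear.sameCycle_iterate hb' (Equiv.Perm.SameCycle.refl _ _) h
      interval_cases i
      · exact absurd rfl hd.2
      · exact s2
      · exact s3
      · exact s4

/-- The deletion of two edges of a triangulation. -/
theorem exists_of_twoEdges {V D : Type} [Finite D] {M : DartMap V D} {n : ℕ} (hn : 3 ≤ n)
    {N u₁ w₁ u₂ w₂ : V} (hM : ∀ d, M.faceLen d = 3) (h : M.graph.TwoEdges n N u₁ w₁ u₂ w₂) :
    ∃ (D' : Type) (_ : Finite D') (M' : DartMap V D'), M'.deg N = n ∧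
      (∀ v, v ≠ N → M'.deg v = 5) ∧ (M'.HasTwoQuads ∨ M'.HasPentagon) := by
  classical
  have hdeg : ∀ v, M.deg v = (if v = N then n else 5) +
      (if v = u₁ ∨ v = w₁ then 1 else 0) + if v = u₂ ∨ v = w₂ then 1 else 0 := fun v => by
    rw [← ncard_neighborSet, h.ncard]
  have h3 : ∀ v, 3 ≤ M.deg v := fun v => by
    rw [hdeg]
    split_ifs <;> omega
  obtain ⟨b, rfl, rfl⟩ := h.adj₁
  let M₁ := M.deleteEdge h3 b (hM b)
  have key : ∀ {v a b : V}, a ≠ b → (if v = a ∨ v = b then 1 else 0) =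
      (if a = v then 1 else 0) + if b = v then 1 else 0 := by
    intro v a b hab
    split_ifs <;> grind
  have hdeg₁ : ∀ v, M₁.deg v = (if v = N then n else 5) + if v = u₂ ∨ v = w₂ then 1 else 0 := by
    intro v
    have h1 := deleteEdge_deg (h3 := h3) (hb := hM b) v
    rw [hdeg v, key (M.tail_inv_ne b).symm] at h1
    change M₁.deg v + _ = _ at h1
    omega
  have h3₁ : ∀ v, 3 ≤ M₁.deg v := fun v => by
    rw [hdeg₁]
    split_ifs <;> omega
  obtain ⟨q, hq, -, hqs⟩ := deleteEdge_quad (h3 := h3) (hb := hM b) (hM _)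
  have hL₁ : ∀ d, ¬ M₁.face.SameCycle q d → M₁.faceLen d = 3 := fun d hd => by
    have : ¬ (M.face.SameCycle b d ∨ M.face.SameCycle (M.inv b) d) := mt (hqs d) hd
    rw [not_or] at this
    exact (deleteEdge_faceLen d this.1 this.2).trans (hM _)
  -- The quadrangle does not border itself, so one of the two darts of the second edge lies on a
  -- triangle.
  have hc : ∃ c, s(M₁.tail c, M₁.tail (M₁.inv c)) = s(u₂, w₂) ∧ ¬ M₁.face.SameCycle q c := by
    obtain ⟨c, hc1, hc2⟩ := h.adj₂
    have hcb : c ≠ b ∧ c ≠ M.inv b := by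
      constructor
      · rintro rfl
        exact h.ne (by rw [hc1, hc2])
      · rintro rfl
        rw [M.inv_inv] at hc2
        exact h.ne (by rw [← hc1, ← hc2, Sym2.eq_swap])
    by_cases hqc : M₁.face.SameCycle q ⟨c, hcb⟩
    · refine ⟨M₁.inv ⟨c, hcb⟩, ?_, fun h' => ?_⟩
      · rw [M₁.inv_inv, Sym2.eq_swap, ← hc1, ← hc2]
        rfl
      · exact not_sameCycle_inv h3₁ ((M₁.face_sameCycle_face hqc).trans_le (hq.trans_le (by norm_num)))
          (hqc.symm.trans h')
    · exact ⟨_, by rw [← hc1, ← hc2]; rfl, hqc⟩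
  obtain ⟨c, hcs, hqc⟩ := hc
  have hc3 := hL₁ c hqc
  refine ⟨_, inferInstance, M₁.deleteEdge h3₁ c hc3, ?_, ?_, ?_⟩
  rotate_left 2
  -- If the second edge borders the quadrangle from the first deletion, a pentagon arises, otherwise
  -- a second quadrangle.
  · by_cases hqc' : M₁.face.SameCycle q (M₁.inv c)
    · right
      obtain ⟨p, hp, hps⟩ := deleteEdge_pentagon (h3 := h3₁) (hb := hc3)
        ((M₁.face_sameCycle_face hqc').trans hq)
      refine ⟨p, hp, fun d hd => ?_⟩
      have := mt (hps d) hd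
      rw [not_or] at this
      exact (deleteEdge_faceLen d this.1 this.2).trans (hL₁ _ fun h => this.2 (hqc'.symm.trans h))
    · left
      obtain ⟨p, hp, hcp, hps⟩ := deleteEdge_quad (h3 := h3₁) (hb := hc3) (hL₁ _ hqc')
      have hq' : q ≠ c ∧ q ≠ M₁.inv c := by
        constructor
        · rintro rfl
          exact hqc (Equiv.Perm.SameCycle.refl _ _)
        · rintro rfl
          exact hqc' (Equiv.Perm.SameCycle.refl _ _)
      have hit := deleteEdge_iterate_face (h3 := h3₁) (hb := hc3) ⟨q, hq'⟩
        (fun h => hqc h.symm) fun h => hqc' h.symm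
      refine ⟨⟨q, hq'⟩, p, fun hqp => ?_, ?_, hp, fun d hd hd' => ?_⟩
      · obtain ⟨i, -, hi⟩ := (Equiv.Perm.sameCycle_iff_exists_iterate _).1 hqp
        refine hqc ((M₁.face.sameCycle_iterate q i).trans ?_)
        have := hit i
        rw [hi] at this
        rw [← this]
        exact hcp.symm
      · exact (deleteEdge_faceLen ⟨q, hq'⟩ (fun h => hqc h.symm) fun h => hqc' h.symm).trans hq
      · have := mt (hps d) hd'
        rw [not_or] at this
        refine (deleteEdge_faceLen d this.1 this.2).trans (hL₁ _ fun h => hd ?_)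
        obtain ⟨i, -, hi⟩ := (Equiv.Perm.sameCycle_iff_exists_iterate _).1 h
        have hd2 : d = (M₁.deleteEdge h3₁ c hc3).face^[i] ⟨q, hq'⟩ :=
          Subtype.ext (hi.symm.trans (hit i).symm)
        rw [hd2]
        exact Equiv.Perm.sameCycle_iterate _ _ _
  all_goals
    have hdeg₂ : ∀ v, (M₁.deleteEdge h3₁ c hc3).deg v = if v = N then n else 5 := by
      intro v
      have h1 := deleteEdge_deg (h3 := h3₁) (hb := hc3) v
      have h2 : (v = u₂ ∨ v = w₂) ↔ (v = M₁.tail c ∨ v = M₁.tail (M₁.inv c)) := by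
        rw [← Sym2.mem_iff, ← hcs, Sym2.mem_iff]
      rw [hdeg₁ v, if_congr h2 rfl rfl, key (M₁.tail_inv_ne c).symm] at h1
      omega
  · rw [hdeg₂, if_pos rfl]
  · intro v hv
    rw [hdeg₂, if_neg hv]

end DartMap

/-! ### Euler's formula for the completed map -/

namespace DartMap

variable {V D : Type*} {M : DartMap V D} [Finite D] {n : ℕ} {N u₁ w₁ u₂ w₂ : V}

theorem card_dart_of_faceLen_eq_three (hM : ∀ d, M.faceLen d = 3) :
    Nat.card D = 3 * Nat.card M.FaceSet := by
  have := Fintype.ofFinite M.FaceSet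
  rw [card_eq_sum_faceLen (M := M), Finset.sum_congr rfl fun q _ => hM q.out]
  simp [mul_comm]

/-- The degree sum is `n + 5 * (card V - 1)` plus four for the ends of the two edges. -/
theorem card_dart_of_twoEdges [Finite V] (h : M.graph.TwoEdges n N u₁ w₁ u₂ w₂) :
    Nat.card D + 1 = n + 5 * Nat.card V := by
  classical
  have := Fintype.ofFinite V
  have h1 : ∀ v, M.deg v + (if v = N then 5 else 0) = (if v = N then n else 0) + 5 +
      ((if v = u₁ then 1 else 0) + if v = w₁ then 1 else 0) +
      ((if v = u₂ then 1 else 0) + if v = w₂ then 1 else 0) := by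
    intro v
    have e₁ := h.adj₁.ne
    have e₂ := h.adj₂.ne
    rw [← ncard_neighborSet, h.ncard v]
    have key : ∀ {a b : V}, a ≠ b → (if v = a ∨ v = b then 1 else 0) =
        (if v = a then 1 else 0) + if v = b then 1 else 0 := by
      intro a b hab
      split_ifs <;> grind
    rw [key e₁, key e₂]
    split_ifs <;> omega
  have h2 := Finset.sum_congr rfl fun v (_ : v ∈ Finset.univ) => h1 v
  simp only [Finset.sum_add_distrib, Finset.sum_ite_eq', Finset.mem_univ, if_true,
    ← card_eq_sum_deg, Finset.sum_const, Finset.card_univ, smul_eq_mul] at h2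
  rw [Nat.card_eq_fintype_card (α := V)]
  omega

/-- Two edges of a suitable triangulation can be added to a plane map with two missing edges. -/
theorem IsNear.exists_triangulation {V D : Type} [Finite V] [Finite D] {M : DartMap V D} {N : V}
    (hN : M.IsNear n N) (hn : 3 ≤ n) (hC : M.ChordFree) : ∃ (H : PlaneGraph V) (u₁ w₁ u₂ w₂ : V),
      H.IsTriangulation ∧ H.graph.TwoEdges n N u₁ w₁ u₂ w₂ := by
  obtain ⟨D', _, M', u₁, w₁, u₂, w₂, hM', h⟩ := hN.exists_twoEdges hn hC
  have h1 := card_dart_of_twoEdges h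
  have h2 := card_dart_of_faceLen_eq_three hM'
  have h3 := hN.card
  have : Nonempty V := ⟨N⟩
  -- With `n + 11` vertices there are `6 * n + 54` darts and `2 * n + 18` triangles, which satisfy
  -- Euler's formula.
  refine ⟨M'.toPlaneGraph (by omega), u₁, w₁, u₂, w₂, fun f => ?_, h⟩
  obtain ⟨d, rfl⟩ := M'.exists_faceOf f
  exact (M'.toRotationSystem_faceLength d).trans (hM' d)

end DartMap

namespace PlaneGraph

variable {V : Type} [Finite V] {H : PlaneGraph V} {n : ℕ} {N u₁ w₁ u₂ w₂ : V}

/-- The removal of two suitable edges of a triangulation leaves a plane map whose dual is a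
pentagulation. -/
theorem IsTriangulation.exists_pentagulation (hH : H.IsTriangulation) (hn : 3 ≤ n)
    (h : H.graph.TwoEdges n N u₁ w₁ u₂ w₂) : ∃ (V : Type) (_ : Finite V) (G : PlaneGraph V),
      G.graph.IsVertexConnected 3 ∧ G.IsPentagulation n (n + 10) := by
  have := DartMap.finite_dart H.graph
  have hs : ∀ v, ∃ w, H.graph.Adj v w := fun v => by
    refine Set.nonempty_of_ncard_ne_zero (s := H.graph.neighborSet v) ?_
    rw [h.ncard]
    split_ifs <;> omega
  let M := DartMap.ofRotationSystem H.toRotationSystem H.connected hs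
  have hgraph : M.graph = H.graph := by
    ext u v
    exact ⟨fun ⟨d, hu, hv⟩ => hu ▸ hv ▸ d.adj, fun huv => ⟨⟨(u, v), huv⟩, rfl, rfl⟩⟩
  have hM : ∀ d, M.faceLen d = 3 := fun d => by
    rw [← hH (H.faceOf d), RotationSystem.faceLength, DartMap.faceLen,
      ← Equiv.Perm.ncard_sameCycle]
    congr 1
    ext e
    exact Equiv.Perm.sameCycle_comm.trans H.faceOf_eq_iff.symm
  rw [← hgraph] at h
  have h1 := DartMap.card_dart_of_twoEdges h
  have h2 := DartMap.card_dart_of_faceLen_eq_three hM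
  have h3 := DartMap.two_mul_card_edgeSet H.graph
  have h4 := H.euler
  have h5 : Nat.card M.FaceSet = Nat.card H.Face := rfl
  obtain ⟨D', _, M', hN, h5, hF⟩ := DartMap.exists_of_twoEdges hn hM h
  -- Euler's formula, triangular faces and the degree sum force the number of vertices to be `n +
  -- 11`.
  exact DartMap.IsNear.exists_pentagulation hn ⟨by omega, hN, h5, hF⟩

end PlaneGraph

/-! ### The positions of two edges and a vertex -/

namespace SimpleGraph

variable {V : Type*} {G : SimpleGraph V} {n : ℕ}

theorem hasLabelledSubgraph_iff {W : Type*} {P : SimpleGraph W} {l : W → ℕ} :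
    G.HasLabelledSubgraph P l ↔ ∃ f : W → V, Function.Injective f ∧
      (∀ a b, P.Adj a b → G.Adj (f a) (f b)) ∧ (∀ w, (G.neighborSet (f w)).ncard = l w) ∧
      ∀ v, (∀ w, v ≠ f w) → (G.neighborSet v).ncard = 5 := by
  constructor
  · rintro ⟨φ, h1, h2⟩
    exact ⟨φ, φ.injective, fun a b h => φ.toHom.map_adj h, h1, fun v hv => h2 v (by
      rintro ⟨w, rfl⟩
      exact hv w rfl)⟩
  · rintro ⟨f, hf, h, h1, h2⟩
    exact ⟨⟨⟨f, h _ _⟩, hf⟩, h1, fun v hv => h2 v fun w hw => hv ⟨w, hw.symm⟩⟩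

/-- The labelled subgraphs that two edges and a vertex can form. -/
def HasPattern (G : SimpleGraph V) (n : ℕ) : Prop :=
  G.HasLabelledSubgraph (pathGraph 2 ⊕g pathGraph 2 ⊕g pathGraph 1)
      (Sum.elim (Sum.elim ![6, 6] ![6, 6]) ![n]) ∨
    G.HasLabelledSubgraph (pathGraph 3 ⊕g pathGraph 1) (Sum.elim ![6, 7, 6] ![n]) ∨
    G.HasLabelledSubgraph (pathGraph 2 ⊕g pathGraph 2) (Sum.elim ![6, 6] ![6, n + 1]) ∨
    G.HasLabelledSubgraph (pathGraph 3) ![6, 7, n + 1] ∨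
    G.HasLabelledSubgraph (pathGraph 3) ![6, n + 2, 6]

/-- The two edges are those of the pattern, and `N` is the vertex labelled `n`, `n + 1` or `n + 2`,
according to how many of them contain it. Every other label is five plus the number of incident
edges. -/
theorem HasPattern.exists_twoEdges (h : G.HasPattern n) :
    ∃ N u₁ w₁ u₂ w₂, G.TwoEdges n N u₁ w₁ u₂ w₂ := by
  classical
  rcases h with h | h | h | h | h
  all_goals
    obtain ⟨f, hf, ha, hl, h5⟩ := hasLabelledSubgraph_iff.1 h
  · refine ⟨f (.inr 0), f (.inl (.inl 0)), f (.inl (.inl 1)), f (.inl (.inr 0)), f (.inl (.inr 1)),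
      ha _ _ (by simp [pathGraph_adj]), ha _ _ (by simp [pathGraph_adj]), by simp [hf.eq_iff],
      fun v => ?_⟩
    by_cases hv : ∃ w, v = f w
    · obtain ⟨(w | w) | w, rfl⟩ := hv <;> rw [hl] <;> fin_cases w <;> simp [hf.eq_iff]
    · push Not at hv
      simp [h5 v hv, hv]
  · refine ⟨f (.inr 0), f (.inl 0), f (.inl 1), f (.inl 1), f (.inl 2),
      ha _ _ (by simp [pathGraph_adj]), ha _ _ (by simp [pathGraph_adj]), by simp [hf.eq_iff],
      fun v => ?_⟩
    by_cases hv : ∃ w, v = f w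
    · obtain ⟨w | w, rfl⟩ := hv <;> rw [hl] <;> fin_cases w <;> simp [hf.eq_iff]
    · push Not at hv
      simp [h5 v hv, hv]
  · refine ⟨f (.inr 1), f (.inl 0), f (.inl 1), f (.inr 0), f (.inr 1),
      ha _ _ (by simp [pathGraph_adj]), ha _ _ (by simp [pathGraph_adj]), by simp [hf.eq_iff],
      fun v => ?_⟩
    by_cases hv : ∃ w, v = f w
    · obtain ⟨w | w, rfl⟩ := hv <;> rw [hl] <;> fin_cases w <;> simp [hf.eq_iff]
    · push Not at hv
      simp [h5 v hv, hv]
  · refine ⟨f 2, f 0, f 1, f 1, f 2,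
      ha _ _ (by simp [pathGraph_adj]), ha _ _ (by simp [pathGraph_adj]), by simp [hf.eq_iff],
      fun v => ?_⟩
    by_cases hv : ∃ w, v = f w
    · obtain ⟨w, rfl⟩ := hv
      rw [hl]
      fin_cases w <;> simp [hf.eq_iff]
    · push Not at hv
      simp [h5 v hv, hv]
  · refine ⟨f 1, f 0, f 1, f 1, f 2,
      ha _ _ (by simp [pathGraph_adj]), ha _ _ (by simp [pathGraph_adj]), by simp [hf.eq_iff],
      fun v => ?_⟩
    by_cases hv : ∃ w, v = f w
    · obtain ⟨w, rfl⟩ := hv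
      rw [hl]
      fin_cases w <;> simp [hf.eq_iff]
    · push Not at hv
      simp [h5 v hv, hv]

namespace TwoEdges

variable {N u₁ w₁ u₂ w₂ : V}

theorem symm (h : G.TwoEdges n N u₁ w₁ u₂ w₂) : G.TwoEdges n N u₂ w₂ u₁ w₁ :=
  ⟨h.adj₂, h.adj₁, h.ne.symm, fun v => by rw [h.ncard v, add_right_comm]⟩

theorem flip (h : G.TwoEdges n N u₁ w₁ u₂ w₂) : G.TwoEdges n N w₁ u₁ u₂ w₂ :=
  ⟨h.adj₁.symm, h.adj₂, by rw [Sym2.eq_swap]; exact h.ne, fun v => by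
    classical
    rw [h.ncard v, if_congr (or_comm (a := v = u₁)) rfl rfl]⟩

/-- Two edges with a common vertex `c` and `N` at the far end of one of them: pattern (iv). -/
theorem hasPattern_of_end {c : V} (h : G.TwoEdges n N u₁ c c N) : G.HasPattern n := by
  classical
  have h1 := h.adj₁.ne
  have h2 := h.adj₂.ne
  have h3 : u₁ ≠ N := fun h' => h.ne (by rw [h', Sym2.eq_swap])
  refine .inr (.inr (.inr (.inl (hasLabelledSubgraph_iff.2 ⟨![u₁, c, N], ?_, ?_, ?_, ?_⟩))))
  · intro a b
    fin_cases a <;> fin_cases b <;> simp [h1, h2, h3, h1.symm, h2.symm, h3.symm]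
  · intro a b
    fin_cases a <;> fin_cases b <;> simp [pathGraph_adj, h.adj₁, h.adj₂, h.adj₁.symm, h.adj₂.symm]
  · intro a
    rw [h.ncard]
    fin_cases a <;> simp [h1, h2, h3, h1.symm, h2.symm, h3.symm]
  · intro v hv
    simp only [Fin.forall_fin_succ] at hv
    rw [h.ncard]
    simp_all

/-- Two edges with a common vertex `c`: pattern (iv), (v) or (ii) when `N` is an end of the path,
its middle, or off the path. -/
theorem hasPattern_of_common {c : V} (h : G.TwoEdges n N u₁ c c w₂) : G.HasPattern n := by
  classical
  by_cases e1 : N = w₂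
  · subst e1
    exact h.hasPattern_of_end
  by_cases e2 : N = u₁
  · subst e2
    exact h.flip.symm.flip.hasPattern_of_end
  have h1 := h.adj₁.ne
  have h2 := h.adj₂.ne
  have h3 : u₁ ≠ w₂ := fun h' => h.ne (by rw [h', Sym2.eq_swap])
  by_cases e3 : N = c
  · subst e3
    refine .inr (.inr (.inr (.inr (hasLabelledSubgraph_iff.2 ⟨![u₁, N, w₂], ?_, ?_, ?_, ?_⟩))))
    · intro a b
      fin_cases a <;> fin_cases b <;> simp [h1, h2, h3, h1.symm, h2.symm, h3.symm]
    · intro a b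
      fin_cases a <;> fin_cases b <;> simp [pathGraph_adj, h.adj₁, h.adj₂, h.adj₁.symm, h.adj₂.symm]
    · intro a
      rw [h.ncard]
      fin_cases a <;> simp [h1, h2, h3, h1.symm, h2.symm, h3.symm]
    · intro v hv
      simp only [Fin.forall_fin_succ] at hv
      rw [h.ncard]
      simp_all
  · refine .inr (.inl (hasLabelledSubgraph_iff.2 ⟨Sum.elim ![u₁, c, w₂] ![N], ?_, ?_, ?_, ?_⟩))
    · rintro (a | a) (b | b) <;> fin_cases a <;> fin_cases b <;>
        simp [h1, h2, h3, h1.symm, h2.symm, h3.symm, e1, e2, e3, Ne.symm e1, Ne.symm e2, Ne.symm e3]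
    · rintro (a | a) (b | b) <;> fin_cases a <;> fin_cases b <;>
        simp [pathGraph_adj, h.adj₁, h.adj₂, h.adj₁.symm, h.adj₂.symm]
    · intro a
      rw [h.ncard]
      rcases a with a | a <;> fin_cases a <;>
        simp [h1, h2, h3, h1.symm, h2.symm, h3.symm, e1, e2, e3, Ne.symm e1, Ne.symm e2, Ne.symm e3]
    · intro v hv
      simp only [Sum.forall, Fin.forall_fin_succ] at hv
      rw [h.ncard]
      simp_all

/-- Disjoint edges with `N` on one of them: pattern (iii). -/
theorem hasPattern_of_mem (h : G.TwoEdges n N u₁ w₁ u₂ N) (e1 : w₁ ≠ u₂) (e2 : w₁ ≠ N)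
    (e3 : u₁ ≠ u₂) (e4 : u₁ ≠ N) : G.HasPattern n := by
  classical
  have h1 := h.adj₁.ne
  have h2 := h.adj₂.ne
  refine .inr (.inr (.inl (hasLabelledSubgraph_iff.2
    ⟨Sum.elim ![u₁, w₁] ![u₂, N], ?_, ?_, ?_, ?_⟩)))
  · rintro (a | a) (b | b) <;> fin_cases a <;> fin_cases b <;>
      simp [h1, h2, h1.symm, h2.symm, e1, e2, e3, e4, e1.symm, e2.symm, e3.symm, e4.symm]
  · rintro (a | a) (b | b) <;> fin_cases a <;> fin_cases b <;>
      simp [pathGraph_adj, h.adj₁, h.adj₂, h.adj₁.symm, h.adj₂.symm]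
  · intro a
    rw [h.ncard]
    rcases a with a | a <;> fin_cases a <;>
      simp [h1, h2, h1.symm, h2.symm, e1, e2, e3, e4, e1.symm, e2.symm, e3.symm, e4.symm]
  · intro v hv
    simp only [Sum.forall, Fin.forall_fin_succ] at hv
    rw [h.ncard]
    simp_all

/-- Exchanging the two edges and reversing each of them reduces every coincidence among the four
ends and `N` to one of the preceding cases. Without any coincidence, pattern (i) remains. -/
theorem hasPattern (h : G.TwoEdges n N u₁ w₁ u₂ w₂) : G.HasPattern n := by
  classical
  by_cases e1 : w₁ = u₂
  · subst e1; exact h.hasPattern_of_common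
  by_cases e2 : w₁ = w₂
  · subst e2; exact h.symm.flip.symm.hasPattern_of_common
  by_cases e3 : u₁ = u₂
  · subst e3; exact h.flip.hasPattern_of_common
  by_cases e4 : u₁ = w₂
  · subst e4; exact h.flip.symm.flip.symm.hasPattern_of_common
  by_cases f1 : N = w₂
  · subst f1; exact h.hasPattern_of_mem e1 e2 e3 e4
  by_cases f2 : N = u₂
  · subst f2; exact h.symm.flip.symm.hasPattern_of_mem e2 e1 e4 e3
  by_cases f3 : N = w₁
  · subst f3; exact h.symm.hasPattern_of_mem (Ne.symm e4) (Ne.symm e2) (Ne.symm e3) (Ne.symm e1)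
  by_cases f4 : N = u₁
  · subst f4
    exact h.flip.symm.hasPattern_of_mem (Ne.symm e2) (Ne.symm e4) (Ne.symm e1) (Ne.symm e3)
  have h1 := h.adj₁.ne
  have h2 := h.adj₂.ne
  refine .inl (hasLabelledSubgraph_iff.2
    ⟨Sum.elim (Sum.elim ![u₁, w₁] ![u₂, w₂]) ![N], ?_, ?_, ?_, ?_⟩)
  · rintro ((a | a) | a) ((b | b) | b) <;> fin_cases a <;> fin_cases b <;>
      simp [h1, h2, h1.symm, h2.symm, e1, e2, e3, e4, f1, f2, f3, f4, Ne.symm e1, Ne.symm e2,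
        Ne.symm e3, Ne.symm e4, Ne.symm f1, Ne.symm f2, Ne.symm f3, Ne.symm f4]
  · rintro ((a | a) | a) ((b | b) | b) <;> fin_cases a <;> fin_cases b <;>
      simp [pathGraph_adj, h.adj₁, h.adj₂, h.adj₁.symm, h.adj₂.symm]
  · intro a
    rw [h.ncard]
    rcases a with (a | a) | a <;> fin_cases a <;>
      simp [h1, h2, h1.symm, h2.symm, e1, e2, e3, e4, f1, f2, f3, f4, Ne.symm e1, Ne.symm e2,
        Ne.symm e3, Ne.symm e4, Ne.symm f1, Ne.symm f2, Ne.symm f3, Ne.symm f4]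
  · intro v hv
    simp only [Sum.forall, Fin.forall_fin_succ] at hv
    rw [h.ncard]
    simp_all

end TwoEdges

end SimpleGraph

theorem mainTheorem8 (n : ℕ) (hn : 3 ≤ n) (hn5 : n ≠ 5) :
    (∃ (V : Type) (_ : Finite V) (G : PlaneGraph V),
      G.graph.IsVertexConnected 3 ∧ G.IsPentagulation n (n + 10)) ↔
    (∃ (V : Type) (_ : Finite V) (H : PlaneGraph V), H.IsTriangulation ∧
      (H.graph.HasLabelledSubgraph
          (SimpleGraph.pathGraph 2 ⊕g SimpleGraph.pathGraph 2 ⊕g SimpleGraph.pathGraph 1)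
          (Sum.elim (Sum.elim ![6, 6] ![6, 6]) ![n]) ∨
       H.graph.HasLabelledSubgraph
          (SimpleGraph.pathGraph 3 ⊕g SimpleGraph.pathGraph 1)
          (Sum.elim ![6, 7, 6] ![n]) ∨
       H.graph.HasLabelledSubgraph
          (SimpleGraph.pathGraph 2 ⊕g SimpleGraph.pathGraph 2)
          (Sum.elim ![6, 6] ![6, n + 1]) ∨
       H.graph.HasLabelledSubgraph (SimpleGraph.pathGraph 3) ![6, 7, n + 1] ∨
       H.graph.HasLabelledSubgraph (SimpleGraph.pathGraph 3) ![6, n + 2, 6])) := by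
  constructor
  · rintro ⟨V, _, G, hG, h⟩
    have := DartMap.finite_dart G.graph
    have : Finite G.Face := Quotient.finite _
    obtain ⟨N, hN⟩ := PlaneGraph.dualDartMap_isNear hG h
    obtain ⟨H, u₁, w₁, u₂, w₂, hH, hT⟩ :=
      hN.exists_triangulation hn (PlaneGraph.dualDartMap_chordFree hG)
    exact ⟨_, inferInstance, H, hH, hT.hasPattern⟩
  · rintro ⟨V, _, H, hH, h⟩
    obtain ⟨N, u₁, w₁, u₂, w₂, hT⟩ := SimpleGraph.HasPattern.exists_twoEdges h
    exact hH.exists_pentagulation hn hT
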